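/- Let $k$ be a field. A graded $k$-algebra $A=\bigoplus_{n\ge 0}A_n$ is called quadratic if $A\cong T(V)/(W)$ with $V=A_1$ and $W\subseteq V\otimes V$. A rank-two quadric is a closed subscheme $Q=\mathcal V(\ell_1\ell_2)\subset\mathbb P^3_k$, where $\ell_1,\ell_2$ are linearly independent linear forms over $k$. For a $k$-automorphism $\tau$ of $Q$ and an invertible sheaf $\mathcal L$ on $Q$, the twisted homogeneous coordinate ring is the graded $k$-algebra $$S(Q,\tau,\mathcal L)=\bigoplus_{n\ge 0}H^0\bigl(Q,\ \mathcal L\otimes\tau^*\mathcal L\otimes\cdots\otimes(\tau^{n-1})^*\mathcal L\bigr),\qquad s\cdot t=s\otimes(\tau^m)^*t\quad\text{for } s\in S_m,\ t\in S_n .$$ **Proposition.** Let $A$ be a quadratic $k$-algebra which is a domain, and let $\Omega\in A_2$ be such that $A/\langle\Omega\rangle\cong S(Q,\tau,\mathcal L)$ as graded $k$-algebras, where $Q$ is a rank-two quadric, $\tau$ is a $k$-automorphism of $Q$, $\mathcal L$ is an invertible sheaf on $Q$, and $\langle\Omega\rangle$ is the two-sided ideal generated by $\Omega$. Then $\Omega$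 is normal in $A$, that is, $\Omega A=A\Omega$. The hypothesis that $A$ is a domain cannot be dropped: over every field $k$ there are a rank-two quadric $Q$, an invertible sheaf $\mathcal L$ on $Q$, a quadratic $k$-algebra $A$ which is not a domain, and $\Omega\in A_2$ with $A/\langle\Omega\rangle\cong S(Q,\mathrm{id},\mathcal L)$ as graded $k$-algebras, such that $\Omega$ is not normal in $A$. -/

import Mathlib

open CategoryTheory AlgebraicGeometry TopologicalSpace Opposite

universe u v

noncomputable section

namespace TwistedQuadric

/-! ### Quadratic algebras and normal elements -/

/-- A graded algebra `A = ⨁ 𝒜 n` is quadratic if it is `T(V)/(W)` with `V = 𝒜 1` and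
`W ⊆ V ⊗ V`: the canonical map `T(𝒜 1) → A` is onto, and its kernel is generated, as a two-sided
ideal, by homogeneous tensors of degree two. In particular `𝒜 0 = k`. -/
def IsQuadratic {k : Type u} [Field k] {A : Type v} [Ring A] [Algebra k A]
    (𝒜 : ℕ → Submodule k A) : Prop :=
  Function.Surjective (TensorAlgebra.lift k (𝒜 1).subtype) ∧
    ∀ t : TensorAlgebra k (𝒜 1), TensorAlgebra.lift k (𝒜 1).subtype t = 0 ↔
      t ∈ TwoSidedIdeal.span
        {r : TensorAlgebra k (𝒜 1) |
          r ∈ LinearMap.range (TensorAlgebra.ι k (M := 𝒜 1)) ^ 2 ∧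
            TensorAlgebra.lift k (𝒜 1).subtype r = 0}

/-- `Ω` is normal in `A` if `ΩA = AΩ`. -/
def IsNormalElement {A : Type v} [Ring A] (Ω : A) : Prop :=
  {x : A | ∃ a, x = Ω * a} = {x : A | ∃ a, x = a * Ω}

/-! ### The quotient of a graded algebra by a homogeneous ideal -/

section QuotientGrading

variable {k : Type u} [Field k] {R : Type u} [CommRing R] [Algebra k R]
  (𝒜 : ℕ → Submodule k R) (I : Ideal R)

/-- The grading induced on `R ⧸ I`: the images of the graded pieces of `R`. -/
def quotientGrading (n : ℕ) : Submodule k (R ⧸ I) :=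
  (𝒜 n).map (Ideal.Quotient.mkₐ k I).toLinearMap

/-- The projection `𝒜 n → (R ⧸ I)_n`. -/
def quotientGradingMk (n : ℕ) : 𝒜 n →ₗ[k] quotientGrading 𝒜 I n :=
  (Ideal.Quotient.mkₐ k I).toLinearMap.restrict fun _ hx => Submodule.mem_map_of_mem hx

variable [GradedAlgebra 𝒜]

/-- The decomposition of `R` followed by the projections to the graded pieces of `R ⧸ I`. -/
def quotientDecomposeAux : R →ₗ[k] DirectSum ℕ fun n => quotientGrading 𝒜 I n :=
  (DirectSum.lmap (quotientGradingMk 𝒜 I)).comp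
    (DirectSum.decomposeLinearEquiv 𝒜).toLinearMap

lemma quotientDecomposeAux_apply (x : R) (n : ℕ) :
    ((quotientDecomposeAux 𝒜 I x n : quotientGrading 𝒜 I n) : R ⧸ I) =
      Ideal.Quotient.mk I (DirectSum.decompose 𝒜 x n : R) := by
  simp only [quotientDecomposeAux, LinearMap.comp_apply, DirectSum.lmap_apply]
  rfl

lemma quotientDecomposeAux_coe {n : ℕ} (x : 𝒜 n) :
    quotientDecomposeAux 𝒜 I (x : R) = DirectSum.of _ n (quotientGradingMk 𝒜 I n x) := by
  simp only [quotientDecomposeAux, LinearMap.comp_apply, LinearEquiv.coe_coe,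
    DirectSum.decomposeLinearEquiv_apply, DirectSum.decompose_coe]
  exact DirectSum.lmap_lof _ _ _

lemma quotientDecomposeAux_eq_zero (hI : I.IsHomogeneous 𝒜) {x : R} (hx : x ∈ I) :
    quotientDecomposeAux 𝒜 I x = 0 := by
  ext n
  rw [quotientDecomposeAux_apply]
  simpa using Ideal.Quotient.eq_zero_iff_mem.mpr (hI n hx)

/-- The decomposition of `R ⧸ I` into its graded pieces. -/
def quotientDecompose (hI : I.IsHomogeneous 𝒜) :
    R ⧸ I →+ DirectSum ℕ fun n => quotientGrading 𝒜 I n :=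
  QuotientAddGroup.lift I.toAddSubgroup (quotientDecomposeAux 𝒜 I).toAddMonoidHom
    fun _ hx => quotientDecomposeAux_eq_zero 𝒜 I hI hx

/-- `R ⧸ I` is graded when `I` is homogeneous. -/
@[reducible] def quotientGradedAlgebra (hI : I.IsHomogeneous 𝒜) :
    GradedAlgebra (quotientGrading 𝒜 I) where
  one_mem := ⟨1, SetLike.GradedOne.one_mem, by simp⟩
  mul_mem := by
    rintro i j _ _ ⟨a, ha, rfl⟩ ⟨b, hb, rfl⟩
    exact ⟨a * b, SetLike.GradedMul.mul_mem ha hb, by simp⟩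
  toDecomposition := DirectSum.Decomposition.ofAddHom _ (quotientDecompose 𝒜 I hI)
    (by
      refine AddMonoidHom.ext fun y => ?_
      obtain ⟨x, rfl⟩ := Ideal.Quotient.mk_surjective y
      change DirectSum.coeAddMonoidHom _ (quotientDecomposeAux 𝒜 I x) = Ideal.Quotient.mk I x
      induction x using DirectSum.Decomposition.inductionOn 𝒜 with
      | zero => simp
      | homogeneous m => rw [quotientDecomposeAux_coe, DirectSum.coeAddMonoidHom_of]; rfl
      | add a b ha hb => rw [map_add, map_add, ha, hb, map_add])
    (by
      refine DirectSum.addHom_ext fun n ⟨y, hy⟩ => ?_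
      obtain ⟨x, hx, rfl⟩ := hy
      simp only [AddMonoidHom.comp_apply, DirectSum.coeAddMonoidHom_of, AddMonoidHom.id_apply]
      exact quotientDecomposeAux_coe 𝒜 I ⟨x, hx⟩)

end QuotientGrading

/-! ### Rank-two quadrics in `ℙ³` -/

/-- A (split) rank-two quadric in `ℙ³`: the zero scheme `V(ℓ₁ℓ₂)` of the product of two linearly
independent linear forms in four variables, i.e. the union of two distinct planes. -/
structure RankTwoQuadric (k : Type u) [Field k] where
  l₁ : MvPolynomial (Fin 4) k
  l₂ : MvPolynomial (Fin 4) k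
  hom₁ : l₁.IsHomogeneous 1
  hom₂ : l₂.IsHomogeneous 1
  linearIndependent : LinearIndependent k ![l₁, l₂]

namespace RankTwoQuadric

variable {k : Type u} [Field k] (Q : RankTwoQuadric k)

/-- The homogeneous ideal `(ℓ₁ℓ₂)` of `k[x₀, x₁, x₂, x₃]`. -/
def ideal : Ideal (MvPolynomial (Fin 4) k) := Ideal.span {Q.l₁ * Q.l₂}

attribute [local instance] MvPolynomial.gradedAlgebra

lemma ideal_isHomogeneous :
    Q.ideal.IsHomogeneous (MvPolynomial.homogeneousSubmodule (Fin 4) k) :=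
  Ideal.homogeneous_span _ _ <| by
    rintro _ rfl
    exact ⟨2, Q.hom₁.mul Q.hom₂⟩

/-- The (commutative) homogeneous coordinate ring `S(Q) = k[x₀, x₁, x₂, x₃]/(ℓ₁ℓ₂)`. -/
abbrev CoordinateRing : Type u := MvPolynomial (Fin 4) k ⧸ Q.ideal

/-- The grading of `S(Q)` by degree. -/
def grading : ℕ → Submodule k Q.CoordinateRing :=
  quotientGrading (MvPolynomial.homogeneousSubmodule (Fin 4) k) Q.ideal

instance : GradedAlgebra Q.grading :=
  quotientGradedAlgebra _ Q.ideal Q.ideal_isHomogeneous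

/-- The quadric as a scheme, `Q = Proj S(Q)`. -/
def scheme : Scheme.{u} := Proj Q.grading

/-- The structure morphism `Q → Spec k`. -/
def toSpec : Q.scheme ⟶ Spec (.of k) :=
  Proj.toSpecZero Q.grading ≫ Spec.map (CommRingCat.ofHom (algebraMap k (Q.grading 0)))

end RankTwoQuadric

/-! ### Invertible sheaves -/

/-- An invertible sheaf on a scheme, given by its transition functions with respect to an open
cover `(U i)` on which it is trivial. Its sections over `V` are the families
`s i ∈ Γ(X, V ∩ U i)` with `s i = g i j * s j` on `V ∩ U i ∩ U j`. (The transition functions are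
units, `g i j` being inverse to `g j i`, and every invertible sheaf arises in this way.) -/
structure InvertibleSheaf (X : Scheme.{u}) where
  /-- the indices of the trivializing cover -/
  ι : Type u
  /-- the trivializing cover -/
  U : ι → X.Opens
  iSup_U : ⨆ i, U i = ⊤
  /-- the transition functions -/
  g : ∀ i j, Γ(X, U i ⊓ U j)
  g_self : ∀ i, g i i = 1
  g_mul : ∀ i j l,
    X.presheaf.map (homOfLE (inf_le_left : U i ⊓ U j ⊓ U l ≤ U i ⊓ U j)).op (g i j) *
      X.presheaf.map (homOfLE (inf_le_inf_right (U l) inf_le_right :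
        U i ⊓ U j ⊓ U l ≤ U j ⊓ U l)).op (g j l) =
      X.presheaf.map (homOfLE (inf_le_inf_right (U l) inf_le_left :
        U i ⊓ U j ⊓ U l ≤ U i ⊓ U l)).op (g i l)

/-! ### Twisted homogeneous coordinate rings -/

section Twisted

variable {X : Scheme.{u}}

/-- The `n`-th iterate `σⁿ` of an endomorphism. -/
def iter (σ : X ⟶ X) : ℕ → (X ⟶ X)
  | 0 => 𝟙 X
  | n + 1 => iter σ n ≫ σ

lemma iter_add (σ : X ⟶ X) (m n : ℕ) : iter σ (m + n) = iter σ m ≫ iter σ n := by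
  induction n with
  | zero => simp [iter]
  | succ n ih => rw [← add_assoc, iter, ih, iter, Category.assoc]

namespace InvertibleSheaf

variable (L : InvertibleSheaf X) (σ : X ⟶ X)

/-- The open sets `U (w 0) ∩ σ⁻¹ U (w 1) ∩ ⋯ ∩ σ⁻⁽ⁿ⁻¹⁾ U (w (n - 1))`, which trivialize
`L ⊗ σ^*L ⊗ ⋯ ⊗ (σⁿ⁻¹)^*L`. Only the first `n` entries of `w` matter. -/
def opens (n : ℕ) (w : ℕ → L.ι) : X.Opens :=
  Finset.univ.inf fun j : Fin n => iter σ j ⁻¹ᵁ L.U (w j)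

lemma opens_le {n : ℕ} (w : ℕ → L.ι) (j : Fin n) :
    L.opens σ n w ≤ iter σ j ⁻¹ᵁ L.U (w j) :=
  Finset.inf_le (f := fun j : Fin n => iter σ j ⁻¹ᵁ L.U (w j)) (Finset.mem_univ j)

lemma le_opens {n : ℕ} {w : ℕ → L.ι} {V : X.Opens}
    (h : ∀ j : ℕ, j < n → V ≤ iter σ j ⁻¹ᵁ L.U (w j)) : V ≤ L.opens σ n w :=
  Finset.le_inf fun j _ => h j j.2

lemma inf_opens_le {n : ℕ} (w w' : ℕ → L.ι) (j : Fin n) :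
    L.opens σ n w ⊓ L.opens σ n w' ≤ iter σ j ⁻¹ᵁ (L.U (w j) ⊓ L.U (w' j)) :=
  inf_le_inf (L.opens_le σ w j) (L.opens_le σ w' j)

/-- The transition functions of `L ⊗ σ^*L ⊗ ⋯ ⊗ (σⁿ⁻¹)^*L`: the product of the functions
`(σʲ)^* g (w j) (w' j)` for `j < n`. -/
def trans (n : ℕ) (w w' : ℕ → L.ι) : Γ(X, L.opens σ n w ⊓ L.opens σ n w') :=
  ∏ j : Fin n, ((iter σ j).appLE (L.U (w j) ⊓ L.U (w' j)) (L.opens σ n w ⊓ L.opens σ n w')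
    (L.inf_opens_le σ w w' j)) (L.g (w j) (w' j))

/-- The group of global sections of `Lₙ = L ⊗ σ^*L ⊗ ⋯ ⊗ (σⁿ⁻¹)^*L`. -/
def sections (n : ℕ) : AddSubgroup (∀ w : ℕ → L.ι, Γ(X, L.opens σ n w)) where
  carrier := {s | ∀ w w' : ℕ → L.ι,
    X.presheaf.map (homOfLE inf_le_left).op (s w) =
      L.trans σ n w w' * X.presheaf.map (homOfLE inf_le_right).op (s w')}
  zero_mem' w w' := by simp
  add_mem' {s t} hs ht w w' := by
    simp only [Pi.add_apply, map_add, hs w w', ht w w', mul_add]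
  neg_mem' {s} hs w w' := by
    simp only [Pi.neg_apply, map_neg, hs w w', mul_neg]

/-! The product of `s ∈ Γ(Lₘ)` and `t ∈ Γ(Lₙ)` is `s ⊗ (σᵐ)^*t ∈ Γ(Lₘ₊ₙ)`. -/

lemma opens_add_le_left (m n : ℕ) (w : ℕ → L.ι) : L.opens σ (m + n) w ≤ L.opens σ m w :=
  L.le_opens σ fun j hj => L.opens_le σ w (⟨j, by omega⟩ : Fin (m + n))

lemma opens_add_le_right (m n : ℕ) (w : ℕ → L.ι) :
    L.opens σ (m + n) w ≤ iter σ m ⁻¹ᵁ L.opens σ n fun i => w (m + i) := by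
  intro x hx
  have key : ∀ (N : ℕ) (v : ℕ → L.ι) (y : X), y ∈ L.opens σ N v ↔
      ∀ j : Fin N, iter σ j y ∈ L.U (v j) := by
    intro N v y
    constructor
    · intro hy j
      exact L.opens_le σ v j hy
    · intro hy
      simpa [opens, ← SetLike.mem_coe, Opens.coe_finset_inf] using hy
  rw [Scheme.Hom.mem_preimage, key]
  intro j
  have h := (key _ _ _).1 hx ⟨m + j, by omega⟩
  simpa [iter_add] using h

lemma inf_opens_add_le_left (m n : ℕ) (w w' : ℕ → L.ι) :
    L.opens σ (m + n) w ⊓ L.opens σ (m + n) w' ≤ L.opens σ m w ⊓ L.opens σ m w' :=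
  inf_le_inf (L.opens_add_le_left σ m n w) (L.opens_add_le_left σ m n w')

lemma inf_opens_add_le_right (m n : ℕ) (w w' : ℕ → L.ι) :
    L.opens σ (m + n) w ⊓ L.opens σ (m + n) w' ≤
      iter σ m ⁻¹ᵁ ((L.opens σ n fun i => w (m + i)) ⊓ L.opens σ n fun i => w' (m + i)) :=
  inf_le_inf (L.opens_add_le_right σ m n w) (L.opens_add_le_right σ m n w')

lemma appLE_map_apply {Y : Scheme.{u}} (f : Y ⟶ X) {U : X.Opens} {V V' : Y.Opens}
    (e : V ≤ f ⁻¹ᵁ U) (i : V' ≤ V) (x : Γ(X, U)) :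
    Y.presheaf.map (homOfLE i).op (f.appLE U V e x) = f.appLE U V' (i.trans e) x := by
  rw [← CommRingCat.comp_apply, Scheme.Hom.appLE_map]

lemma map_appLE_apply {Y : Scheme.{u}} (f : Y ⟶ X) {U U' : X.Opens} {V : Y.Opens}
    (e : V ≤ f ⁻¹ᵁ U) (i : U ≤ U') (x : Γ(X, U')) :
    f.appLE U V e (X.presheaf.map (homOfLE i).op x) =
      f.appLE U' V (e.trans (f.preimage_mono i)) x := by
  rw [← CommRingCat.comp_apply, Scheme.Hom.map_appLE]

lemma appLE_appLE_apply (m n : ℕ) {U V W : X.Opens} (e₁ : V ≤ iter σ n ⁻¹ᵁ U)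
    (e₂ : W ≤ iter σ m ⁻¹ᵁ V) (e : W ≤ iter σ (m + n) ⁻¹ᵁ U) (x : Γ(X, U)) :
    (iter σ m).appLE V W e₂ ((iter σ n).appLE U V e₁ x) = (iter σ (m + n)).appLE U W e x := by
  rw [← CommRingCat.comp_apply, Scheme.Hom.appLE_comp_appLE]
  have key : ∀ (f g : X ⟶ X) (h : f = g) (e : W ≤ f ⁻¹ᵁ U) (e' : W ≤ g ⁻¹ᵁ U),
      f.appLE U W e = g.appLE U W e' := by
    rintro f _ rfl _ _; rfl
  rw [key _ _ (iter_add σ m n).symm _ e]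

lemma map_map_apply {U V W : X.Opens} (i : V ≤ U) (j : W ≤ V) (x : Γ(X, U)) :
    X.presheaf.map (homOfLE j).op (X.presheaf.map (homOfLE i).op x) =
      X.presheaf.map (homOfLE (j.trans i)).op x := by
  rw [← CommRingCat.comp_apply, ← Functor.map_comp]
  rfl

lemma id_appLE_apply {U V : X.Opens} (e : V ≤ 𝟙 X ⁻¹ᵁ U) (e' : V ≤ U) (x : Γ(X, U)) :
    (𝟙 X : X ⟶ X).appLE U V e x = X.presheaf.map (homOfLE e').op x := by
  have : (𝟙 X : X ⟶ X).appLE U V e = X.presheaf.map (homOfLE e').op := by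
    simp only [Scheme.Hom.appLE, Scheme.Hom.id_app]
    exact Category.id_comp _
  rw [this]

lemma map_congr {n : ℕ} (s : ∀ w : ℕ → L.ι, Γ(X, L.opens σ n w)) {v w : ℕ → L.ι} (h : v = w)
    {U : X.Opens} (e : U ≤ L.opens σ n v) (e' : U ≤ L.opens σ n w) :
    X.presheaf.map (homOfLE e).op (s v) = X.presheaf.map (homOfLE e').op (s w) := by
  subst h; rfl

lemma appLE_congr {n m m' : ℕ} (s : ∀ w : ℕ → L.ι, Γ(X, L.opens σ n w)) (hm : m = m')
    {v w : ℕ → L.ι} (h : v = w) {U : X.Opens} (e : U ≤ iter σ m ⁻¹ᵁ L.opens σ n v)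
    (e' : U ≤ iter σ m' ⁻¹ᵁ L.opens σ n w) :
    (iter σ m).appLE _ U e (s v) = (iter σ m').appLE _ U e' (s w) := by
  subst h hm; rfl

lemma trans_add (m n : ℕ) (w w' : ℕ → L.ι) :
    L.trans σ (m + n) w w' =
      X.presheaf.map (homOfLE (L.inf_opens_add_le_left σ m n w w')).op (L.trans σ m w w') *
      (iter σ m).appLE _ _ (L.inf_opens_add_le_right σ m n w w')
        (L.trans σ n (fun i => w (m + i)) fun i => w' (m + i)) := by
  simp only [trans, map_prod]
  rw [Fin.prod_univ_add]
  congr 1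
  · refine Finset.prod_congr rfl fun j _ => ?_
    rw [appLE_map_apply]
    rfl
  · refine Finset.prod_congr rfl fun j _ => ?_
    exact (appLE_appLE_apply σ m j _ _ _ _).symm

/-- The product `Γ(Lₘ) × Γ(Lₙ) → Γ(Lₘ₊ₙ)`, `(s, t) ↦ s ⊗ (σᵐ)^*t`. -/
def mul {m n : ℕ} (s : L.sections σ m) (t : L.sections σ n) : L.sections σ (m + n) :=
  ⟨fun w => X.presheaf.map (homOfLE (L.opens_add_le_left σ m n w)).op (s.1 w) *
      (iter σ m).appLE _ _ (L.opens_add_le_right σ m n w) (t.1 fun i => w (m + i)), by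
    intro w w'
    have hs := congrArg (X.presheaf.map (homOfLE (L.inf_opens_add_le_left σ m n w w')).op) (s.2 w w')
    have ht := congrArg ((iter σ m).appLE _ _ (L.inf_opens_add_le_right σ m n w w')) (t.2 (fun i => w (m + i)) fun i => w' (m + i))
    simp only [map_mul, map_map_apply, map_appLE_apply] at hs ht
    simp only [map_mul, map_map_apply, appLE_map_apply, trans_add]
    rw [hs, ht, mul_mul_mul_comm]⟩

/-- A constant `c ∈ Γ(X, 𝒪)` as an element of `Γ(L₀)`, `L₀ = 𝒪`. -/
def const (c : Γ(X, ⊤)) : L.sections σ 0 :=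
  ⟨fun _ => X.presheaf.map (homOfLE le_top).op c, by
    intro w w'
    simp only [map_map_apply, trans, Finset.univ_eq_empty, Finset.prod_empty, one_mul]⟩

lemma mk_eq_mk {m n : ℕ} (h : m = n) (s : L.sections σ m) (t : L.sections σ n)
    (e : ∀ w, t.1 w = X.presheaf.map (homOfLE (h ▸ le_rfl : L.opens σ n w ≤ L.opens σ m w)).op
      (s.1 w)) :
    GradedMonoid.mk (A := fun n => L.sections σ n) m s = GradedMonoid.mk n t := by
  subst h
  congr 1
  ext w
  rw [e w]
  simp

instance : GradedMonoid.GMul fun n => L.sections σ n := ⟨fun s t => L.mul σ s t⟩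

instance : GradedMonoid.GOne fun n => L.sections σ n := ⟨L.const σ 1⟩

instance gRing : DirectSum.GRing fun n => L.sections σ n where
  mul_zero a := by ext w; simp [GradedMonoid.GMul.mul, mul]
  zero_mul a := by ext w; simp [GradedMonoid.GMul.mul, mul]
  mul_add a b c := by ext w; simp [GradedMonoid.GMul.mul, mul, mul_add]
  add_mul a b c := by ext w; simp [GradedMonoid.GMul.mul, mul, add_mul]
  one_mul := by
    rintro ⟨n, a⟩
    refine L.mk_eq_mk σ (zero_add n) (L.mul σ (L.const σ 1) a) a fun w => ?_
    have hw : (fun i => w (0 + i)) = w := by simp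
    have e : L.opens σ (0 + n) w ≤ L.opens σ n fun i => w (0 + i) := L.opens_add_le_right σ 0 n w
    have h1 := id_appLE_apply (L.opens_add_le_right σ 0 n w) e (a.1 fun i => w (0 + i))
    have h2 : (L.mul σ (L.const σ 1) a).1 w =
        X.presheaf.map (homOfLE e).op (a.1 fun i => w (0 + i)) := by
      rw [← h1]
      simp only [mul, const, map_one, one_mul]
      rfl
    rw [h2, map_map_apply, L.map_congr σ a.1 hw _ le_rfl]
    exact (ConcreteCategory.congr_hom (X.presheaf.map_id _) _).symm
  mul_one := by
    rintro ⟨n, a⟩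
    refine L.mk_eq_mk σ (add_zero n) (L.mul σ a (L.const σ 1)) a fun w => ?_
    simp only [mul, const, map_one, mul_one, map_map_apply]
    exact (ConcreteCategory.congr_hom (X.presheaf.map_id _) _).symm
  mul_assoc := by
    rintro ⟨m, a⟩ ⟨n, b⟩ ⟨p, c⟩
    refine L.mk_eq_mk σ (add_assoc m n p) (L.mul σ (L.mul σ a b) c) (L.mul σ a (L.mul σ b c))
      fun w => ?_
    simp only [mul, map_mul, map_map_apply, appLE_map_apply, map_appLE_apply, mul_assoc]
    congr 2
    have e : L.opens σ (m + (n + p)) w ≤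
        iter σ (m + n) ⁻¹ᵁ L.opens σ p fun i => w (m + (n + i)) := by
      have h := L.opens_add_le_right σ (m + n) p w
      simpa only [add_assoc] using h
    exact (appLE_appLE_apply σ m n _ _ e _).trans
      (L.appLE_congr σ c.1 rfl (by simp only [add_assoc]) _ _)
  natCast n := L.const σ n
  natCast_zero := by ext w; simp [const]
  natCast_succ n := by ext w; simp [GradedMonoid.GOne.one, const]
  intCast n := L.const σ n
  intCast_ofNat n := by simp
  intCast_negSucc_ofNat n := by ext w; simp [const]

/-- The twisted homogeneous coordinate ring
`S(X, σ, L) = ⨁ₙ Γ(X, L ⊗ σ^*L ⊗ ⋯ ⊗ (σⁿ⁻¹)^*L)`, a graded ring with product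
`s * t = s ⊗ (σᵐ)^*t` for `s` of degree `m`. -/
abbrev TwistedRing : Type u := DirectSum ℕ fun n => L.sections σ n

/-- The scalar `c ∈ k` as an element of degree zero of `S(X, σ, L)`, for `X` a scheme over `k`. -/
def scalar {k : Type u} [Field k] (p : X ⟶ Spec (.of k)) (c : k) : L.TwistedRing σ :=
  DirectSum.of (fun n => L.sections σ n) 0
    (L.const σ (p.appTop ((Scheme.ΓSpecIso (.of k)).inv c)))

/-- `A/⟨Ω⟩ ≅ S(X, σ, L)` as graded `k`-algebras: there is a surjective homomorphism of `k`-algebras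
`A → S(X, σ, L)`, homogeneous of degree zero, whose kernel is the two-sided ideal `⟨Ω⟩`. -/
def IsQuotientBy {k : Type u} [Field k] (p : X ⟶ Spec (.of k)) {A : Type v} [Ring A] [Algebra k A]
    (𝒜 : ℕ → Submodule k A) (Ω : A) : Prop :=
  ∃ φ : A →+* L.TwistedRing σ,
    (∀ c : k, φ (algebraMap k A c) = L.scalar σ p c) ∧
    (∀ n, ∀ a ∈ 𝒜 n, ∃ s : L.sections σ n,
      φ a = DirectSum.of (fun n => L.sections σ n) n s) ∧
    Function.Surjective φ ∧
    ∀ a : A, φ a = 0 ↔ a ∈ TwoSidedIdeal.span {Ω}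

end InvertibleSheaf

end Twisted

end TwistedQuadric

end

/-! The quadric `Q` is the union of two planes glued along a line. Its homogeneous coordinate ring
consists of the pairs of polynomials in `u, z, w` that agree on `u = 0` (`DoublePlane`). Every
invertible sheaf on `Q` is a twist `𝒪(d)` of the structure sheaf (`exists_isFrame`): on each plane
unique factorization trivializes a Cartier divisor up to a twist, and on the common line the two
trivializations differ by a nonzero constant, which can be scaled away. So each graded piece of
`S(Q, τ, L)` is zero or is the space of all forms of some degree on `Q` (`exists_model`). The
automorphism permutes the two planes by some `t : Bool → Bool`. Of the product, only this much is
needed: `x * y` vanishes on plane `i` exactly when `x` vanishes on plane `i` or `y` vanishes on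
plane `t i` (`exists_linear_model`).

The rest takes place in degrees one and two of `A` (`isNormalElement_of_linear_model`). The ideal
`⟨Ω⟩` is zero in degree one and is `kΩ` in degree two. So `A₁` is a space of forms of some degree,
and an element of `A₂` vanishing on both planes is a multiple of `Ω`. If `A₁` has dimension at most
one, `A` is commutative. If the forms in `A₁` have degree at least two, there are independent `s,
s'` vanishing on one plane and a nonzero `r` with `s * r` and `s' * r` both in `kΩ`; a combination
of `s` and `s'` then kills `r`, which a domain forbids. There remain the linear forms: `dim A₁ = 4`
and `dim A₂ ≤ 16`. Let `s i` be the linear form vanishing on plane `i`, and `J i` the space of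
elements of `A₂` vanishing on plane `i`. Then `Ω` is proportional to `s i * s (t !i)`. A count gives
`dim J i ≤ 1 + 3`, while `s i * A₁` and `A₁ * s (t i)` lie in `J i` and have dimension four because
`A` is a domain. Hence `s i * A₁ = J i = A₁ * s (t i)`. Moving a linear form through the two factors
of `Ω` gives `Ω * A₁ = A₁ * Ω`, and `A₁` generates `A`.

For the counterexample, let `x₀, x₁` be central with `x₀x₁ = 0`, let `x₂, x₃` be otherwise free, and
take `Ω = x₂x₃ - x₃x₂`. Modulo `Ω` the algebra becomes `k[x₀, …, x₃]/(x₀x₁) = S(Q, id, 𝒪(1))`, while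
a representation by `3 × 3` matrices shows that `x₂Ω` is not in `ΩA`. -/

noncomputable section

namespace TwistedQuadric

attribute [local instance] MvPolynomial.gradedAlgebra

/-! ### Homogeneous polynomials -/

section HomogeneousPolynomials

variable {σ k : Type*} [Field k]

/-- The map `f ↦ ∑ n, fₙ tⁿ`, where the `fₙ` are the homogeneous components of `f`. -/
def homogenization : MvPolynomial σ k →ₐ[k] Polynomial (MvPolynomial σ k) :=
  MvPolynomial.aeval fun i => Polynomial.C (MvPolynomial.X i) * Polynomial.X

lemma homogenization_monomial (d : σ →₀ ℕ) (c : k) :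
    homogenization (MvPolynomial.monomial d c) =
      Polynomial.monomial d.degree (MvPolynomial.monomial d c) := by
  rw [homogenization, MvPolynomial.aeval_monomial, MvPolynomial.monomial_eq,
    ← Polynomial.C_mul_X_pow_eq_monomial]
  simp only [mul_pow, Finsupp.prod, Finset.prod_mul_distrib, Finset.prod_pow_eq_pow_sum]
  rw [IsScalarTower.algebraMap_apply k (MvPolynomial σ k) (Polynomial (MvPolynomial σ k))]
  simp only [Polynomial.algebraMap_eq, MvPolynomial.algebraMap_eq, map_mul, map_prod, map_pow]
  rw [mul_assoc]
  rfl

lemma coeff_homogenization (f : MvPolynomial σ k) (n : ℕ) :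
    (homogenization f).coeff n = MvPolynomial.homogeneousComponent n f := by
  induction f using MvPolynomial.induction_on' with
  | monomial d c =>
    rw [homogenization_monomial, Polynomial.coeff_monomial]
    split_ifs with h
    · rw [MvPolynomial.homogeneousComponent_of_mem
        (MvPolynomial.isHomogeneous_monomial c h), if_pos rfl]
    · rw [MvPolynomial.homogeneousComponent_of_mem
        (MvPolynomial.isHomogeneous_monomial c rfl), if_neg (Ne.symm h)]
  | add p q hp hq => rw [map_add, Polynomial.coeff_add, hp, hq, map_add]

lemma homogenization_of_isHomogeneous {f : MvPolynomial σ k} {n : ℕ} (hf : f.IsHomogeneous n) :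
    homogenization f = Polynomial.monomial n f := by
  ext1 m
  rw [coeff_homogenization, Polynomial.coeff_monomial, MvPolynomial.homogeneousComponent_of_mem hf]
  simp only [eq_comm]

/-- A factor of a nonzero homogeneous polynomial is homogeneous. -/
lemma exists_isHomogeneous_of_mul {f g : MvPolynomial σ k} {n : ℕ}
    (h : (f * g).IsHomogeneous n) (h0 : f * g ≠ 0) : ∃ m, f.IsHomogeneous m := by
  have hfg := homogenization_of_isHomogeneous h
  rw [map_mul] at hfg
  have hne : homogenization f * homogenization g ≠ 0 := by
    rw [hfg]; simpa using h0
  have hf0 := left_ne_zero_of_mul hne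
  have hg0 := right_ne_zero_of_mul hne
  -- Highest and lowest degrees in `t` both add up over the factors. They coincide for the product,
  -- hence for each factor, so each factor is a single power of `t` times a coefficient.
  have hd := Polynomial.natDegree_mul hf0 hg0
  have ht := Polynomial.natTrailingDegree_mul hf0 hg0
  rw [hfg, Polynomial.natDegree_monomial_eq _ h0] at hd
  rw [hfg, Polynomial.natTrailingDegree_monomial h0] at ht
  have h1 := Polynomial.natTrailingDegree_le_natDegree (homogenization f)
  have h2 := Polynomial.natTrailingDegree_le_natDegree (homogenization g)
  refine ⟨(homogenization f).natDegree, ?_⟩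
  have key : ∀ m, m ≠ (homogenization f).natDegree → MvPolynomial.homogeneousComponent m f = 0 := by
    intro m hm
    rw [← coeff_homogenization]
    rcases lt_or_gt_of_ne hm with h | h
    · exact Polynomial.coeff_eq_zero_of_lt_natTrailingDegree (by omega)
    · exact Polynomial.coeff_eq_zero_of_natDegree_lt h
  generalize (homogenization f).natDegree = D at key ⊢
  rw [← MvPolynomial.sum_homogeneousComponent f]
  refine MvPolynomial.IsHomogeneous.sum _ _ _ fun m _ => ?_
  by_cases hm : m = D
  · rw [← hm]; exact MvPolynomial.homogeneousComponent_isHomogeneous m f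
  · rw [key m hm]; exact MvPolynomial.isHomogeneous_zero _ _ _

lemma isHomogeneous_of_mul {f g : MvPolynomial σ k} {n m : ℕ}
    (h : (f * g).IsHomogeneous n) (hf : f.IsHomogeneous m) (h0 : f ≠ 0) :
    g.IsHomogeneous (n - m) := by
  by_cases hg : g = 0
  · subst hg; exact MvPolynomial.isHomogeneous_zero _ _ _
  obtain ⟨l, hl⟩ := exists_isHomogeneous_of_mul (mul_comm f g ▸ h) (mul_ne_zero hg h0)
  have := MvPolynomial.IsHomogeneous.inj_right (hf.mul hl) h (mul_ne_zero h0 hg)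
  rwa [← this, Nat.add_sub_cancel_left]

/-- An element of a prime ideal has an irreducible factor in the ideal. -/
lemma exists_irreducible_dvd_mem {B : Type*} [CommRing B] [IsDomain B]
    [UniqueFactorizationMonoid B] {P : Ideal B} (hP : P.IsPrime) {a : B} (ha : a ∈ P) (h0 : a ≠ 0) :
    ∃ p, Irreducible p ∧ p ∣ a ∧ p ∈ P := by
  induction a using WfDvdMonoid.induction_on_irreducible with
  | zero => exact absurd rfl h0
  | unit u hu => exact absurd (P.eq_top_of_isUnit_mem ha hu) hP.ne_top
  | mul a i ha0 hi ih =>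
    rcases hP.mem_or_mem ha with h | h
    · exact ⟨i, hi, dvd_mul_right _ _, h⟩
    · obtain ⟨p, hp, hpa, hpP⟩ := ih h ha0
      exact ⟨p, hp, hpa.mul_left _, hpP⟩

lemma isUnit_of_isHomogeneous_zero {f : MvPolynomial σ k} (hf : f.IsHomogeneous 0) (h0 : f ≠ 0) :
    IsUnit f := by
  rw [← MvPolynomial.totalDegree_zero_iff_isHomogeneous,
    MvPolynomial.totalDegree_eq_zero_iff_eq_C] at hf
  rw [hf] at h0 ⊢
  exact (isUnit_iff_ne_zero.2 fun h => h0 (by rw [h, map_zero])).map MvPolynomial.C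

lemma degree_pos_of_irreducible {p : MvPolynomial σ k} {n : ℕ} (hp : Irreducible p)
    (h : p.IsHomogeneous n) : 0 < n := by
  rcases Nat.eq_zero_or_pos n with rfl | hn
  · exact absurd (isUnit_of_isHomogeneous_zero h hp.ne_zero) hp.not_isUnit
  · exact hn

instance finite_homogeneousSubmodule [Finite σ] (n : ℕ) :
    Module.Finite k (MvPolynomial.homogeneousSubmodule σ k n) :=
  Module.Finite.iff_fg.2 (MvPolynomial.homogeneousSubmodule_fg _ _ n)

lemma finrank_homogeneousSubmodule [Fintype σ] [DecidableEq σ] (n : ℕ) :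
    Module.finrank k (MvPolynomial.homogeneousSubmodule σ k n) =
      (Fintype.card σ).multichoose n := by
  rw [MvPolynomial.homogeneousSubmodule_eq_finsupp_supported,
    AddMonoidAlgebra.supported_eq_span_single]
  have hs : {d : σ →₀ ℕ | d.degree = n} = ↑(Finset.finsuppAntidiag (Finset.univ : Finset σ) n) := by
    ext d
    simp [Finset.mem_finsuppAntidiag, Finsupp.degree_eq_sum]
  have hli : LinearIndependent k
      (fun d : Finset.finsuppAntidiag (Finset.univ : Finset σ) n =>
        (MvPolynomial.monomial (d : σ →₀ ℕ) (1 : k))) :=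
    (MvPolynomial.basisMonomials σ k).linearIndependent.comp _ Subtype.val_injective
  have h := finrank_span_eq_card hli
  rw [Fintype.card_coe, Finset.card_finsuppAntidiag_nat_eq_multichoose, Finset.card_univ] at h
  rw [← h, hs]
  have hrange : Set.range (fun d : Finset.finsuppAntidiag (Finset.univ : Finset σ) n =>
      (MvPolynomial.monomial (d : σ →₀ ℕ) (1 : k))) =
      (fun d => MvPolynomial.monomial d (1 : k)) ''
        (Finset.finsuppAntidiag (Finset.univ : Finset σ) n : Set (σ →₀ ℕ)) := by
    rw [Set.image_eq_range]; rfl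
  rw [hrange]
  rfl

end HomogeneousPolynomials

/-! ### Restriction to the line `u = 0` of the plane with coordinates `u, z, w` -/

section Line

variable {k : Type*} [Field k]

/-- Restriction of polynomials in `u, z, w` to the line `u = 0`. -/
def lineRes : MvPolynomial (Fin 3) k →ₐ[k] MvPolynomial (Fin 2) k :=
  MvPolynomial.aeval (Fin.cons 0 MvPolynomial.X)

/-- A section of the restriction to the line `u = 0`. -/
def lineLift : MvPolynomial (Fin 2) k →ₐ[k] MvPolynomial (Fin 3) k :=
  MvPolynomial.rename Fin.succ

lemma lineRes_X_zero : lineRes (MvPolynomial.X 0 : MvPolynomial (Fin 3) k) = 0 := by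
  simp [lineRes]

lemma lineRes_X_succ (i : Fin 2) :
    lineRes (MvPolynomial.X i.succ : MvPolynomial (Fin 3) k) = MvPolynomial.X i := by
  simp [lineRes]

lemma lineRes_lineLift (f : MvPolynomial (Fin 2) k) : lineRes (lineLift f) = f := by
  have : (lineRes.comp lineLift : _ →ₐ[k] MvPolynomial (Fin 2) k) = AlgHom.id k _ := by
    ext i : 1
    simp [lineRes, lineLift]
  exact DFunLike.congr_fun this f

lemma lineRes_isHomogeneous {f : MvPolynomial (Fin 3) k} {n : ℕ} (hf : f.IsHomogeneous n) :
    (lineRes f).IsHomogeneous n := by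
  have := hf.aeval (τ := Fin 2) (S := k) (n := 1) (Fin.cons 0 MvPolynomial.X) (fun i => by
    refine Fin.cases ?_ (fun j => ?_) i
    · exact MvPolynomial.isHomogeneous_zero _ _ _
    · exact MvPolynomial.isHomogeneous_X _ _)
  simpa [lineRes] using this

lemma X_zero_dvd_sub_lineLift (f : MvPolynomial (Fin 3) k) :
    MvPolynomial.X 0 ∣ f - lineLift (lineRes f) := by
  induction f using MvPolynomial.induction_on with
  | C a => simp [lineRes, lineLift]
  | add p q hp hq =>
    rw [map_add, map_add, add_sub_add_comm]
    exact dvd_add hp hq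
  | mul_X p i hp =>
    have h : MvPolynomial.X 0 ∣ (MvPolynomial.X i : MvPolynomial (Fin 3) k) -
        lineLift (lineRes (MvPolynomial.X i)) := by
      refine Fin.cases ?_ (fun j => ?_) i
      · simp [lineRes]
      · simp [lineRes, lineLift]
    rw [map_mul, map_mul]
    have : p * MvPolynomial.X i - lineLift (lineRes p) * lineLift (lineRes (MvPolynomial.X i)) =
        (p - lineLift (lineRes p)) * MvPolynomial.X i + lineLift (lineRes p) *
          (MvPolynomial.X i - lineLift (lineRes (MvPolynomial.X i))) := by ring
    rw [this]
    exact dvd_add (hp.mul_right _) (h.mul_left _)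

lemma lineRes_eq_zero_iff {f : MvPolynomial (Fin 3) k} :
    lineRes f = 0 ↔ MvPolynomial.X 0 ∣ f := by
  constructor
  · intro h
    simpa [h] using X_zero_dvd_sub_lineLift f
  · rintro ⟨g, rfl⟩
    rw [map_mul, lineRes_X_zero, zero_mul]

end Line

/-! ### Values of functions on `Proj` at points -/

section Values

variable {k : Type u} [Field k] {S : Type u} [CommRing S] [Algebra k S] {𝒮 : ℕ → Submodule k S}
  [GradedAlgebra 𝒮] {K : Type*} [Field K]

instance isPrime_asHomogeneousIdeal (x : Proj 𝒮) : x.asHomogeneousIdeal.toIdeal.IsPrime :=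
  ProjectiveSpectrum.isPrime x

/-- The homomorphism from the local ring of `Proj` at `x` to a field induced by a homomorphism on
`S` under which the complement of `x` does not meet the kernel. -/
def fiberHom (x : Proj 𝒮) (φ : S →+* K) (h : ∀ a, a ∉ x.asHomogeneousIdeal → φ a ≠ 0) :
    HomogeneousLocalization.AtPrime 𝒮 x.asHomogeneousIdeal.toIdeal →+* K :=
  (IsLocalization.lift (M := x.asHomogeneousIdeal.toIdeal.primeCompl)
    (S := Localization x.asHomogeneousIdeal.toIdeal.primeCompl) (g := φ)
    (fun a => isUnit_iff_ne_zero.2 (h a a.2))).comp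
    (algebraMap (HomogeneousLocalization.AtPrime 𝒮 x.asHomogeneousIdeal.toIdeal)
      (Localization x.asHomogeneousIdeal.toIdeal.primeCompl))

lemma fiberHom_mk (x : Proj 𝒮) (φ : S →+* K) (h : ∀ a, a ∉ x.asHomogeneousIdeal → φ a ≠ 0)
    (c : HomogeneousLocalization.NumDenSameDeg 𝒮 x.asHomogeneousIdeal.toIdeal.primeCompl) :
    fiberHom x φ h (HomogeneousLocalization.mk c) * φ c.den = φ c.num := by
  simp only [fiberHom, RingHom.comp_apply, HomogeneousLocalization.algebraMap_apply,
    HomogeneousLocalization.val_mk, Localization.mk_eq_mk']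
  rw [mul_comm]
  exact ((IsLocalization.lift_mk'_spec (M := x.asHomogeneousIdeal.toIdeal.primeCompl)
    (S := Localization x.asHomogeneousIdeal.toIdeal.primeCompl)
    (fun a => isUnit_iff_ne_zero.2 (h a a.2)) _ _ ⟨_, c.den_mem⟩).1 rfl).symm

/-- The value in a field `K` of a function at a point `x` of `Proj`, with respect to a homomorphism
from `S` to `K`. -/
def value (x : Proj 𝒮) (φ : S →+* K) (h : ∀ a, a ∉ x.asHomogeneousIdeal → φ a ≠ 0)
    {U : (Proj 𝒮).Opens} (hx : x ∈ U) : Γ(Proj 𝒮, U) →+* K :=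
  (fiberHom x φ h).comp (openToLocalization 𝒮 U x hx).hom

lemma value_map (x : Proj 𝒮) (φ : S →+* K) (h : ∀ a, a ∉ x.asHomogeneousIdeal → φ a ≠ 0)
    {U V : (Proj 𝒮).Opens} (hx : x ∈ V) (i : V ≤ U) (f : Γ(Proj 𝒮, U)) :
    value x φ h hx ((Proj 𝒮).presheaf.map (homOfLE i).op f) = value x φ h (i hx) f := rfl

/-- Open sets are stable under generization, and the inclusion of ideals says that `q` is a
specialization of `x`. -/
lemma mem_of_le {x q : Proj 𝒮} (h : x.asHomogeneousIdeal ≤ q.asHomogeneousIdeal)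
    {U : (Proj 𝒮).Opens} (hq : q ∈ U) : x ∈ U := by
  have h1 : q ∈ closure ({x} : Set (Proj 𝒮)) :=
    (ProjectiveSpectrum.le_iff_mem_closure (𝒜 := 𝒮) x q).1 h
  obtain ⟨y, hy, hyx⟩ := mem_closure_iff.1 h1 U U.isOpen hq
  rw [Set.mem_singleton_iff] at hyx
  exact hyx ▸ hy

/-- Near a point `q`, a function is a fraction. -/
lemma exists_fraction {U : (Proj 𝒮).Opens} (f : Γ(Proj 𝒮, U)) {q : Proj 𝒮} (hq : q ∈ U) :
    ∃ (n : ℕ) (a b : S), a ∈ 𝒮 n ∧ b ∈ 𝒮 n ∧ b ∉ q.asHomogeneousIdeal ∧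
      ∀ (x : Proj 𝒮) (φ : S →+* K) (h : ∀ a, a ∉ x.asHomogeneousIdeal → φ a ≠ 0) (hx : x ∈ U),
        x.asHomogeneousIdeal ≤ q.asHomogeneousIdeal → value x φ h hx f * φ b = φ a := by
  obtain ⟨V, hqV, i, n, a, b, hb, hf⟩ := f.2 ⟨q, hq⟩
  refine ⟨n, a, b, a.2, b.2, hb ⟨q, hqV⟩, fun x φ h hx hxq => ?_⟩
  have hxV : x ∈ V := mem_of_le hxq hqV
  have h2 : openToLocalization 𝒮 U x hx f = HomogeneousLocalization.mk ⟨n, a, b, hb ⟨x, hxV⟩⟩ :=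
    hf ⟨x, hxV⟩
  have h3 : value x φ h hx f = fiberHom x φ h (HomogeneousLocalization.mk ⟨n, a, b, hb ⟨x, hxV⟩⟩) :=
    congrArg (fiberHom x φ h) h2
  rw [h3]
  exact fiberHom_mk x φ h _

/-- A function that is locally zero is zero. -/
lemma eq_zero_of_fraction {U : (Proj 𝒮).Opens} (f : Γ(Proj 𝒮, U))
    (h : ∀ q : Proj 𝒮, q ∈ U → ∀ (n : ℕ) (a b : S), a ∈ 𝒮 n → b ∈ 𝒮 n →
      b ∉ q.asHomogeneousIdeal → (∀ (x : Proj 𝒮) (φ : S →+* K)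
        (h : ∀ a, a ∉ x.asHomogeneousIdeal → φ a ≠ 0) (hx : x ∈ U),
        x.asHomogeneousIdeal ≤ q.asHomogeneousIdeal → value x φ h hx f * φ b = φ a) →
      ∃ c, c ∉ q.asHomogeneousIdeal ∧ c * a = 0) : f = 0 := by
  apply Subtype.ext
  funext ⟨q, hq⟩
  obtain ⟨V, hqV, i, n, a, b, hb, hf⟩ := f.2 ⟨q, hq⟩
  obtain ⟨c, hc, hca⟩ := h q hq n a b a.2 b.2 (hb ⟨q, hqV⟩) (fun x φ h hx hxq => by
    have hxV : x ∈ V := mem_of_le hxq hqV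
    have h2 : openToLocalization 𝒮 U x hx f = HomogeneousLocalization.mk ⟨n, a, b, hb ⟨x, hxV⟩⟩ :=
      hf ⟨x, hxV⟩
    have h3 : value x φ h hx f =
        fiberHom x φ h (HomogeneousLocalization.mk ⟨n, a, b, hb ⟨x, hxV⟩⟩) :=
      congrArg (fiberHom x φ h) h2
    rw [h3]
    exact fiberHom_mk x φ h _)
  refine (hf ⟨q, hqV⟩).trans ?_
  apply HomogeneousLocalization.val_injective
  erw [HomogeneousLocalization.val_mk, HomogeneousLocalization.val_zero]
  rw [Localization.mk_eq_mk', IsLocalization.mk'_eq_zero_iff]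
  exact ⟨⟨c, hc⟩, hca⟩

/-- Local fractions glue to functions. -/
lemma exists_section {U : (Proj 𝒮).Opens} (n : Proj 𝒮 → ℕ) (a b : Proj 𝒮 → S)
    (ha : ∀ q ∈ U, a q ∈ 𝒮 (n q)) (hb : ∀ q ∈ U, b q ∈ 𝒮 (n q))
    (hbq : ∀ q ∈ U, b q ∉ q.asHomogeneousIdeal)
    (hloc : ∀ q ∈ U, ∃ V : (Proj 𝒮).Opens, q ∈ V ∧ V ≤ U ∧ ∀ p ∈ V,
      b q ∉ p.asHomogeneousIdeal ∧
      ∃ c, c ∉ p.asHomogeneousIdeal ∧ c * (a p * b q) = c * (a q * b p)) :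
    ∃ f : Γ(Proj 𝒮, U), ∀ (x : Proj 𝒮) (φ : S →+* K)
      (h : ∀ a, a ∉ x.asHomogeneousIdeal → φ a ≠ 0) (hx : x ∈ U),
        value x φ h hx f * φ (b x) = φ (a x) := by
  refine ⟨⟨fun q => HomogeneousLocalization.mk
    ⟨n q.1, ⟨a q.1, ha q.1 q.2⟩, ⟨b q.1, hb q.1 q.2⟩, hbq q.1 q.2⟩, ?_⟩, ?_⟩
  · intro q
    obtain ⟨V, hqV, hVU, hV⟩ := hloc q.1 q.2
    refine ⟨V, hqV, homOfLE hVU, n q.1, ⟨a q.1, ha q.1 q.2⟩, ⟨b q.1, hb q.1 q.2⟩,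
      fun x => (hV x.1 x.2).1, fun x => ?_⟩
    apply HomogeneousLocalization.val_injective
    erw [HomogeneousLocalization.val_mk, HomogeneousLocalization.val_mk]
    rw [Localization.mk_eq_mk_iff, Localization.r_iff_exists]
    obtain ⟨c, hc, hca⟩ := (hV x.1 x.2).2
    refine ⟨⟨c, hc⟩, ?_⟩
    change c * (b q.1 * a x.1) = c * (b x.1 * a q.1)
    exact (congrArg (c * ·) (mul_comm _ _)).trans
      (hca.trans (congrArg (c * ·) (mul_comm _ _)))
  · intro x φ h hx
    exact fiberHom_mk x φ h
      ⟨n x, ⟨a x, ha x hx⟩, ⟨b x, hb x hx⟩, hbq x hx⟩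

end Values

/-! ### Two planes glued along a line -/

/-- The homogeneous coordinate ring of a plane, with coordinates `u, z, w`. -/
abbrev PlaneRing (k : Type u) [Field k] : Type u := MvPolynomial (Fin 3) k

/-- A presentation of a graded ring `S` as the homogeneous coordinate ring of the union of two
planes glued along the line `u = 0`: homomorphisms `π i` to the coordinate rings of the planes,
identifying `S` with the pairs of polynomials congruent modulo `u`, and a common section `ι` of
these. -/
structure DoublePlane {k : Type u} [Field k] {S : Type u} [CommRing S] [Algebra k S]
    (𝒮 : ℕ → Submodule k S) where
  /-- the restriction to the `i`-th plane -/
  π : Bool → S →ₐ[k] PlaneRing k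
  /-- the projection to a plane -/
  ι : PlaneRing k →ₐ[k] S
  /-- the linear form `u` on the `i`-th plane, extended by zero -/
  e : Bool → S
  π_mem : ∀ i n a, a ∈ 𝒮 n → (π i a).IsHomogeneous n
  ι_mem : ∀ n f, f.IsHomogeneous n → ι f ∈ 𝒮 n
  e_mem : ∀ i, e i ∈ 𝒮 1
  π_ι : ∀ i f, π i (ι f) = f
  π_e : ∀ i, π i (e i) = MvPolynomial.X 0
  π_e_not : ∀ i, π i (e !i) = 0
  eq_zero : ∀ a, (∀ i, π i a = 0) → a = 0
  dvd : ∀ i a, MvPolynomial.X 0 ∣ π (!i) a - π i a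

section Graded

variable {k : Type u} [Field k] {S : Type u} [CommRing S] [Algebra k S] {𝒮 : ℕ → Submodule k S}
  [GradedAlgebra 𝒮]

/-- The point of `Proj` given by a relevant homogeneous prime ideal. -/
def projPoint (I : Ideal S) (hI : I.IsHomogeneous 𝒮) (hp : I.IsPrime) {n : ℕ} (hn : 0 < n) {s : S}
    (hs : s ∈ 𝒮 n) (hsI : s ∉ I) : Proj 𝒮 :=
  ⟨⟨I, hI⟩, hp, fun h => hsI <| h <| (HomogeneousIdeal.mem_irrelevant_iff 𝒮 s).2 <| by
    rw [GradedRing.proj_apply, DirectSum.decompose_of_mem_ne 𝒮 hs hn.ne']⟩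

lemma isHomogeneous_comap {σ : Type*} (f : S →ₐ[k] MvPolynomial σ k)
    (hf : ∀ n a, a ∈ 𝒮 n → (f a).IsHomogeneous n) {J : Ideal (MvPolynomial σ k)}
    (hJ : J.IsHomogeneous (MvPolynomial.homogeneousSubmodule σ k)) :
    (J.comap f).IsHomogeneous 𝒮 :=
  (HomogeneousIdeal.comap (𝒜 := 𝒮) (ℬ := MvPolynomial.homogeneousSubmodule σ k)
    ⟨(f : S →+* MvPolynomial σ k), fun {i x} hx => hf i x hx⟩ ⟨J, hJ⟩).isHomogeneous

lemma isHomogeneous_span {σ : Type*} {p : MvPolynomial σ k} {n : ℕ} (hp : p.IsHomogeneous n) :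
    (Ideal.span {p}).IsHomogeneous (MvPolynomial.homogeneousSubmodule σ k) :=
  Ideal.homogeneous_span _ _ <| by rintro _ rfl; exact ⟨n, hp⟩

end Graded

namespace DoublePlane

variable {k : Type u} [Field k] {S : Type u} [CommRing S] [Algebra k S] {𝒮 : ℕ → Submodule k S}
  [GradedAlgebra 𝒮] (D : DoublePlane 𝒮)

-- Subtracting the pullback of the restriction to plane `i` leaves an element that is zero on that
-- plane and a multiple of `u` on the other; such elements are multiples of `e (!i)`.
omit [GradedAlgebra 𝒮] in
lemma exists_decomp (i : Bool) (a : S) :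
    ∃ c, π D (!i) a - π D i a = MvPolynomial.X 0 * c ∧ a = D.ι (D.π i a) + D.e (!i) * D.ι c := by
  obtain ⟨c, hc⟩ := D.dvd i a
  refine ⟨c, hc, sub_eq_zero.1 (D.eq_zero _ fun j => ?_)⟩
  by_cases h : j = i
  · subst h
    simp [D.π_ι, D.π_e_not]
  · obtain rfl : j = !i := by cases i <;> cases j <;> simp_all
    rw [map_sub, map_add, map_mul, D.π_ι, D.π_ι, D.π_e, ← hc]
    ring

omit [GradedAlgebra 𝒮] in
lemma e_mul_e (i : Bool) : D.e i * D.e (!i) = 0 :=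
  D.eq_zero _ fun j => by
    by_cases h : j = i
    · subst h
      rw [map_mul, D.π_e_not, mul_zero]
    · obtain rfl : i = !j := by cases i <;> cases j <;> simp_all
      rw [map_mul, D.π_e_not, zero_mul]

/-- The point of `Proj` given by a prime element in the homogeneous coordinate ring of a
projective space. -/
def primePoint {σ : Type*} (f : S →ₐ[k] MvPolynomial σ k)
    (hf : ∀ n a, a ∈ 𝒮 n → (f a).IsHomogeneous n) {p : MvPolynomial σ k} {n : ℕ}
    (hp : p.IsHomogeneous n) (hp' : p = 0 ∨ Irreducible p) {s : S} (hs : s ∈ 𝒮 1)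
    (hsp : ¬ p ∣ f s) : Proj 𝒮 :=
  projPoint ((Ideal.span {p}).comap f) (isHomogeneous_comap f hf (isHomogeneous_span hp))
    (by
      have : (Ideal.span {p}).IsPrime := by
        rcases hp' with rfl | hp'
        · simpa using Ideal.isPrime_bot
        · exact (Ideal.span_singleton_prime hp'.ne_zero).2 hp'.prime
      infer_instance) one_pos hs (by rwa [Ideal.mem_comap, Ideal.mem_span_singleton])

omit [GradedAlgebra 𝒮] in
lemma not_zero_dvd (i : Bool) : ¬ (0 : PlaneRing k) ∣ D.π i (D.e i) := by
  rw [D.π_e, zero_dvd_iff]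
  exact MvPolynomial.X_ne_zero _

/-- The generic point of the `i`-th plane. -/
def gen (i : Bool) : Proj 𝒮 :=
  primePoint (D.π i) (D.π_mem i) (MvPolynomial.isHomogeneous_zero _ _ 0) (Or.inl rfl) (D.e_mem i)
    (D.not_zero_dvd i)

lemma mem_gen {i : Bool} {a : S} : a ∈ (D.gen i).asHomogeneousIdeal ↔ D.π i a = 0 := by
  change a ∈ (Ideal.span {0}).comap (D.π i) ↔ _
  rw [Ideal.mem_comap, Ideal.mem_span_singleton, zero_dvd_iff]

/-- The point `q` lies on the `i`-th plane. -/
def On (i : Bool) (q : Proj 𝒮) : Prop :=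
  (D.gen i).asHomogeneousIdeal ≤ q.asHomogeneousIdeal

variable {D}

lemma On.mem {i : Bool} {q : Proj 𝒮} (h : D.On i q) {U : (Proj 𝒮).Opens} (hq : q ∈ U) :
    D.gen i ∈ U := mem_of_le h hq

lemma On.mem_ideal {i : Bool} {q : Proj 𝒮} (h : D.On i q) {a : S} (ha : D.π i a = 0) :
    a ∈ q.asHomogeneousIdeal := h (D.mem_gen.2 ha)

lemma On.ne_zero {i : Bool} {q : Proj 𝒮} (h : D.On i q) {a : S} (ha : a ∉ q.asHomogeneousIdeal) :
    D.π i a ≠ 0 := fun h' => ha (h.mem_ideal h')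

variable (D)

/-- By `exists_decomp`, the ideal of plane `i` is generated by `e (!i)`. -/
lemma on_iff {i : Bool} {q : Proj 𝒮} : D.On i q ↔ D.e (!i) ∈ q.asHomogeneousIdeal := by
  refine ⟨fun h => h.mem_ideal (D.π_e_not i), fun h a ha => ?_⟩
  obtain ⟨c, -, hc⟩ := D.exists_decomp i a
  rw [D.mem_gen.1 ha, map_zero, zero_add] at hc
  rw [hc]
  exact Ideal.mul_mem_right _ q.asHomogeneousIdeal.toIdeal h

lemma on_or_on (q : Proj 𝒮) (i : Bool) : D.On i q ∨ D.On (!i) q := by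
  rw [D.on_iff, D.on_iff, Bool.not_not]
  have h : D.e (!i) * D.e i ∈ q.asHomogeneousIdeal.toIdeal := by
    rw [mul_comm, e_mul_e]; exact zero_mem _
  exact (isPrime_asHomogeneousIdeal q).mem_or_mem h

lemma on_gen (i : Bool) : D.On i (D.gen i) := le_rfl

lemma not_on_gen_not (i : Bool) : ¬ D.On (!i) (D.gen i) := by
  rw [D.on_iff, Bool.not_not, D.mem_gen, D.π_e]
  exact MvPolynomial.X_ne_zero _

/-- Vanishing in the local ring at `q` can be tested on the planes through `q`. If `q` avoids plane
`!i`, then `e i` is invertible at `q` and kills whatever lives on that plane; if `q` is on both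
planes, `y` itself is zero. -/
lemma exists_mul_eq_zero {q : Proj 𝒮} {y : S} (hy : ∀ i, D.On i q → D.π i y = 0) :
    ∃ c, c ∉ q.asHomogeneousIdeal ∧ c * y = 0 := by
  by_cases h : ∃ i, ¬ D.On (!i) q
  · obtain ⟨i, hi⟩ := h
    have hi' : D.On i q := (D.on_or_on q i).resolve_right hi
    refine ⟨D.e i, fun h => hi (by rwa [D.on_iff, Bool.not_not]), D.eq_zero _ fun j => ?_⟩
    by_cases hj : j = i
    · rw [hj, map_mul, hy i hi', mul_zero]
    · obtain rfl : i = !j := by cases i <;> cases j <;> simp_all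
      rw [map_mul, D.π_e_not, zero_mul]
  · push Not at h
    refine ⟨1, fun h1 => (isPrime_asHomogeneousIdeal q).ne_top
      ((Ideal.eq_top_iff_one _).2 h1), ?_⟩
    rw [one_mul]
    refine D.eq_zero _ fun j => hy j ?_
    simpa using h (!j)

/-- The field of rational functions in the coordinates of a plane. -/
abbrev _root_.TwistedQuadric.PlaneField (k : Type u) [Field k] : Type u := FractionRing (PlaneRing k)

/-- Restriction to the `i`-th plane, as a homomorphism to rational functions. -/
def toField (i : Bool) : S →ₐ[k] PlaneField k :=
  (Algebra.algHom k (PlaneRing k) (PlaneField k)).comp (D.π i)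

omit [GradedAlgebra 𝒮] in
lemma toField_eq_zero {i : Bool} {a : S} : D.toField i a = 0 ↔ D.π i a = 0 :=
  FaithfulSMul.algebraMap_eq_zero_iff (PlaneRing k) (PlaneField k)

omit [GradedAlgebra 𝒮] in
lemma toField_eq {i : Bool} {a b : S} : D.toField i a = D.toField i b ↔ D.π i a = D.π i b :=
  (FaithfulSMul.algebraMap_injective (PlaneRing k) (PlaneField k)).eq_iff

lemma toField_gen_ne_zero (i : Bool) (a : S) (ha : a ∉ (D.gen i).asHomogeneousIdeal) :
    (D.toField i : S →+* PlaneField k) a ≠ 0 := fun h =>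
  ha (D.mem_gen.2 (D.toField_eq_zero.1 h))

open Classical in
/-- The restriction of a function on `U` to the `i`-th plane, as a rational function. It is zero
if `U` does not meet the `i`-th plane. -/
def ev (i : Bool) {U : (Proj 𝒮).Opens} (f : Γ(Proj 𝒮, U)) : PlaneField k :=
  if h : D.gen i ∈ U then value (D.gen i) (D.toField i : S →+* PlaneField k)
    (D.toField_gen_ne_zero i) h f else 0

section ev

variable (i : Bool) {U V : (Proj 𝒮).Opens}

lemma ev_eq (h : D.gen i ∈ U) (f : Γ(Proj 𝒮, U)) : D.ev i f =
    value (D.gen i) (D.toField i : S →+* PlaneField k) (D.toField_gen_ne_zero i) h f := dif_pos h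

lemma ev_map (h : D.gen i ∈ V) (e : V ≤ U) (f : Γ(Proj 𝒮, U)) :
    D.ev i ((Proj 𝒮).presheaf.map (homOfLE e).op f) = D.ev i f := by
  rw [ev_eq D i h, ev_eq D i (e h), value_map]

lemma ev_one (h : D.gen i ∈ U) : D.ev i (1 : Γ(Proj 𝒮, U)) = 1 := by
  rw [ev_eq D i h, map_one]

lemma ev_zero : D.ev i (0 : Γ(Proj 𝒮, U)) = 0 := by
  by_cases h : D.gen i ∈ U
  · rw [ev_eq D i h, map_zero]
  · exact dif_neg h

lemma ev_add (f g : Γ(Proj 𝒮, U)) : D.ev i (f + g) = D.ev i f + D.ev i g := by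
  by_cases h : D.gen i ∈ U
  · simp only [ev_eq D i h, map_add]
  · simp only [ev, dif_neg h, add_zero]

lemma ev_mul (f g : Γ(Proj 𝒮, U)) : D.ev i (f * g) = D.ev i f * D.ev i g := by
  by_cases h : D.gen i ∈ U
  · simp only [ev_eq D i h, map_mul]
  · simp only [ev, dif_neg h, mul_zero]

lemma ev_sub (f g : Γ(Proj 𝒮, U)) : D.ev i (f - g) = D.ev i f - D.ev i g := by
  by_cases h : D.gen i ∈ U
  · simp only [ev_eq D i h, map_sub]
  · simp only [ev, dif_neg h, sub_zero]

end ev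

/-- The pair `f` of rational functions of degree `d` on the planes is regular at `q`. -/
def RegAt (q : Proj 𝒮) (d : ℤ) (f : Bool → PlaneField k) : Prop :=
  ∃ (m n : ℕ) (a b : S), a ∈ 𝒮 m ∧ b ∈ 𝒮 n ∧ (m : ℤ) = n + d ∧ b ∉ q.asHomogeneousIdeal ∧
    ∀ i, D.On i q → f i * D.toField i b = D.toField i a

/-- The pair `f` of rational functions of degree `d` on the planes is regular and invertible at
`q`. -/
def UnitAt (q : Proj 𝒮) (d : ℤ) (f : Bool → PlaneField k) : Prop :=
  ∃ (m n : ℕ) (a b : S), a ∈ 𝒮 m ∧ b ∈ 𝒮 n ∧ (m : ℤ) = n + d ∧ a ∉ q.asHomogeneousIdeal ∧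
    b ∉ q.asHomogeneousIdeal ∧ ∀ i, D.On i q → f i * D.toField i b = D.toField i a

variable {D} {q : Proj 𝒮} {d d' : ℤ} {f g : Bool → PlaneField k}

lemma mul_notMem {a b : S} (ha : a ∉ q.asHomogeneousIdeal) (hb : b ∉ q.asHomogeneousIdeal) :
    a * b ∉ q.asHomogeneousIdeal := fun h =>
  ((isPrime_asHomogeneousIdeal q).mem_or_mem h).elim ha hb

lemma RegAt.congr (hf : D.RegAt q d f) (h : ∀ i, D.On i q → f i = g i) : D.RegAt q d g := by
  obtain ⟨m, n, a, b, ha, hb, hmn, hbq, hf⟩ := hf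
  exact ⟨m, n, a, b, ha, hb, hmn, hbq, fun i hi => h i hi ▸ hf i hi⟩

lemma UnitAt.congr (hf : D.UnitAt q d f) (h : ∀ i, D.On i q → f i = g i) : D.UnitAt q d g := by
  obtain ⟨m, n, a, b, ha, hb, hmn, haq, hbq, hf⟩ := hf
  exact ⟨m, n, a, b, ha, hb, hmn, haq, hbq, fun i hi => h i hi ▸ hf i hi⟩

lemma UnitAt.regAt (hf : D.UnitAt q d f) : D.RegAt q d f := by
  obtain ⟨m, n, a, b, ha, hb, hmn, haq, hbq, hf⟩ := hf
  exact ⟨m, n, a, b, ha, hb, hmn, hbq, hf⟩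

lemma RegAt.mul (hf : D.RegAt q d f) (hg : D.RegAt q d' g) :
    D.RegAt q (d + d') fun i => f i * g i := by
  obtain ⟨m, n, a, b, ha, hb, hmn, hbq, hf⟩ := hf
  obtain ⟨m', n', a', b', ha', hb', hmn', hbq', hg⟩ := hg
  refine ⟨m + m', n + n', a * a', b * b', SetLike.mul_mem_graded ha ha',
    SetLike.mul_mem_graded hb hb', by push_cast; omega, mul_notMem hbq hbq', fun i hi => ?_⟩
  rw [map_mul, map_mul, ← hf i hi, ← hg i hi]
  ring

lemma UnitAt.inv (hf : D.UnitAt q d f) : D.UnitAt q (-d) fun i => (f i)⁻¹ := by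
  obtain ⟨m, n, a, b, ha, hb, hmn, haq, hbq, hf⟩ := hf
  refine ⟨n, m, b, a, hb, ha, by omega, hbq, haq, fun i hi => ?_⟩
  have h1 : D.toField i a ≠ 0 := fun h => hi.ne_zero haq (D.toField_eq_zero.1 h)
  rw [← hf i hi] at h1 ⊢
  rw [inv_mul_cancel_left₀ (left_ne_zero_of_mul h1)]

lemma UnitAt.ne_zero (hf : D.UnitAt q d f) {i : Bool} (hi : D.On i q) : f i ≠ 0 := by
  obtain ⟨m, n, a, b, ha, hb, hmn, haq, hbq, hf⟩ := hf
  have h1 : D.toField i a ≠ 0 := fun h => hi.ne_zero haq (D.toField_eq_zero.1 h)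
  rw [← hf i hi] at h1
  exact left_ne_zero_of_mul h1

variable (D) {U : (Proj 𝒮).Opens}

lemma regAt_ev (s : Γ(Proj 𝒮, U)) (hq : q ∈ U) : D.RegAt q 0 fun i => D.ev i s := by
  obtain ⟨n, a, b, ha, hb, hbq, h⟩ := exists_fraction (K := PlaneField k) s hq
  refine ⟨n, n, a, b, ha, hb, by simp, hbq, fun i hi => ?_⟩
  change D.ev i s * _ = _
  rw [D.ev_eq i (hi.mem hq)]
  exact h (D.gen i) (D.toField i : S →+* PlaneField k) (D.toField_gen_ne_zero i) (hi.mem hq) hi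

/-- With `s = a / b` and `t = a' / b'` near `q`, the relation `s * t = 1` gives `a * a' = b * b'` up
to a factor outside `q`. As `b` and `b'` are outside `q`, so is `a`. -/
lemma unitAt_ev (s t : Γ(Proj 𝒮, U)) (hst : s * t = 1) (hq : q ∈ U) :
    D.UnitAt q 0 fun i => D.ev i s := by
  obtain ⟨m, n, a, b, ha, hb, hmn, hbq, hs⟩ := D.regAt_ev s hq
  obtain ⟨m', n', a', b', ha', hb', hmn', hbq', ht⟩ := D.regAt_ev t hq
  refine ⟨m, n, a, b, ha, hb, hmn, fun haq => ?_, hbq, hs⟩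
  obtain ⟨c, hc, hc'⟩ := D.exists_mul_eq_zero (q := q) (y := a * a' - b * b') fun i hi => by
    rw [← D.toField_eq_zero, map_sub, map_mul, map_mul, ← hs i hi, ← ht i hi, sub_eq_zero]
    have := congrArg (D.ev i) hst
    rw [D.ev_mul, D.ev_one i (hi.mem hq)] at this
    linear_combination (D.toField i b * D.toField i b') * this
  rw [mul_sub, sub_eq_zero] at hc'
  refine mul_notMem hc (mul_notMem hbq hbq') (hc' ▸ ?_)
  exact Ideal.mul_mem_left q.asHomogeneousIdeal.toIdeal _ (Ideal.mul_mem_right _ _ haq)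

/-- The double plane is reduced, so functions are determined at the generic points of the planes.
Identities between sections are thereby checked in `PlaneField k`. -/
lemma eq_of_ev {s t : Γ(Proj 𝒮, U)} (h : ∀ i, D.gen i ∈ U → D.ev i s = D.ev i t) : s = t := by
  rw [← sub_eq_zero]
  refine eq_zero_of_fraction (K := PlaneField k) _ fun q hq n a b ha hb hbq hs =>
    D.exists_mul_eq_zero fun i hi => ?_
  have := hs (D.gen i) (D.toField i : S →+* PlaneField k) (D.toField_gen_ne_zero i) (hi.mem hq) hi
  rw [← D.ev_eq i (hi.mem hq), D.ev_sub, h i (hi.mem hq), sub_self, zero_mul] at this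
  exact D.toField_eq_zero.1 this.symm

/-- The converse of `regAt_ev`: fractions that represent the same pair of rational functions agree
locally, and therefore glue. -/
lemma exists_ev_eq (hf : ∀ q ∈ U, D.RegAt q 0 f) :
    ∃ s : Γ(Proj 𝒮, U), ∀ i, D.gen i ∈ U → D.ev i s = f i := by
  choose! m n a b ha hb hmn hbq hf using hf
  obtain ⟨s, hs⟩ := exists_section (K := PlaneField k) (U := U) n a b
    (fun q hq => by
      have h1 := ha q hq
      have h2 := hmn q hq
      rwa [show m q = n q by omega] at h1) hb hbq (fun q hq => by
    classical
    -- This neighbourhood of `q` removes the planes that do not pass through `q`. Every plane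
    -- through a point `p` of it then passes through `q`, and the fractions chosen at `p` and at `q`
    -- can be compared.
    refine ⟨U ⊓ Proj.basicOpen 𝒮 (b q) ⊓ ((if D.On true q then ⊤ else Proj.basicOpen 𝒮 (D.e false)) ⊓
      (if D.On false q then ⊤ else Proj.basicOpen 𝒮 (D.e true))), ⟨⟨hq, hbq q hq⟩, ?_, ?_⟩,
      inf_le_left.trans inf_le_left, ?_⟩
    · split_ifs with h
      · trivial
      · rw [D.on_iff] at h; exact h
    · split_ifs with h
      · trivial
      · rw [D.on_iff] at h; exact h
    · rintro p ⟨⟨hpU, hpb⟩, hp1, hp2⟩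
      have hOn : ∀ i, D.On i p → D.On i q := by
        rintro (_ | _) hi <;> by_contra hiq
        · rw [if_neg hiq] at hp2
          rw [D.on_iff] at hi
          exact hp2 hi
        · rw [if_neg hiq] at hp1
          rw [D.on_iff] at hi
          exact hp1 hi
      refine ⟨hpb, ?_⟩
      obtain ⟨c, hc, hc'⟩ := D.exists_mul_eq_zero (q := p) (y := a p * b q - a q * b p)
        fun i hi => by
          rw [← D.toField_eq_zero, map_sub, map_mul, map_mul, ← hf p hpU i hi,
            ← hf q hq i (hOn i hi)]
          ring
      exact ⟨c, hc, by rwa [mul_sub, sub_eq_zero] at hc'⟩)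
  refine ⟨s, fun i hi => ?_⟩
  have h1 := hs (D.gen i) (D.toField i : S →+* PlaneField k) (D.toField_gen_ne_zero i) hi
  rw [← D.ev_eq i hi] at h1
  have h2 := hf (D.gen i) hi i (D.on_gen i)
  exact mul_right_cancel₀ (D.toField_gen_ne_zero i _ (hbq _ hi)) (h1.trans h2.symm)

end DoublePlane

/-! ### Sections of invertible sheaves in terms of frames -/

section Polynomials

variable {k : Type u} [Field k] {σ : Type*}

lemma eq_zero_of_mul_isHomogeneous {b y : MvPolynomial σ k} {m n : ℕ} (hb : b.IsHomogeneous n)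
    (hb0 : b ≠ 0) (h : (b * y).IsHomogeneous m) (hmn : m < n) : y = 0 := by
  by_contra hy
  have h1 := MvPolynomial.IsHomogeneous.inj_right (hb.mul (isHomogeneous_of_mul h hb hb0)) h
    (mul_ne_zero hb0 hy)
  omega

/-- A common irreducible factor of two variables would be associated to both. The lemma ensures that
the prime ideal `(p)` omits a linear form, and so is a point of `Proj`. -/
lemma exists_not_dvd_X {p : MvPolynomial σ k} (hp : Irreducible p) {i j : σ} (hij : i ≠ j) :
    ∃ l, ¬ p ∣ MvPolynomial.X l := by
  by_contra! h
  have h1 : Associated p (MvPolynomial.X i) :=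
    hp.associated_of_dvd MvPolynomial.X_prime.irreducible (h i)
  classical
  have h2 := map_dvd (MvPolynomial.eval fun l => if l = i then (0 : k) else 1)
    (h1.symm.dvd.trans (h j))
  simp [hij.symm] at h2

end Polynomials

/-- A compatible family of functions is a global section of the invertible sheaf. -/
def InvertibleSheaf.IsSection {X : Scheme.{u}} (N : InvertibleSheaf X)
    (s : ∀ j, Γ(X, N.U j)) : Prop :=
  ∀ j j', X.presheaf.map (homOfLE inf_le_left).op (s j) =
    N.g j j' * X.presheaf.map (homOfLE inf_le_right).op (s j')

namespace DoublePlane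

section Algebra

variable {k : Type u} [Field k] {S : Type u} [CommRing S] [Algebra k S] {𝒮 : ℕ → Submodule k S}
  (D : DoublePlane 𝒮)

/-- Restriction to the line in which the two planes meet. -/
def res : S →ₐ[k] MvPolynomial (Fin 2) k := lineRes.comp (D.π false)

lemma lineRes_π (i : Bool) (a : S) : lineRes (D.π i a) = D.res a := by
  cases i
  · rfl
  · have := lineRes_eq_zero_iff.2 (D.dvd false a)
    rw [map_sub, sub_eq_zero] at this
    exact this

lemma res_mem (n : ℕ) (a : S) (ha : a ∈ 𝒮 n) : (D.res a).IsHomogeneous n :=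
  lineRes_isHomogeneous (D.π_mem false n a ha)

lemma res_e (i : Bool) : D.res (D.e i) = 0 := by
  rw [← D.lineRes_π i, D.π_e, lineRes_X_zero]

/-- Forms on the two planes glue once they agree on the common line: their difference is `u * c`,
and `e true * ι c` corrects the second plane without changing the first. -/
lemma exists_mem_of_lineRes_eq {n : ℕ} {y : Bool → PlaneRing k} (hy : ∀ i, (y i).IsHomogeneous n)
    (h : lineRes (y false) = lineRes (y true)) [GradedAlgebra 𝒮] :
    ∃ a ∈ 𝒮 n, ∀ i, D.π i a = y i := by
  obtain ⟨c, hc⟩ := lineRes_eq_zero_iff.1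
    (show lineRes (y true - y false) = 0 by rw [map_sub, h, sub_self])
  have h1 : (MvPolynomial.X 0 * c).IsHomogeneous n := hc ▸ (hy true).sub (hy false)
  have hX : (MvPolynomial.X 0 : PlaneRing k).IsHomogeneous 1 := MvPolynomial.isHomogeneous_X _ _
  refine ⟨D.ι (y false) + D.e true * D.ι c, add_mem (D.ι_mem n _ (hy false)) ?_, ?_⟩
  -- In degree zero `c` would have degree `-1`, so it is zero; truncated subtraction does not see
  -- this.
  · rcases Nat.eq_zero_or_pos n with rfl | hn
    · rw [eq_zero_of_mul_isHomogeneous hX (MvPolynomial.X_ne_zero _) h1 one_pos, map_zero, mul_zero]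
      exact zero_mem _
    · have := SetLike.mul_mem_graded (D.e_mem true) (D.ι_mem _ _
        (isHomogeneous_of_mul h1 hX (MvPolynomial.X_ne_zero _)))
      rwa [Nat.add_sub_cancel' hn] at this
  · rintro (_ | _)
    · rw [map_add, map_mul, show true = !false from rfl, D.π_e_not, D.π_ι, zero_mul, add_zero]
    · rw [map_add, map_mul, D.π_e, D.π_ι, D.π_ι, ← hc]
      ring

lemma exists_linear_not_dvd (i : Bool) {p : PlaneRing k} (hp : Irreducible p) :
    ∃ s ∈ 𝒮 1, ¬ p ∣ D.π i s := by
  obtain ⟨l, hl⟩ := exists_not_dvd_X hp (show (0 : Fin 3) ≠ 1 by decide)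
  exact ⟨D.ι (MvPolynomial.X l), D.ι_mem 1 _ (MvPolynomial.isHomogeneous_X _ _), by rwa [D.π_ι]⟩

lemma exists_linear_not_dvd_res {p : MvPolynomial (Fin 2) k} (hp : p = 0 ∨ Irreducible p) :
    ∃ s ∈ 𝒮 1, ¬ p ∣ D.res s := by
  obtain ⟨l, hl⟩ : ∃ l, ¬ p ∣ MvPolynomial.X l := by
    rcases hp with rfl | hp
    · exact ⟨0, by rw [zero_dvd_iff]; exact MvPolynomial.X_ne_zero _⟩
    · exact exists_not_dvd_X hp (show (0 : Fin 2) ≠ 1 by decide)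
  refine ⟨D.ι (MvPolynomial.X l.succ), D.ι_mem 1 _ (MvPolynomial.isHomogeneous_X _ _), ?_⟩
  rwa [← D.lineRes_π false, D.π_ι, lineRes_X_succ]

lemma toField_π {i : Bool} {f : PlaneRing k} {a b : S} {x : PlaneField k}
    (hx : x = algebraMap _ _ f) (h : x * D.toField i b = D.toField i a) :
    f * D.π i b = D.π i a := by
  rw [hx] at h
  apply FaithfulSMul.algebraMap_injective (PlaneRing k) (PlaneField k)
  rw [map_mul]
  exact h

end Algebra

variable {k : Type u} [Field k] {S : Type u} [CommRing S] [Algebra k S] {𝒮 : ℕ → Submodule k S}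
  [GradedAlgebra 𝒮] (D : DoublePlane 𝒮)

/-- A curve in the `i`-th plane has a generic point. -/
lemma exists_point_plane (i : Bool) {p : PlaneRing k} {n : ℕ} (hp : p.IsHomogeneous n)
    (hp' : Irreducible p) :
    ∃ q : Proj 𝒮, D.On i q ∧ ∀ a, a ∈ q.asHomogeneousIdeal ↔ p ∣ D.π i a := by
  obtain ⟨s, hs, hsp⟩ := D.exists_linear_not_dvd i hp'
  have hq : ∀ a, a ∈ (primePoint (D.π i) (D.π_mem i) hp (Or.inr hp') hs hsp).asHomogeneousIdeal ↔
      p ∣ D.π i a := fun a => by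
    change a ∈ (Ideal.span {p}).comap (D.π i) ↔ _
    rw [Ideal.mem_comap, Ideal.mem_span_singleton]
  refine ⟨_, ?_, hq⟩
  rw [D.on_iff, hq, D.π_e_not]
  exact dvd_zero _

/-- A closed subvariety of the line in which the two planes meet has a generic point. -/
lemma exists_point_line {p : MvPolynomial (Fin 2) k} {n : ℕ} (hp : p.IsHomogeneous n)
    (hp' : p = 0 ∨ Irreducible p) :
    ∃ q : Proj 𝒮, (∀ i, D.On i q) ∧ ∀ a, a ∈ q.asHomogeneousIdeal ↔ p ∣ D.res a := by
  obtain ⟨s, hs, hsp⟩ := D.exists_linear_not_dvd_res hp'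
  have hq : ∀ a, a ∈ (primePoint D.res D.res_mem hp hp' hs hsp).asHomogeneousIdeal ↔
      p ∣ D.res a := fun a => by
    change a ∈ (Ideal.span {p}).comap D.res ↔ _
    rw [Ideal.mem_comap, Ideal.mem_span_singleton]
  refine ⟨_, fun i => ?_, hq⟩
  rw [D.on_iff, hq, res_e]
  exact dvd_zero _

/-- A rational function on the plane which is regular everywhere is a polynomial. -/
lemma exists_polynomial {d : ℤ} {f : Bool → PlaneField k} (hf : ∀ q, D.RegAt q d f) (i : Bool) :
    ∃ y : PlaneRing k, f i = algebraMap _ _ y := by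
  obtain ⟨α, β, hαβ, h⟩ := IsFractionRing.exists_reduced_fraction (PlaneRing k) (f i)
  have hβ0 : (β : PlaneRing k) ≠ 0 := nonZeroDivisors.ne_zero β.2
  have hmul : f i * algebraMap _ _ (β : PlaneRing k) = algebraMap _ _ α := by
    rw [← h, IsLocalization.mk'_spec]
  -- As `α / β` is in lowest terms, `β` divides the denominator of every fraction representing `f
  -- i`.
  have key : ∀ a b : S, f i * D.toField i b = D.toField i a → (β : PlaneRing k) ∣ D.π i b := by
    intro a b hab
    refine (hαβ.symm).dvd_of_dvd_mul_left (⟨D.π i a, ?_⟩ : (β : PlaneRing k) ∣ α * D.π i b)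
    apply FaithfulSMul.algebraMap_injective (PlaneRing k) (PlaneField k)
    rw [map_mul, map_mul, ← hmul]
    change _ = _ * D.toField i a
    rw [← hab]
    change _ * D.toField i b = _
    ring
  have hunit : IsUnit (β : PlaneRing k) := by
    by_contra hβ
    obtain ⟨p, hp, hpβ⟩ := WfDvdMonoid.exists_irreducible_factor hβ hβ0
    obtain ⟨m, n, a, b, ha, hb, -, hbq, hab⟩ := hf (D.gen i)
    obtain ⟨c, hc⟩ := hpβ.trans (key a b (hab i (D.on_gen i)))
    have hb0 : D.π i b ≠ 0 := fun h => hbq (D.mem_gen.2 h)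
    -- The factor `p` of `β` divides a form, hence is homogeneous and defines a curve. At the
    -- generic point of that curve `f` has a denominator not divisible by `p`, contradicting `key`.
    obtain ⟨l, hl⟩ := exists_isHomogeneous_of_mul (hc ▸ D.π_mem i n b hb) (hc ▸ hb0)
    obtain ⟨q, hq, hqm⟩ := D.exists_point_plane i hl hp
    obtain ⟨m, n, a, b, ha, hb, -, hbq, hab⟩ := hf q
    exact hbq ((hqm b).2 (hpβ.trans (key a b (hab i hq))))
  obtain ⟨v, hv⟩ := hunit
  refine ⟨α * ↑v⁻¹, ?_⟩
  rw [map_mul, ← hmul, ← hv, mul_assoc, ← map_mul, Units.mul_inv, map_one, mul_one]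

/-- The everywhere regular pairs of rational functions of degree `d ≥ 0` are the elements of `S` of
degree `d`. -/
lemma exists_mem_of_regAt {n : ℕ} {f : Bool → PlaneField k} (hf : ∀ q, D.RegAt q n f) :
    ∃ y ∈ 𝒮 n, ∀ i, f i = D.toField i y := by
  choose y hy using D.exists_polynomial hf
  have hyn : ∀ i, (y i).IsHomogeneous n := by
    intro i
    obtain ⟨m, l, a, b, ha, hb, hml, hbq, hab⟩ := hf (D.gen i)
    have h1 := D.toField_π (hy i) (hab i (D.on_gen i))
    have h2 := isHomogeneous_of_mul (mul_comm (y i) _ ▸ h1 ▸ D.π_mem i m a ha) (D.π_mem i l b hb)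
      fun h => hbq (D.mem_gen.2 h)
    rwa [show m - l = n by omega] at h2
  -- At the generic point of the common line (`p = 0`), one fraction `a / b` represents `f` on both
  -- planes. This forces the two polynomials to agree on the line.
  obtain ⟨q, hq, hqm⟩ := D.exists_point_line (MvPolynomial.isHomogeneous_zero _ _ 0) (Or.inl rfl)
  obtain ⟨m, l, a, b, ha, hb, hml, hbq, hab⟩ := hf q
  have h1 : ∀ i, lineRes (y i) * D.res b = D.res a := fun i => by
    rw [← D.lineRes_π i, ← D.lineRes_π i, ← map_mul, D.toField_π (hy i) (hab i (hq i))]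
  rw [hqm, zero_dvd_iff] at hbq
  obtain ⟨a, ha, hay⟩ := D.exists_mem_of_lineRes_eq hyn
    (mul_right_cancel₀ hbq ((h1 false).trans (h1 true).symm))
  refine ⟨a, ha, fun i => ?_⟩
  rw [hy, ← hay]
  rfl

/-- There are no everywhere regular rational functions of negative degree. -/
lemma eq_zero_of_regAt {d : ℤ} (hd : d < 0) {f : Bool → PlaneField k} (hf : ∀ q, D.RegAt q d f)
    (i : Bool) : f i = 0 := by
  obtain ⟨y, hy⟩ := D.exists_polynomial hf i
  obtain ⟨m, l, a, b, ha, hb, hml, hbq, hab⟩ := hf (D.gen i)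
  have h1 := D.toField_π hy (hab i (D.on_gen i))
  have h2 : y = 0 := eq_zero_of_mul_isHomogeneous (D.π_mem i l b hb)
    (fun h => hbq (D.mem_gen.2 h)) (mul_comm y _ ▸ h1 ▸ D.π_mem i m a ha) (by omega)
  rw [hy, h2, map_zero]

lemma regAt_toField {n : ℕ} {y : S} (hy : y ∈ 𝒮 n) (q : Proj 𝒮) :
    D.RegAt q n fun i => D.toField i y :=
  ⟨n, 0, y, 1, hy, SetLike.GradedOne.one_mem, by simp,
    fun h => (isPrime_asHomogeneousIdeal q).ne_top ((Ideal.eq_top_iff_one _).2 h), by simp⟩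

section InvertibleSheaf

variable (N : InvertibleSheaf (Proj 𝒮))

variable {N}

lemma ev_g_self {i : Bool} {j : N.ι} (h : D.gen i ∈ N.U j) : D.ev i (N.g j j) = 1 := by
  rw [N.g_self, D.ev_one i (show D.gen i ∈ N.U j ⊓ N.U j from ⟨h, h⟩)]

lemma ev_g_mul {i : Bool} {j l m : N.ι} (hj : D.gen i ∈ N.U j) (hl : D.gen i ∈ N.U l)
    (hm : D.gen i ∈ N.U m) : D.ev i (N.g j l) * D.ev i (N.g l m) = D.ev i (N.g j m) := by
  have h : D.gen i ∈ N.U j ⊓ N.U l ⊓ N.U m := ⟨⟨hj, hl⟩, hm⟩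
  have := congrArg (D.ev i) (N.g_mul j l m)
  rwa [D.ev_mul, D.ev_map i h, D.ev_map i h, D.ev_map i h] at this

lemma ev_g_ne_zero {i : Bool} {j l : N.ι} (hj : D.gen i ∈ N.U j) (hl : D.gen i ∈ N.U l) :
    D.ev i (N.g j l) ≠ 0 := fun h => by
  have := D.ev_g_mul hj hl hj
  rw [h, zero_mul, D.ev_g_self hj] at this
  exact zero_ne_one this

lemma unitAt_g {q : Proj 𝒮} {j l : N.ι} (hj : q ∈ N.U j) (hl : q ∈ N.U l) :
    D.UnitAt q 0 fun i => D.ev i (N.g j l) := by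
  have h := N.g_mul j l j
  rw [N.g_self, map_one] at h
  exact (D.unitAt_ev _ _ h (show q ∈ N.U j ⊓ N.U l ⊓ N.U j from ⟨⟨hj, hl⟩, hj⟩)).congr
    fun i hi => D.ev_map i (show D.gen i ∈ N.U j ⊓ N.U l ⊓ N.U j from
      ⟨⟨hi.mem hj, hi.mem hl⟩, hi.mem hj⟩) _ _

lemma ev_section {i : Bool} {j l : N.ι} {s : ∀ j, Γ(Proj 𝒮, N.U j)} (hs : N.IsSection s)
    (hj : D.gen i ∈ N.U j) (hl : D.gen i ∈ N.U l) :
    D.ev i (s j) = D.ev i (N.g j l) * D.ev i (s l) := by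
  have h : D.gen i ∈ N.U j ⊓ N.U l := ⟨hj, hl⟩
  have := congrArg (D.ev i) (hs j l)
  rwa [D.ev_mul, D.ev_map i h, D.ev_map i h] at this

variable (N)

/-- The pair `F` of rational sections of degree `d` of the planes is a frame, identifying the
invertible sheaf with the twist by `d` of the structure sheaf. Here the sheaf is trivialized on the
`i`-th plane by means of the index `a i`. -/
def IsFrame (a : Bool → N.ι) (d : ℤ) (F : Bool → PlaneField k) : Prop :=
  ∀ q j, q ∈ N.U j → D.UnitAt q d fun i => F i * D.ev i (N.g (a i) j)

variable {N} {a : Bool → N.ι} {d : ℤ} {F : Bool → PlaneField k} {D}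

lemma IsFrame.ne_zero (hF : D.IsFrame N a d F) (ha : ∀ i, D.gen i ∈ N.U (a i)) (i : Bool) :
    F i ≠ 0 :=
  left_ne_zero_of_mul ((hF (D.gen i) (a i) (ha i)).ne_zero (D.on_gen i))

lemma exists_mem_U (N : InvertibleSheaf (Proj 𝒮)) (q : Proj 𝒮) : ∃ j, q ∈ N.U j := by
  have : q ∈ ⨆ i, N.U i := N.iSup_U ▸ trivial
  simpa using this

/-- Multiplication by the frame turns sections into forms of degree `d`: locally `F * s (a i)` is
the invertible `F * g (a i) j` times the function `s j`. -/
lemma IsFrame.regAt (hF : D.IsFrame N a d F) (ha : ∀ i, D.gen i ∈ N.U (a i))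
    {s : ∀ j, Γ(Proj 𝒮, N.U j)} (hs : N.IsSection s) (q : Proj 𝒮) :
    D.RegAt q d fun i => F i * D.ev i (s (a i)) := by
  obtain ⟨j, hj⟩ := exists_mem_U N q
  have h := (hF q j hj).regAt.mul (D.regAt_ev (s j) hj)
  rw [add_zero] at h
  refine h.congr fun i hi => ?_
  rw [D.ev_section hs (ha i) (hi.mem hj), mul_assoc]

/-- Division by the frame gives the inverse: the local expression of the section is `x / (F * g (a
i) j)`, regular because the denominator is invertible of the same degree. -/
lemma IsFrame.exists_section (hF : D.IsFrame N a d F) (ha : ∀ i, D.gen i ∈ N.U (a i))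
    {x : Bool → PlaneField k} (hx : ∀ q, D.RegAt q d x) :
    ∃ s, N.IsSection s ∧ ∀ i, F i * D.ev i (s (a i)) = x i := by
  have h : ∀ j, ∃ s : Γ(Proj 𝒮, N.U j), ∀ i, D.gen i ∈ N.U j →
      D.ev i s = (F i * D.ev i (N.g (a i) j))⁻¹ * x i := fun j =>
    D.exists_ev_eq fun q hq => by
      have := (hF q j hq).inv.regAt.mul (hx q)
      rwa [neg_add_cancel] at this
  choose s hs using h
  refine ⟨s, fun j l => D.eq_of_ev fun i hi => ?_, fun i => ?_⟩
  · rw [D.ev_mul, D.ev_map i hi, D.ev_map i hi, hs j i hi.1, hs l i hi.2,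
      ← D.ev_g_mul (ha i) hi.1 hi.2]
    have h1 := hF.ne_zero ha i
    have h2 := D.ev_g_ne_zero (ha i) hi.1
    have h3 := D.ev_g_ne_zero hi.1 hi.2
    field_simp
  · rw [hs _ i (ha i), D.ev_g_self (ha i), mul_one, mul_inv_cancel_left₀ (hF.ne_zero ha i)]

lemma section_eq_zero (ha : ∀ i, D.gen i ∈ N.U (a i)) {s : ∀ j, Γ(Proj 𝒮, N.U j)}
    (hs : N.IsSection s) (h : ∀ i, D.ev i (s (a i)) = 0) : s = 0 := by
  funext j
  refine D.eq_of_ev fun i hi => ?_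
  rw [D.ev_section hs hi (ha i), h, mul_zero]
  exact (D.ev_zero i).symm

end InvertibleSheaf

end DoublePlane

/-! ### Existence of frames -/

section Divisors

variable {k : Type u} [Field k] {σ : Type*} {K : Type*} [Field K] [Algebra (MvPolynomial σ k) K]
  [IsFractionRing (MvPolynomial σ k) K]

/-- A homogeneous Cartier divisor on a projective space is principal. -/
lemma exists_frame_of_cartier {Pt : Type*} (P : Pt → Ideal (MvPolynomial σ k))
    (hP : ∀ q, (P q).IsPrime) (E : Pt → K)
    (hinv : ∀ q, ∃ (m n : ℕ) (α β : MvPolynomial σ k), α.IsHomogeneous m ∧ β.IsHomogeneous n ∧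
      α ≠ 0 ∧ β ∉ P q ∧ E q * algebraMap _ K α = algebraMap _ K β)
    (hcompat : ∀ q q' p n, Irreducible p → p.IsHomogeneous n → p ∈ P q → p ∈ P q' →
      ∃ α β : MvPolynomial σ k, ¬ p ∣ α ∧ ¬ p ∣ β ∧
        E q' * algebraMap _ K β = E q * algebraMap _ K α) :
    ∀ (n : ℕ) (H : MvPolynomial σ k), H.IsHomogeneous n → H ≠ 0 →
      (∀ q, ∃ (m n : ℕ) (α β : MvPolynomial σ k), α.IsHomogeneous m ∧ β.IsHomogeneous n ∧ β ∉ P q ∧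
        algebraMap _ K H * E q * algebraMap _ K β = algebraMap _ K α) →
    ∃ (n : ℕ) (H : MvPolynomial σ k), H.IsHomogeneous n ∧ H ≠ 0 ∧
      ∀ q, ∃ (m n : ℕ) (α β : MvPolynomial σ k), α.IsHomogeneous m ∧ β.IsHomogeneous n ∧ α ∉ P q ∧
        β ∉ P q ∧ algebraMap _ K H * E q * algebraMap _ K β = algebraMap _ K α := by
  have hinj : Function.Injective (algebraMap (MvPolynomial σ k) K) :=
    IsFractionRing.injective _ _
  intro n
  induction n using Nat.strong_induction_on with
  | _ n ih =>
  intro H hH hH0 hreg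
  by_cases hall : ∀ q, ∃ (m n : ℕ) (α β : MvPolynomial σ k), α.IsHomogeneous m ∧
      β.IsHomogeneous n ∧ α ∉ P q ∧ β ∉ P q ∧
      algebraMap _ K H * E q * algebraMap _ K β = algebraMap _ K α
  · exact ⟨n, H, hH, hH0, hall⟩
  push Not at hall
  obtain ⟨q, hq⟩ := hall
  obtain ⟨m, l, a, b, ha, hb, hbq, hab⟩ := hreg q
  have haq : a ∈ P q := by
    by_contra haq
    exact hq m l a b ha hb haq hbq hab
  obtain ⟨m', l', a', b', ha', hb', ha'0, hb'q, hab'⟩ := hinv q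
  have hb0 : b ≠ 0 := fun h => hbq (h ▸ zero_mem _)
  have hb'0 : b' ≠ 0 := fun h => hb'q (h ▸ zero_mem _)
  -- Near `q` one has `H * E q = a / b`, and `a' / b'` is the inverse of `E q`.
  have hprod : H * b' * b = a * a' := by
    apply hinj
    simp only [map_mul]
    rw [← hab, ← hab']
    ring
  have ha0 : a ≠ 0 := by
    rintro rfl
    rw [zero_mul] at hprod
    exact mul_ne_zero (mul_ne_zero hH0 hb'0) hb0 hprod
  -- Where `H * E` is not invertible, its numerator has an irreducible factor `p` through `q`. By
  -- `hprod` this `p` divides `H`, since `b` and `b'` do not lie in `P q`. Replacing `H` by `H / p`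
  -- lowers the degree, and what remains is to see that `(H / p) * E` is still regular.
  obtain ⟨p, hp, ⟨c, hc⟩, hpq⟩ := exists_irreducible_dvd_mem (hP q) haq ha0
  obtain ⟨t, ht⟩ := exists_isHomogeneous_of_mul (hc ▸ ha) (hc ▸ ha0)
  have hpdvd : ∀ x, x ∉ P q → ¬ p ∣ x := fun x hx h => hx (Ideal.mem_of_dvd _ h hpq)
  have hpH : p ∣ H := by
    have h1 : p ∣ H * b' * b := hprod ▸ (Dvd.intro _ hc.symm).mul_right _
    rcases hp.prime.dvd_or_dvd h1 with h1 | h1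
    · rcases hp.prime.dvd_or_dvd h1 with h1 | h1
      · exact h1
      · exact absurd h1 (hpdvd _ hb'q)
    · exact absurd h1 (hpdvd _ hbq)
  obtain ⟨H', rfl⟩ := hpH
  have htpos := degree_pos_of_irreducible hp ht
  have hle : t ≤ n := by
    by_contra hlt
    exact right_ne_zero_of_mul hH0 (eq_zero_of_mul_isHomogeneous ht hp.ne_zero hH (by omega))
  refine ih (n - t) (by omega) H' (isHomogeneous_of_mul hH ht hp.ne_zero)
    (right_ne_zero_of_mul hH0) fun q' => ?_
  obtain ⟨m₂, l₂, a₂, b₂, ha₂, hb₂, hb₂q, hab₂⟩ := hreg q'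
  -- If the hypersurface `p = 0` passes through `q'`, then `E q` and `E q'` differ by a unit along
  -- it, so `p` divides the numerator at `q'` too. Otherwise `p` is invertible at `q'` and may join
  -- the denominator.
  by_cases hpq' : p ∈ P q'
  · obtain ⟨α, β, hα, hβ, hαβ⟩ := hcompat q q' p t hp ht hpq hpq'
    have h1 : a₂ * b * β = a * α * b₂ := by
      apply hinj
      simp only [map_mul] at hab hab₂ ⊢
      rw [← hab, ← hab₂]
      linear_combination (algebraMap _ K p * algebraMap _ K H' * algebraMap _ K b₂ *
        algebraMap _ K b) * hαβ
    have h2 : p ∣ a₂ := by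
      have h3 : p ∣ a₂ * b * β := h1 ▸ ((Dvd.intro _ hc.symm).mul_right _).mul_right _
      rcases hp.prime.dvd_or_dvd h3 with h3 | h3
      · rcases hp.prime.dvd_or_dvd h3 with h3 | h3
        · exact h3
        · exact absurd h3 (hpdvd _ hbq)
      · exact absurd h3 hβ
    obtain ⟨a₃, rfl⟩ := h2
    refine ⟨m₂ - t, l₂, a₃, b₂, isHomogeneous_of_mul ha₂ ht hp.ne_zero, hb₂, hb₂q, ?_⟩
    have hp0 : algebraMap _ K p ≠ 0 := fun h => hp.ne_zero (hinj (h.trans (map_zero _).symm))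
    apply mul_left_cancel₀ hp0
    simp only [map_mul] at hab₂
    rw [← hab₂]
    ring
  · refine ⟨m₂, t + l₂, a₂, p * b₂, ha₂, ht.mul hb₂, fun h =>
      ((hP q').mem_or_mem h).elim hpq' hb₂q, ?_⟩
    rw [← hab₂]
    simp only [map_mul]
    ring

/-- A homogeneous rational function without zeros and poles is constant. -/
lemma exists_const_of_no_zeros {Pt : Type*} (P : Pt → Ideal (MvPolynomial σ k))
    (hP : ∀ (p : MvPolynomial σ k) n, Irreducible p → p.IsHomogeneous n → ∃ q, p ∈ P q)
    (N M : Pt → MvPolynomial σ k) (hN : ∀ q, N q ∉ P q) (hM : ∀ q, M q ∉ P q) :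
    ∀ (t : ℕ) (n₀ m₀ : MvPolynomial σ k) (r : ℕ), n₀.IsHomogeneous t → m₀.IsHomogeneous r →
      n₀ ≠ 0 → m₀ ≠ 0 → (∀ q, N q * m₀ = M q * n₀) →
      ∃ κ : k, κ ≠ 0 ∧ n₀ = MvPolynomial.C κ * m₀ := by
  intro t
  induction t using Nat.strong_induction_on with
  | _ t ih =>
  intro n₀ m₀ r hn₀ hm₀ hn0 hm0 h
  have hdvd : ∀ p q x, p ∈ P q → x ∉ P q → ¬ p ∣ x := fun p q x hp hx hpx =>
    hx (Ideal.mem_of_dvd _ hpx hp)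
  by_cases hu : IsUnit n₀
  · have hum : IsUnit m₀ := by
      by_contra hum
      obtain ⟨p, hp, c, hc⟩ := WfDvdMonoid.exists_irreducible_factor hum hm0
      obtain ⟨s, hs⟩ := exists_isHomogeneous_of_mul (hc ▸ hm₀) (hc ▸ hm0)
      obtain ⟨q, hq⟩ := hP p s hp hs
      have h1 : p ∣ M q * n₀ := h q ▸ (Dvd.intro _ hc.symm).mul_left _
      rcases hp.prime.dvd_or_dvd h1 with h1 | h1
      · exact hdvd p q _ hq (hM q) h1
      · exact hp.not_isUnit (isUnit_of_dvd_unit h1 hu)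
    rw [MvPolynomial.isUnit_iff_eq_C_of_isReduced] at hu hum
    obtain ⟨x, hx, rfl⟩ := hu
    obtain ⟨y, hy, rfl⟩ := hum
    refine ⟨x / y, div_ne_zero hx.ne_zero hy.ne_zero, ?_⟩
    rw [← map_mul, div_mul_cancel₀ _ hy.ne_zero]
  · obtain ⟨p, hp, n₁, rfl⟩ := WfDvdMonoid.exists_irreducible_factor hu hn0
    obtain ⟨s, hs⟩ := exists_isHomogeneous_of_mul hn₀ hn0
    obtain ⟨q, hq⟩ := hP p s hp hs
    have h1 : p ∣ N q * m₀ := h q ▸ (dvd_mul_right p n₁).mul_left _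
    -- At a point of `p = 0` the quotient `n₀ / m₀` is the unit `N q / M q`, so a factor `p` of `n₀`
    -- must occur in `m₀` and can be cancelled.
    obtain ⟨m₁, rfl⟩ : p ∣ m₀ := (hp.prime.dvd_or_dvd h1).resolve_left (hdvd p q _ hq (hN q))
    have hspos := degree_pos_of_irreducible hp hs
    have hle : s ≤ t := by
      by_contra hlt
      exact right_ne_zero_of_mul hn0 (eq_zero_of_mul_isHomogeneous hs hp.ne_zero hn₀ (by omega))
    obtain ⟨κ, hκ, h2⟩ := ih (t - s) (by omega) n₁ m₁ (r - s) (isHomogeneous_of_mul hn₀ hs hp.ne_zero)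
      (isHomogeneous_of_mul hm₀ hs hp.ne_zero) (right_ne_zero_of_mul hn0)
      (right_ne_zero_of_mul hm0) fun q => mul_left_cancel₀ hp.ne_zero (by
        linear_combination h q)
    exact ⟨κ, hκ, by rw [h2]; ring⟩

end Divisors

namespace DoublePlane

variable {k : Type u} [Field k] {S : Type u} [CommRing S] [Algebra k S] {𝒮 : ℕ → Submodule k S}
  [GradedAlgebra 𝒮] (D : DoublePlane 𝒮)

/-- At a point of plane `i`, `e (!i)` vanishes, so by `exists_decomp` every element reduces to the
image under `ι` of a polynomial. If all the `ι (X j)` vanished there, the point would contain the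
irrelevant ideal. -/
lemma iSup_basicOpen_eq_top :
    ⨆ j : Fin 3, Proj.basicOpen 𝒮 (D.ι (MvPolynomial.X j)) = ⊤ := by
  refine top_le_iff.1 fun q _ => ?_
  by_contra hq
  simp only [Opens.mem_iSup, Proj.mem_basicOpen, not_exists, not_not] at hq
  have hq' : ∀ j : Fin 3, D.ι (MvPolynomial.X j) ∈ q.asHomogeneousIdeal.toIdeal := hq
  obtain ⟨i, hi⟩ : ∃ i, D.On i q := (D.on_or_on q true).elim (fun h => ⟨_, h⟩) (fun h => ⟨_, h⟩)
  have hpos : ∀ n, 0 < n → ∀ f : PlaneRing k, f.IsHomogeneous n → D.ι f ∈ q.asHomogeneousIdeal := by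
    intro n hn f hf
    have h1 : f ∈ Ideal.span (Set.range (MvPolynomial.X (R := k) (σ := Fin 3))) := by
      rw [← Set.image_univ, MvPolynomial.mem_ideal_span_X_image]
      intro m hm
      have := hf (MvPolynomial.mem_support_iff.1 hm)
      by_contra! h
      have hm0 : m = 0 := by ext j; simpa using h j (Set.mem_univ j)
      subst hm0
      simp at this
      omega
    have h2 : Ideal.span (Set.range (MvPolynomial.X (R := k) (σ := Fin 3))) ≤
        q.asHomogeneousIdeal.toIdeal.comap D.ι := by
      rw [Ideal.span_le]
      rintro _ ⟨j, rfl⟩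
      exact hq' j
    exact h2 h1
  refine ProjectiveSpectrum.not_irrelevant_le q fun a ha => ?_
  have hcomp : ∀ n, (DirectSum.decompose 𝒮 a n : S) ∈ q.asHomogeneousIdeal.toIdeal := by
    intro n
    rcases Nat.eq_zero_or_pos n with rfl | hn
    · have h0 := (HomogeneousIdeal.mem_irrelevant_iff 𝒮 a).1 ha
      rw [GradedRing.proj_apply] at h0
      rw [h0]
      exact zero_mem _
    · obtain ⟨c, -, hc⟩ := D.exists_decomp i (DirectSum.decompose 𝒮 a n : S)
      rw [hc]
      refine add_mem (hpos n hn _ (D.π_mem i n _ (SetLike.coe_mem _))) ?_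
      exact Ideal.mul_mem_right _ _ (D.on_iff.1 hi)
  classical
  rw [← DirectSum.sum_support_decompose 𝒮 a]
  exact Ideal.sum_mem q.asHomogeneousIdeal.toIdeal fun n _ => hcomp n

include D in
lemma isCompact_univ : IsCompact (Set.univ : Set (Proj 𝒮)) := by
  have h := congrArg (fun U : (Proj 𝒮).Opens => (U : Set (Proj 𝒮))) D.iSup_basicOpen_eq_top
  simp only [Opens.coe_iSup, Opens.coe_top] at h
  rw [← h]
  exact isCompact_iUnion fun j => (Proj.isAffineOpen_basicOpen 𝒮 _
    (D.ι_mem 1 _ (MvPolynomial.isHomogeneous_X _ _)) one_pos).isCompact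

include D in
lemma exists_finite_subcover (N : InvertibleSheaf (Proj 𝒮)) :
    ∃ J : Finset N.ι, ∀ q : Proj 𝒮, ∃ j ∈ J, q ∈ N.U j := by
  obtain ⟨J, hJ⟩ := D.isCompact_univ.elim_finite_subcover (fun j => (N.U j : Set (Proj 𝒮)))
    (fun j => (N.U j).isOpen) (fun q _ => by
      obtain ⟨j, hj⟩ := exists_mem_U N q
      exact Set.mem_iUnion.2 ⟨j, hj⟩)
  exact ⟨J, fun q => by simpa using hJ (Set.mem_univ q)⟩

end DoublePlane

namespace DoublePlane

variable {k : Type u} [Field k] {S : Type u} [CommRing S] [Algebra k S] {𝒮 : ℕ → Submodule k S}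
  [GradedAlgebra 𝒮] (D : DoublePlane 𝒮)

-- The two elements differ by a multiple of `e (!i)`, which vanishes at `q`. Points of plane `i` are
-- thus controlled by polynomials in three variables.
variable {D} in
lemma On.ι_π_mem {i : Bool} {q : Proj 𝒮} (h : D.On i q) {a : S} :
    D.ι (D.π i a) ∈ q.asHomogeneousIdeal ↔ a ∈ q.asHomogeneousIdeal := by
  obtain ⟨c, -, hc⟩ := D.exists_decomp i a
  have h1 : D.e (!i) * D.ι c ∈ q.asHomogeneousIdeal.toIdeal :=
    Ideal.mul_mem_right _ _ (D.on_iff.1 h)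
  have h2 : a ∈ q.asHomogeneousIdeal.toIdeal ↔ D.ι (D.π i a) ∈ q.asHomogeneousIdeal.toIdeal := by
    conv_lhs => rw [hc]
    exact Ideal.add_mem_iff_left _ h1
  exact h2.symm

variable {N : InvertibleSheaf (Proj 𝒮)}

/-- An invertible sheaf has a frame on each plane. -/
lemma exists_frame_plane (i : Bool) (a₀ : N.ι) (ha₀ : D.gen i ∈ N.U a₀) :
    ∃ (d : ℤ) (F : PlaneField k), ∀ q j, D.On i q → q ∈ N.U j →
      ∃ (m n : ℕ) (α β : PlaneRing k), α.IsHomogeneous m ∧ β.IsHomogeneous n ∧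
        D.ι α ∉ q.asHomogeneousIdeal ∧ D.ι β ∉ q.asHomogeneousIdeal ∧ (m : ℤ) = n + d ∧
        F * D.ev i (N.g a₀ j) * algebraMap _ _ β = algebraMap _ _ α := by
  classical
  have hinj := FaithfulSMul.algebraMap_injective (PlaneRing k) (PlaneField k)
  obtain ⟨J₀, hJ₀⟩ := D.exists_finite_subcover N
  -- Finiteness allows common denominators, and the members of the cover missing the generic point
  -- of plane `i` play no role at points of that plane.
  set J := J₀.filter fun j => D.gen i ∈ N.U j with hJdef
  have hJ : ∀ q, D.On i q → ∃ j ∈ J, q ∈ N.U j := fun q hq => by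
    obtain ⟨j, hj, hqj⟩ := hJ₀ q
    exact ⟨j, Finset.mem_filter.2 ⟨hj, hq.mem hqj⟩, hqj⟩
  have hfrac : ∀ j, D.gen i ∈ N.U j → ∃ (n : ℕ) (A B : PlaneRing k), A.IsHomogeneous n ∧
      B.IsHomogeneous n ∧ A ≠ 0 ∧ B ≠ 0 ∧
      D.ev i (N.g a₀ j) * algebraMap _ _ B = algebraMap _ _ A := by
    intro j hj
    obtain ⟨m, n, a, b, ha, hb, hmn, haq, hbq, hab⟩ := D.unitAt_g ha₀ hj
    refine ⟨n, D.π i a, D.π i b, ?_, D.π_mem i n b hb, (D.on_gen i).ne_zero haq,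
      (D.on_gen i).ne_zero hbq, hab i (D.on_gen i)⟩
    have := D.π_mem i m a ha
    rwa [show m = n by omega] at this
  choose! r A B hA hB hA0 hB0 hAB using hfrac
  have hJgen : ∀ j ∈ J, D.gen i ∈ N.U j := fun j hj => (Finset.mem_filter.1 hj).2
  have hPA : (∏ j ∈ J, A j).IsHomogeneous (∑ j ∈ J, r j) :=
    MvPolynomial.IsHomogeneous.prod _ _ _ fun j hj => hA j (hJgen j hj)
  have hPB : (∏ j ∈ J, B j).IsHomogeneous (∑ j ∈ J, r j) :=
    MvPolynomial.IsHomogeneous.prod _ _ _ fun j hj => hB j (hJgen j hj)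
  have hPA0 : ∏ j ∈ J, A j ≠ 0 := Finset.prod_ne_zero_iff.2 fun j hj => hA0 j (hJgen j hj)
  have hPB0 : ∏ j ∈ J, B j ≠ 0 := Finset.prod_ne_zero_iff.2 fun j hj => hB0 j (hJgen j hj)
  have hc0 : ∀ j, D.gen i ∈ N.U j → D.ev i (N.g a₀ j) ≠ 0 := fun j hj => D.ev_g_ne_zero ha₀ hj
  have hmap0 : ∀ {x : PlaneRing k}, x ≠ 0 → algebraMap (PlaneRing k) (PlaneField k) x ≠ 0 :=
    fun hx h => hx (hinj (h.trans (map_zero _).symm))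
  let Pt := {x : Proj 𝒮 × N.ι // D.On i x.1 ∧ x.2 ∈ J ∧ x.1 ∈ N.U x.2}
  let P : Pt → Ideal (PlaneRing k) := fun q => q.1.1.asHomogeneousIdeal.toIdeal.comap D.ι
  have hP : ∀ q, (P q).IsPrime := fun q => inferInstance
  -- The transition functions `A j / B j` from `a₀` are the local equations of the divisor. Dividing
  -- by the product of all `A j` makes the inverse of each equation a polynomial.
  let E : Pt → PlaneField k := fun q =>
    D.ev i (N.g a₀ q.1.2) / algebraMap (PlaneRing k) (PlaneField k) (∏ j ∈ J, A j)
  have h1P : ∀ q, (1 : PlaneRing k) ∉ P q := fun q h => (hP q).ne_top ((Ideal.eq_top_iff_one _).2 h)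
  have hsplit : ∀ (G : N.ι → PlaneRing k) j, j ∈ J →
      ∏ j ∈ J, G j = G j * ∏ j ∈ J.erase j, G j := fun G j hj => (Finset.mul_prod_erase J G hj).symm
  obtain ⟨n, H, hH, hH0, hHE⟩ := exists_frame_of_cartier P hP E
    (fun q => by
      obtain ⟨⟨q, j⟩, hq, hj, hqj⟩ := q
      have hjg := hJgen j hj
      refine ⟨_, 0, B j * ∏ j ∈ J.erase j, A j, 1, (hB j hjg).mul
        (MvPolynomial.IsHomogeneous.prod _ _ _ fun l hl => hA l (hJgen l (Finset.mem_of_mem_erase hl))),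
        MvPolynomial.isHomogeneous_one _ _, mul_ne_zero (hB0 j hjg) (Finset.prod_ne_zero_iff.2
        fun l hl => hA0 l (hJgen l (Finset.mem_of_mem_erase hl))), h1P _, ?_⟩
      change D.ev i (N.g a₀ j) / algebraMap (PlaneRing k) (PlaneField k) (∏ j ∈ J, A j) * _ = _
      rw [div_mul_eq_mul_div, div_eq_iff (hmap0 hPA0), map_one, one_mul, hsplit A j hj, map_mul,
        map_mul, ← hAB j hjg, mul_assoc])
    (fun q q' p n hp hpn hpq hpq' => by
      obtain ⟨⟨q, j⟩, hq, hj, hqj⟩ := q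
      obtain ⟨⟨q', j'⟩, hq', hj', hqj'⟩ := q'
      -- The generic point of the curve `p = 0` specializes to both `q` and `q'`, hence lies in both
      -- trivializing sets, and the transition function between them is invertible there.
      obtain ⟨x, hx, hxp⟩ := D.exists_point_plane i hpn hp
      have hle : ∀ y : Proj 𝒮, D.On i y → D.ι p ∈ y.asHomogeneousIdeal →
          x.asHomogeneousIdeal ≤ y.asHomogeneousIdeal := fun y hy hpy a ha => by
        rw [← hy.ι_π_mem]
        obtain ⟨c, hc⟩ := (hxp a).1 ha
        rw [hc, map_mul]
        exact Ideal.mul_mem_right _ y.asHomogeneousIdeal.toIdeal hpy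
      have hxj : x ∈ N.U j := mem_of_le (hle q hq hpq) hqj
      have hxj' : x ∈ N.U j' := mem_of_le (hle q' hq' hpq') hqj'
      obtain ⟨m, n, a, b, ha, hb, hmn, haq, hbq, hab⟩ := D.unitAt_g hxj hxj'
      refine ⟨D.π i a, D.π i b, fun h => haq ((hxp a).2 h), fun h => hbq ((hxp b).2 h), ?_⟩
      change D.ev i (N.g a₀ j') / algebraMap (PlaneRing k) (PlaneField k) (∏ j ∈ J, A j) * _ =
        D.ev i (N.g a₀ j) / algebraMap (PlaneRing k) (PlaneField k) (∏ j ∈ J, A j) * _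
      rw [div_mul_eq_mul_div, div_mul_eq_mul_div,
        ← D.ev_g_mul ha₀ (hJgen j hj) (hJgen j' hj'), mul_assoc]
      congr 2
      exact hab i hx)
    -- The starting polynomial: multiplied by any `E`, it leaves `A j` times the product of the
    -- other `B l`, a polynomial.
    _ ((∏ j ∈ J, A j) * ∏ j ∈ J, B j) (hPA.mul hPB) (mul_ne_zero hPA0 hPB0)
    (fun q => by
      obtain ⟨⟨q, j⟩, hq, hj, hqj⟩ := q
      have hjg := hJgen j hj
      refine ⟨_, 0, A j * ∏ j ∈ J.erase j, B j, 1, (hA j hjg).mul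
        (MvPolynomial.IsHomogeneous.prod _ _ _ fun l hl => hB l (hJgen l (Finset.mem_of_mem_erase hl))),
        MvPolynomial.isHomogeneous_one _ _, h1P _, ?_⟩
      change _ * (D.ev i (N.g a₀ j) / algebraMap (PlaneRing k) (PlaneField k) (∏ j ∈ J, A j)) * _ = _
      rw [map_one, mul_one, mul_div_assoc', div_eq_iff (hmap0 hPA0), map_mul, hsplit B j hj, map_mul,
        map_mul, ← hAB j hjg]
      ring)
  refine ⟨n - (∑ j ∈ J, r j : ℕ), algebraMap _ _ H / algebraMap _ _ (∏ j ∈ J, A j),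
    fun q j hq hqj => ?_⟩
  obtain ⟨l, hl, hql⟩ := hJ q hq
  have hlg := hJgen l hl
  obtain ⟨m', n', α, β, hα, hβ, hαq, hβq, hαβ⟩ := hHE ⟨(q, l), hq, hl, hql⟩
  change _ * (D.ev i (N.g a₀ l) / algebraMap (PlaneRing k) (PlaneField k) (∏ j ∈ J, A j)) * _ = _
    at hαβ
  have hα0 : α ≠ 0 := fun h => hαq (h ▸ zero_mem _)
  have hβ0 : β ≠ 0 := fun h => hβq (h ▸ zero_mem _)
  have hdeg : H * A l * β = α * B l * ∏ j ∈ J, A j := by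
    apply hinj
    simp only [map_mul]
    rw [← hαβ, ← hAB l hlg]
    have := hmap0 hPA0
    field_simp
  have hd := MvPolynomial.IsHomogeneous.inj_right ((hH.mul (hA l hlg)).mul hβ)
    (hdeg ▸ (hα.mul (hB l hlg)).mul hPA) (mul_ne_zero (mul_ne_zero hH0 (hA0 l hlg)) hβ0)
  -- The frame is known for an index `l` of `J`; the unit `g l j` carries it to an arbitrary index
  -- `j`.
  obtain ⟨m₁, n₁, a, b, ha, hb, hmn, haq, hbq, hab⟩ := D.unitAt_g hql hqj
  refine ⟨m' + m₁, n' + n₁, α * D.π i a, β * D.π i b, hα.mul (D.π_mem i _ _ ha),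
    hβ.mul (D.π_mem i _ _ hb), ?_, ?_, by
      rw [Nat.cast_add, Nat.cast_add]; omega, ?_⟩
  · rw [map_mul]
    exact mul_notMem hαq (hq.ι_π_mem.not.2 haq)
  · rw [map_mul]
    exact mul_notMem hβq (hq.ι_π_mem.not.2 hbq)
  · rw [← D.ev_g_mul ha₀ hlg (hq.mem hqj), map_mul, map_mul, ← hαβ]
    have h : D.ev i (N.g l j) * algebraMap _ _ (D.π i b) = algebraMap _ _ (D.π i a) := hab i hq
    rw [← h]
    ring

/-- Every invertible sheaf on the union of two planes is a twist of the structure sheaf. -/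
theorem exists_isFrame (a : Bool → N.ι) (ha : ∀ i, D.gen i ∈ N.U (a i)) :
    ∃ (d : ℤ) (F : Bool → PlaneField k), D.IsFrame N a d F := by
  have hinj := FaithfulSMul.algebraMap_injective (PlaneRing k) (PlaneField k)
  choose d F hF using fun i => D.exists_frame_plane i (a i) (ha i)
  choose! m n α β hα hβ hαq hβq hmn hαβ using hF
  have hline : ∀ {q : Proj 𝒮} {x : PlaneRing k}, (∀ i, D.On i q) → D.ι x ∉ q.asHomogeneousIdeal →
      lineRes x ∉ q.asHomogeneousIdeal.toIdeal.comap (D.ι.comp lineLift) := by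
    intro q x hq hx h
    obtain ⟨c, hc⟩ := X_zero_dvd_sub_lineLift x
    apply hx
    rw [← sub_add_cancel x (lineLift (lineRes x)), map_add, hc, map_mul]
    have h1 : D.ι (MvPolynomial.X 0) ∈ q.asHomogeneousIdeal.toIdeal := by
      have := (hq false).ι_π_mem.2 (D.on_iff.1 (hq true))
      rwa [show (!true) = false from rfl, D.π_e] at this
    exact add_mem (S := Ideal S) (Ideal.mul_mem_right _ _ h1) h
  choose jj hjj using exists_mem_U N
  let Pt := {q : Proj 𝒮 // ∀ i, D.On i q}
  let P : Pt → Ideal (MvPolynomial (Fin 2) k) := fun q =>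
    q.1.asHomogeneousIdeal.toIdeal.comap (D.ι.comp lineLift)
  -- On the line, `num / den` is the ratio of the frame of plane `false` to that of plane `true`,
  -- near `q`.
  let num : Proj 𝒮 → N.ι → PlaneRing k := fun q j => α false q j * β true q j
  let den : Proj 𝒮 → N.ι → PlaneRing k := fun q j => α true q j * β false q j
  have hnum : ∀ q j, (∀ i, D.On i q) → q ∈ N.U j → D.ι (num q j) ∉ q.asHomogeneousIdeal := by
    intro q j hq hj
    rw [map_mul]
    exact mul_notMem (hαq _ q j (hq _) hj) (hβq _ q j (hq _) hj)
  have hden : ∀ q j, (∀ i, D.On i q) → q ∈ N.U j → D.ι (den q j) ∉ q.asHomogeneousIdeal := by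
    intro q j hq hj
    rw [map_mul]
    exact mul_notMem (hαq _ q j (hq _) hj) (hβq _ q j (hq _) hj)
  obtain ⟨z, hz, hzm⟩ := D.exists_point_line (MvPolynomial.isHomogeneous_zero _ _ 0) (Or.inl rfl)
  have hzle : ∀ q, (∀ i, D.On i q) → z.asHomogeneousIdeal ≤ q.asHomogeneousIdeal := by
    intro q hq a ha
    have h0 : D.res a = 0 := zero_dvd_iff.1 ((hzm a).1 ha)
    obtain ⟨c, hc⟩ := lineRes_eq_zero_iff.1 h0
    have hc' : D.π false a = MvPolynomial.X 0 * c := hc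
    refine (hq false).ι_π_mem.1 ?_
    rw [hc', map_mul]
    have h1 : D.ι (MvPolynomial.X 0) ∈ q.asHomogeneousIdeal.toIdeal := by
      have := (hq false).ι_π_mem.2 (D.on_iff.1 (hq true))
      rwa [show (!true) = false from rfl, D.π_e] at this
    exact Ideal.mul_mem_right _ _ h1
  have hz0 : ∀ {x : PlaneRing k}, D.ι x ∉ z.asHomogeneousIdeal → lineRes x ≠ 0 := by
    intro x hx h
    rw [hzm, ← D.lineRes_π false, D.π_ι, h] at hx
    exact hx dvd_rfl
  -- The ratio of the frames does not depend on `q` or on the trivialization: it is compared with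
  -- the ratio at the generic point `z` of the line, and the transition function `a₁ / b₁` is the
  -- same on both planes.
  have hcross : ∀ q j, (∀ i, D.On i q) → q ∈ N.U j →
      lineRes (num q j) * lineRes (den z (jj z)) = lineRes (den q j) * lineRes (num z (jj z)) := by
    intro q j hq hj
    obtain ⟨m₁, n₁, a₁, b₁, ha₁, hb₁, hmn₁, haq₁, hbq₁, hab₁⟩ :=
      D.unitAt_g (hjj z) (mem_of_le (hzle q hq) hj)
    have key : ∀ i, lineRes (α i q j) * lineRes (β i z (jj z)) * D.res b₁ =
        lineRes (α i z (jj z)) * lineRes (β i q j) * D.res a₁ := by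
      intro i
      rw [← D.lineRes_π i, ← D.lineRes_π i, ← map_mul, ← map_mul, ← map_mul, ← map_mul]
      congr 1
      apply hinj
      simp only [map_mul]
      rw [← hαβ i q j (hq i) hj, ← hαβ i z (jj z) (hz i) (hjj z),
        ← D.ev_g_mul (ha i) ((hz i).mem (hjj z)) ((hq i).mem hj)]
      have h : D.ev i (N.g (jj z) j) * algebraMap _ _ (D.π i b₁) = algebraMap _ _ (D.π i a₁) :=
        hab₁ i (hz i)
      rw [← h]
      ring
    have ha0 : D.res a₁ ≠ 0 := fun h => haq₁ ((hzm _).2 (h ▸ dvd_rfl))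
    have hb0 : D.res b₁ ≠ 0 := fun h => hbq₁ ((hzm _).2 (h ▸ dvd_rfl))
    have h0 := key false
    have h1 := key true
    apply mul_left_cancel₀ (mul_ne_zero ha0 hb0)
    simp only [num, den, map_mul]
    linear_combination (lineRes (β true q j) * lineRes (α true z (jj z)) * D.res a₁) * h0 -
      (lineRes (α false z (jj z)) * lineRes (β false q j) * D.res a₁) * h1
  have hzn : (lineRes (num z (jj z))).IsHomogeneous _ := lineRes_isHomogeneous
    ((hα false z _ (hz _) (hjj z)).mul (hβ true z _ (hz _) (hjj z)))
  have hzd : (lineRes (den z (jj z))).IsHomogeneous _ := lineRes_isHomogeneous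
    ((hα true z _ (hz _) (hjj z)).mul (hβ false z _ (hz _) (hjj z)))
  have hzn0 := hz0 (hnum z (jj z) hz (hjj z))
  have hzd0 := hz0 (hden z (jj z) hz (hjj z))
  -- A rational function on the line without zeros or poles is constant. This gives both the
  -- equality of the two twists and the factor by which to rescale one frame.
  obtain ⟨κ, hκ, hκz⟩ := exists_const_of_no_zeros P
    (fun p n hp hpn => by
      obtain ⟨q, hq, hqm⟩ := D.exists_point_line hpn (Or.inr hp)
      refine ⟨⟨q, hq⟩, ?_⟩
      change D.ι (lineLift p) ∈ q.asHomogeneousIdeal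
      rw [hqm, ← D.lineRes_π false, D.π_ι, lineRes_lineLift])
    (fun q => lineRes (num q.1 (jj q.1))) (fun q => lineRes (den q.1 (jj q.1)))
    (fun q => hline q.2 (hnum _ _ q.2 (hjj _))) (fun q => hline q.2 (hden _ _ q.2 (hjj _)))
    _ _ _ _ hzn hzd hzn0 hzd0 (fun q => hcross _ _ q.2 (hjj _))
  have hd : d false = d true := by
    rw [hκz] at hzn hzn0
    have h1 := MvPolynomial.IsHomogeneous.inj_right hzn
      (by simpa using (MvPolynomial.isHomogeneous_C _ κ).mul hzd) hzn0
    have h2 := hmn false z _ (hz _) (hjj z)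
    have h3 := hmn true z _ (hz _) (hjj z)
    omega
  have hglue : ∀ q j, (∀ i, D.On i q) → q ∈ N.U j →
      lineRes (num q j) = lineRes (MvPolynomial.C κ * den q j) := by
    intro q j hq hj
    have h1 := hcross q j hq hj
    rw [hκz] at h1
    apply mul_right_cancel₀ hzd0
    have h2 : lineRes (MvPolynomial.C κ : PlaneRing k) = MvPolynomial.C κ := by simp [lineRes]
    rw [h1, map_mul lineRes (MvPolynomial.C κ), h2]
    ring
  have hκC : algebraMap (PlaneRing k) (PlaneField k) (MvPolynomial.C κ) =
      algebraMap k (PlaneField k) κ :=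
    (IsScalarTower.algebraMap_apply k (PlaneRing k) (PlaneField k) κ).symm
  refine ⟨d false, fun i => if i then algebraMap k _ κ * F i else F i, fun q j hj => ?_⟩
  have hκunit : ∀ {q : Proj 𝒮}, D.ι (MvPolynomial.C κ) ∉ q.asHomogeneousIdeal := by
    intro q h
    refine (isPrime_asHomogeneousIdeal q).ne_top (Ideal.eq_top_of_isUnit_mem _ h ?_)
    exact ((isUnit_iff_ne_zero.2 hκ).map MvPolynomial.C).map D.ι
  by_cases hq : ∀ i, D.On i q
  · have h1 := hα false q j (hq _) hj
    have h2 := hβ false q j (hq _) hj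
    have h3 := hα true q j (hq _) hj
    have h4 := hβ true q j (hq _) hj
    have h5 := hmn false q j (hq _) hj
    have h6 := hmn true q j (hq _) hj
    -- Over the common denominator `β false * β true` the rescaled frames have numerators `num` and
    -- `κ * den`, which agree on the line and so glue.
    obtain ⟨x, hx, hxy⟩ := D.exists_mem_of_lineRes_eq
      (y := fun i => if i then MvPolynomial.C κ * den q j else num q j)
      (n := m false q j + n true q j) (by
        rintro (_ | _)
        · exact h1.mul h4
        · have h7 := (MvPolynomial.isHomogeneous_C (Fin 3) κ).mul (h3.mul h2)
          rwa [show 0 + (m true q j + n false q j) = m false q j + n true q j by omega] at h7)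
      (hglue q j hq hj)
    refine ⟨_, _, x, D.ι (β false q j * β true q j), hx, D.ι_mem _ _ (h2.mul h4),
      by push_cast; omega, ?_, ?_, ?_⟩
    · rw [← (hq false).ι_π_mem, hxy]
      exact hnum q j hq hj
    · rw [map_mul]
      exact mul_notMem (hβq _ _ _ (hq _) hj) (hβq _ _ _ (hq _) hj)
    · intro i _
      change _ * algebraMap _ _ (D.π i _) = algebraMap _ _ (D.π i x)
      rw [hxy, D.π_ι]
      rcases i with _ | _
      · simp only [num, map_mul, Bool.false_eq_true, if_false]
        rw [← hαβ false q j (hq _) hj]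
        ring
      · simp only [den, map_mul, if_true]
        rw [← hαβ true q j (hq _) hj, hκC]
        ring
  -- Away from the line there is nothing to glue.
  · obtain ⟨i, hi, hi'⟩ : ∃ i, D.On i q ∧ ¬ D.On (!i) q := by
      push Not at hq
      obtain ⟨i, hi⟩ := hq
      exact ⟨!i, (D.on_or_on q i).resolve_left hi, by rwa [Bool.not_not]⟩
    have h1 := hα i q j hi hj
    have h2 := hβ i q j hi hj
    have h3 := hmn i q j hi hj
    refine ⟨_, _, D.ι ((if i then MvPolynomial.C κ else 1) * α i q j), D.ι (β i q j),
      D.ι_mem (m i q j) _ ?_, D.ι_mem _ _ h2, ?_, ?_, hβq _ _ _ hi hj, fun l hl => ?_⟩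
    · split_ifs
      · simpa using (MvPolynomial.isHomogeneous_C (Fin 3) κ).mul h1
      · simpa using h1
    · rcases i with _ | _ <;> omega
    · rw [map_mul]
      refine mul_notMem ?_ (hαq _ _ _ hi hj)
      split_ifs
      · exact hκunit
      · rw [map_one]
        exact fun h => (isPrime_asHomogeneousIdeal q).ne_top ((Ideal.eq_top_iff_one _).2 h)
    · obtain rfl : l = i := by
        by_contra h
        obtain rfl : l = !i := by cases i <;> cases l <;> simp_all
        exact hi' hl
      change _ * algebraMap _ _ (D.π l _) = algebraMap _ _ (D.π l _)
      rw [D.π_ι, D.π_ι, map_mul, ← hαβ l q j hl hj]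
      rcases l with _ | _
      · simp only [Bool.false_eq_true, if_false, map_one]
        ring
      · simp only [if_true, hκC]
        ring

end DoublePlane

/-! ### Linear changes of coordinates and the standard quadric `x₀x₁ = 0`. -/

section Coordinates

variable {k : Type u} [Field k]

lemma dvd_sub_of_forall_X {σ : Type*} {B : Type*} [CommRing B] [Algebra k B]
    (f g : MvPolynomial σ k →ₐ[k] B) (d : B)
    (h : ∀ i, d ∣ f (MvPolynomial.X i) - g (MvPolynomial.X i)) (p : MvPolynomial σ k) :
    d ∣ f p - g p := by
  have key : (Ideal.Quotient.mkₐ k (Ideal.span {d})).comp f =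
      (Ideal.Quotient.mkₐ k (Ideal.span {d})).comp g := by
    ext i
    exact Ideal.Quotient.eq.2 (Ideal.mem_span_singleton.2 (h i))
  exact Ideal.mem_span_singleton.1 (Ideal.Quotient.eq.1 (DFunLike.congr_fun key p))

/-- The two forms extend to a basis of the space of linear forms. Substituting this basis for the
variables is invertible: the inverse substitutes the coordinates of each variable in the basis. -/
lemma exists_linear_change {l₁ l₂ : MvPolynomial (Fin 4) k} (h₁ : l₁.IsHomogeneous 1)
    (h₂ : l₂.IsHomogeneous 1) (hl : LinearIndependent k ![l₁, l₂]) :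
    ∃ p : MvPolynomial (Fin 4) k ≃ₐ[k] MvPolynomial (Fin 4) k,
      p (MvPolynomial.X 0) = l₁ ∧ p (MvPolynomial.X 1) = l₂ ∧
      (∀ n f, f.IsHomogeneous n → (p f).IsHomogeneous n) ∧
      ∀ n f, f.IsHomogeneous n → (p.symm f).IsHomogeneous n := by
  let V := MvPolynomial.homogeneousSubmodule (Fin 4) k 1
  have hV : Module.finrank k V = 4 := by
    rw [finrank_homogeneousSubmodule]
    simp
  let v : Fin 2 → V := ![⟨l₁, h₁⟩, ⟨l₂, h₂⟩]
  have hv : LinearIndependent k v := by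
    refine LinearIndependent.of_comp V.subtype ?_
    have e : V.subtype ∘ v = ![l₁, l₂] := by
      ext1 i
      fin_cases i <;> rfl
    rw [e]
    exact hl
  obtain ⟨x, hx⟩ := exists_linearIndependent_snoc_of_lt_finrank hv (by omega)
  obtain ⟨y, hy⟩ := exists_linearIndependent_snoc_of_lt_finrank hx (by omega)
  let b := basisOfLinearIndependentOfCardEqFinrank hy (by simp [hV])
  have hb : ∀ i, b i = Fin.snoc (α := fun _ => V) (Fin.snoc (α := fun _ => V) v x) y i :=
    fun i => congrFun (coe_basisOfLinearIndependentOfCardEqFinrank hy _) i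
  let X' : Fin 4 → V := fun i => ⟨MvPolynomial.X i, MvPolynomial.isHomogeneous_X _ _⟩
  let p : MvPolynomial (Fin 4) k →ₐ[k] MvPolynomial (Fin 4) k :=
    MvPolynomial.aeval fun i => (b i : MvPolynomial (Fin 4) k)
  let q : MvPolynomial (Fin 4) k →ₐ[k] MvPolynomial (Fin 4) k :=
    MvPolynomial.aeval fun i => ∑ j, b.repr (X' i) j • MvPolynomial.X j
  have hpq : p.comp q = AlgHom.id k _ := by
    ext1 i
    have h := congrArg (Submodule.subtype V) (b.sum_repr (X' i))
    simp only [map_sum, map_smul] at h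
    simp only [AlgHom.comp_apply, q, MvPolynomial.aeval_X, map_sum, map_smul, AlgHom.id_apply]
    simpa [p, X'] using h
  have hpq' : ∀ f, p (q f) = f := fun f => DFunLike.congr_fun hpq f
  have hq : ∀ x : V, q x = ∑ j, b.repr x j • MvPolynomial.X j := by
    rintro ⟨x, hx⟩
    have hx' := hx
    rw [show V = _ from MvPolynomial.homogeneousSubmodule_one_eq_span_X] at hx'
    induction hx' using Submodule.span_induction with
    | mem x h =>
      obtain ⟨i, rfl⟩ := h
      simp [q, X']
    | zero => simp [show (⟨0, hx⟩ : V) = 0 from rfl]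
    | add x y hx₁ hy₁ ihx ihy =>
      rw [← MvPolynomial.homogeneousSubmodule_one_eq_span_X] at hx₁ hy₁
      have : (⟨x + y, hx⟩ : V) = ⟨x, hx₁⟩ + ⟨y, hy₁⟩ := rfl
      rw [this, map_add, Submodule.coe_add, map_add, ihx hx₁, ihy hy₁, ← Finset.sum_add_distrib]
      exact Finset.sum_congr rfl fun j _ => by rw [Finsupp.add_apply, add_smul]
    | smul c x hx₁ ihx =>
      rw [← MvPolynomial.homogeneousSubmodule_one_eq_span_X] at hx₁
      have : (⟨c • x, hx⟩ : V) = c • ⟨x, hx₁⟩ := rfl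
      rw [this, map_smul, Submodule.coe_smul, map_smul, ihx hx₁, Finset.smul_sum]
      exact Finset.sum_congr rfl fun j _ => by rw [Finsupp.smul_apply, smul_assoc]
  refine ⟨AlgEquiv.ofAlgHom p q hpq ?_, ?_, ?_, ?_, ?_⟩
  · ext1 i
    rw [AlgHom.comp_apply, MvPolynomial.aeval_X, hq]
    simp [Finsupp.single_apply]
  · change p _ = _
    simp only [p, MvPolynomial.aeval_X, hb]
    rfl
  · change p _ = _
    simp only [p, MvPolynomial.aeval_X, hb]
    rfl
  · intro n f hf
    have := hf.aeval (fun i => (b i : MvPolynomial (Fin 4) k)) fun i => (b i).2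
    rwa [one_mul] at this
  · intro n f hf
    have := hf.aeval (fun i => ∑ j, b.repr (X' i) j • (MvPolynomial.X j : MvPolynomial (Fin 4) k))
      (n := 1) fun i => MvPolynomial.IsHomogeneous.sum _ _ _ fun j _ =>
        (MvPolynomial.homogeneousSubmodule (Fin 4) k 1).smul_mem _
          (MvPolynomial.isHomogeneous_X _ _)
    rwa [one_mul] at this

/-- The restriction of the standard quadric `x₀x₁ = 0` to one of its planes. -/
def planeRes (i : Bool) : MvPolynomial (Fin 4) k →ₐ[k] PlaneRing k :=
  MvPolynomial.aeval
    ![bif i then 0 else MvPolynomial.X 0, bif i then MvPolynomial.X 0 else 0,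
      MvPolynomial.X 1, MvPolynomial.X 2]

/-- The projection of the standard quadric `x₀x₁ = 0` to a plane. -/
def planeProj : PlaneRing k →ₐ[k] MvPolynomial (Fin 4) k :=
  MvPolynomial.aeval
    ![MvPolynomial.X 0 + MvPolynomial.X 1, MvPolynomial.X 2, MvPolynomial.X 3]

/-- On either plane one summand of `x₀ + x₁` vanishes and the other restricts to `u`, so `planeProj`
is a section of both restrictions at once. -/
lemma planeRes_planeProj (i : Bool) (f : PlaneRing k) : planeRes i (planeProj f) = f := by
  have : (planeRes i).comp planeProj = AlgHom.id k (PlaneRing k) := by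
    ext1 j
    cases i <;> fin_cases j <;> simp [planeRes, planeProj]
  exact DFunLike.congr_fun this f

lemma planeRes_isHomogeneous (i : Bool) {n : ℕ} {f : MvPolynomial (Fin 4) k}
    (hf : f.IsHomogeneous n) : (planeRes i f).IsHomogeneous n := by
  have := hf.aeval (n := 1) (S := k) (τ := Fin 3)
    ![bif i then 0 else MvPolynomial.X 0, bif i then MvPolynomial.X 0 else 0,
      MvPolynomial.X 1, MvPolynomial.X 2] (fun j => by
        cases i <;> fin_cases j <;>
        first
          | exact MvPolynomial.isHomogeneous_X _ _
          | exact MvPolynomial.isHomogeneous_zero _ _ _)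
  rwa [one_mul] at this

lemma planeProj_isHomogeneous {n : ℕ} {f : PlaneRing k} (hf : f.IsHomogeneous n) :
    (planeProj f).IsHomogeneous n := by
  have := hf.aeval (n := 1) (S := k) (τ := Fin 4)
    ![MvPolynomial.X 0 + MvPolynomial.X 1, MvPolynomial.X 2, MvPolynomial.X 3] (fun j => by
        fin_cases j
        · exact (MvPolynomial.isHomogeneous_X _ _).add (MvPolynomial.isHomogeneous_X _ _)
        · exact MvPolynomial.isHomogeneous_X _ _
        · exact MvPolynomial.isHomogeneous_X _ _)
  rwa [one_mul] at this

/-- Modulo the variable vanishing on a plane, `f` is determined by its restriction to that plane. So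
`x₀` and `x₁` both divide `f`, and they are non-associated primes. -/
lemma dvd_of_planeRes {f : MvPolynomial (Fin 4) k} (h : ∀ i, planeRes i f = 0) :
    MvPolynomial.X 0 * MvPolynomial.X 1 ∣ f := by
  have key : ∀ (l : Fin 4) (j : Bool), l = (bif j then 0 else 1) →
      MvPolynomial.X l ∣ f := by
    rintro l j rfl
    have := dvd_sub_of_forall_X (AlgHom.id k (MvPolynomial (Fin 4) k))
      ((MvPolynomial.aeval ![MvPolynomial.X (bif j then 1 else 0), MvPolynomial.X 2,
        MvPolynomial.X 3]).comp (planeRes j)) (MvPolynomial.X (bif j then 0 else 1)) (fun i => by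
          cases j <;> fin_cases i <;> simp [planeRes]) f
    simpa [h j] using this
  obtain ⟨g, rfl⟩ := key 0 true rfl
  have h1 : Prime (MvPolynomial.X 1 : MvPolynomial (Fin 4) k) := MvPolynomial.X_prime
  refine mul_dvd_mul_left _ ((h1.dvd_or_dvd (key 1 false rfl)).resolve_left fun h => ?_)
  simp [MvPolynomial.X_dvd_X] at h

end Coordinates

namespace RankTwoQuadric

variable {k : Type u} [Field k] (Q : RankTwoQuadric k)

lemma exists_doublePlane : ∃ D : DoublePlane Q.grading,
    D.e false = Ideal.Quotient.mk _ Q.l₁ ∧ D.e true = Ideal.Quotient.mk _ Q.l₂ := by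
  obtain ⟨p, h₁, h₂, hp, hq⟩ := exists_linear_change Q.hom₁ Q.hom₂ Q.linearIndependent
  have hq₁ : p.symm Q.l₁ = MvPolynomial.X 0 := by rw [← h₁, p.symm_apply_apply]
  have hq₂ : p.symm Q.l₂ = MvPolynomial.X 1 := by rw [← h₂, p.symm_apply_apply]
  have hπ : ∀ (i : Bool) (a : MvPolynomial (Fin 4) k), a ∈ Q.ideal →
      (planeRes i).comp p.symm.toAlgHom a = 0 := by
    intro i a ha
    obtain ⟨c, rfl⟩ := Ideal.mem_span_singleton.1 ha
    cases i <;> simp [hq₁, hq₂, planeRes]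
  refine ⟨⟨fun i => Ideal.Quotient.liftₐ Q.ideal ((planeRes i).comp p.symm.toAlgHom) (hπ i),
    (Ideal.Quotient.mkₐ k Q.ideal).comp (p.toAlgHom.comp planeProj),
    fun i => Ideal.Quotient.mk _ (bif i then Q.l₂ else Q.l₁), ?_, ?_, ?_, ?_, ?_, ?_, ?_, ?_⟩,
    rfl, rfl⟩
  · rintro i n _ ⟨a, ha, rfl⟩
    exact planeRes_isHomogeneous i (hq n a ha)
  · intro n f hf
    exact ⟨_, hp n _ (planeProj_isHomogeneous hf), rfl⟩
  · intro i
    refine ⟨_, ?_, rfl⟩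
    cases i
    exacts [Q.hom₁, Q.hom₂]
  · intro i f
    change planeRes i (p.symm (p (planeProj f))) = f
    rw [p.symm_apply_apply, planeRes_planeProj]
  · intro i
    change planeRes i (p.symm (bif i then Q.l₂ else Q.l₁)) = _
    cases i <;> simp [hq₁, hq₂, planeRes]
  · intro i
    change planeRes i (p.symm (bif !i then Q.l₂ else Q.l₁)) = _
    cases i <;> simp [hq₁, hq₂, planeRes]
  · intro a ha
    obtain ⟨a, rfl⟩ := Ideal.Quotient.mk_surjective a
    obtain ⟨c, hc⟩ := dvd_of_planeRes (f := p.symm a) ha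
    refine Ideal.Quotient.eq_zero_iff_mem.2 (Ideal.mem_span_singleton.2 ⟨p c, ?_⟩)
    rw [← h₁, ← h₂, ← map_mul, ← map_mul, ← hc, p.apply_symm_apply]
  · intro i a
    obtain ⟨a, rfl⟩ := Ideal.Quotient.mk_surjective a
    change _ ∣ planeRes (!i) (p.symm a) - planeRes i (p.symm a)
    refine dvd_sub_of_forall_X _ _ _ (fun j => ?_) _
    cases i <;> fin_cases j <;> simp [planeRes]

end RankTwoQuadric

/-! ### The structure morphism of `Proj` on constants. -/

section Scalars

variable {k : Type u} [Field k] {S : Type u} [CommRing S] [Algebra k S] {𝒮 : ℕ → Submodule k S}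
  [GradedAlgebra 𝒮]

lemma topIso_inv_appTop {X : Scheme.{u}} {U : X.Opens} (hU : ⊤ ≤ U) (j : X ⟶ U.toScheme)
    (hj : j ≫ U.ι = 𝟙 X) :
    U.topIso.inv ≫ j.appTop = X.presheaf.map (homOfLE hU).op := by
  have h1 : U.topIso.inv = U.ι.appLE U ⊤ (by simp) := by
    rw [Scheme.Opens.ι_appLE]
    rfl
  have h2 : j.appTop = j.appLE ⊤ ⊤ (le_of_eq (Scheme.Hom.preimage_top _).symm) :=
    (Scheme.Hom.appLE_eq_app _).symm
  rw [h1, h2, Scheme.Hom.appLE_comp_appLE]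
  have key : ∀ (f g : X ⟶ X) (h : f = g) (e : ⊤ ≤ f ⁻¹ᵁ U) (e' : ⊤ ≤ g ⁻¹ᵁ U),
      f.appLE U ⊤ e = g.appLE U ⊤ e' := by
    rintro f _ rfl _ _; rfl
  rw [key _ _ hj _ hU]
  simp only [Scheme.Hom.appLE, Scheme.Hom.id_app]
  exact Category.id_comp _

/-- `Proj.toSpecZero` is defined through the basic open set of `1`, which is all of `Proj`.
Following global sections through this definition makes the action of the constants computable. -/
lemma toSpecZero_appTop :
    (Scheme.ΓSpecIso (.of (𝒮 0))).inv ≫ (Proj.toSpecZero 𝒮).appTop =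
      CommRingCat.ofHom (HomogeneousLocalization.fromZeroRingHom 𝒮 _) ≫
        Proj.awayToSection 𝒮 1 ≫
          (Proj 𝒮).presheaf.map (homOfLE (Proj.basicOpen_one 𝒮).ge).op := by
  let j : Proj 𝒮 ⟶ (Proj.basicOpen 𝒮 1).toScheme :=
    (Scheme.topIso _).inv ≫ (Scheme.isoOfEq _ (Proj.basicOpen_one _)).inv
  have hj : j ≫ (Proj.basicOpen 𝒮 1).ι = 𝟙 _ := by simp [j]
  have h1 : Proj.toSpecZero 𝒮 = j ≫ Proj.basicOpenToSpec 𝒮 1 ≫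
      Spec.map (CommRingCat.ofHom (HomogeneousLocalization.fromZeroRingHom 𝒮 _)) := by
    simp [Proj.toSpecZero, j]
  have h3 : (Proj.basicOpenToSpec 𝒮 1).appTop = _ := Proj.basicOpenToSpec_app_top 𝒮 1
  rw [h1, Scheme.Hom.comp_appTop, Scheme.Hom.comp_appTop, h3, Category.assoc,
    ← Scheme.ΓSpecIso_inv_naturality_assoc]
  simp only [Category.assoc, Iso.inv_hom_id_assoc]
  rw [topIso_inv_appTop _ j hj]

lemma DoublePlane.ev_awayToSection (D : DoublePlane 𝒮) (i : Bool) (c : 𝒮 0) :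
    D.ev i (Proj.awayToSection 𝒮 1 (HomogeneousLocalization.fromZeroRingHom 𝒮 _ c)) =
      D.toField i c := by
  have h : D.gen i ∈ Proj.basicOpen 𝒮 1 := by
    rw [Proj.basicOpen_one]
    trivial
  rw [D.ev_eq i h]
  have hm : Submonoid.powers (1 : S) ≤ (D.gen i).asHomogeneousIdeal.toIdeal.primeCompl :=
    Submonoid.powers_le.2 h
  have h1 : value (D.gen i) (D.toField i : S →+* PlaneField k) (D.toField_gen_ne_zero i) h
      (Proj.awayToSection 𝒮 1 (HomogeneousLocalization.fromZeroRingHom 𝒮 _ c)) =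
      fiberHom (D.gen i) (D.toField i : S →+* PlaneField k) (D.toField_gen_ne_zero i)
        (HomogeneousLocalization.mk ⟨0, c, 1, one_mem _⟩) := by
    refine congrArg (fiberHom (D.gen i) (D.toField i : S →+* PlaneField k)
      (D.toField_gen_ne_zero i)) ?_
    change HomogeneousLocalization.mapId 𝒮 hm (HomogeneousLocalization.mk ⟨0, c, 1, one_mem _⟩) = _
    rfl
  rw [h1]
  have := fiberHom_mk (D.gen i) (D.toField i : S →+* PlaneField k) (D.toField_gen_ne_zero i)
    ⟨0, c, 1, one_mem _⟩
  have h2 : (D.toField i : S →+* PlaneField k) ((1 : 𝒮 0) : S) = 1 :=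
    (congrArg _ ((SetLike.GradeZero.coe_one : ((1 : 𝒮 0) : S) = 1))).trans (map_one _)
  rw [← mul_one (fiberHom _ _ _ _)]
  rw [← h2]
  exact this

end Scalars

/-! ### The sheaves `L ⊗ ⋯ ⊗ (σⁿ⁻¹)^*L` and multiplication by constants. -/

namespace InvertibleSheaf

variable {X : Scheme.{u}} (L : InvertibleSheaf X) (σ : X ⟶ X)

/-- The invertible sheaf `L ⊗ σ^*L ⊗ ⋯ ⊗ (σⁿ⁻¹)^*L`. -/
def twistPower (n : ℕ) : InvertibleSheaf X where
  ι := ℕ → L.ι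
  U := L.opens σ n
  iSup_U := by
    refine top_le_iff.1 fun x _ => Opens.mem_iSup.2 ?_
    have h : ∀ j : ℕ, ∃ l, iter σ j x ∈ L.U l := fun j => by
      have : iter σ j x ∈ ⨆ i, L.U i := L.iSup_U ▸ trivial
      simpa using this
    choose w hw using h
    exact ⟨w, by simpa [opens, ← SetLike.mem_coe, Opens.coe_finset_inf] using fun j : Fin n => hw j⟩
  g := L.trans σ n
  g_self w := by
    refine Finset.prod_eq_one fun j _ => ?_
    rw [L.g_self, map_one]
  g_mul w w' w'' := by
    simp only [trans, map_prod, ← Finset.prod_mul_distrib]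
    refine Finset.prod_congr rfl fun j _ => ?_
    have e : L.opens σ n w ⊓ L.opens σ n w' ⊓ L.opens σ n w'' ≤
        iter σ j ⁻¹ᵁ (L.U (w j) ⊓ L.U (w' j) ⊓ L.U (w'' j)) :=
      inf_le_inf (L.inf_opens_le σ w w' j) (L.opens_le σ w'' j)
    have := congrArg ((iter σ j).appLE _ _ e) (L.g_mul (w j) (w' j) (w'' j))
    rw [map_mul, map_appLE_apply, map_appLE_apply, map_appLE_apply] at this
    rw [appLE_map_apply, appLE_map_apply, appLE_map_apply]
    exact this

/-- The product of a constant and a section. -/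
def constMul {n : ℕ} (c : Γ(X, ⊤)) (s : L.sections σ n) : L.sections σ n :=
  ⟨fun w => X.presheaf.map (homOfLE le_top).op c * s.1 w, fun w w' => by
    have := s.2 w w'
    simp only [map_mul, map_map_apply, this]
    ring⟩

lemma of_const_mul {n : ℕ} (c : Γ(X, ⊤)) (s : L.sections σ n) :
    DirectSum.of (fun n => L.sections σ n) 0 (L.const σ c) *
      DirectSum.of (fun n => L.sections σ n) n s = DirectSum.of (fun n => L.sections σ n) n (L.constMul σ c s) := by
  rw [DirectSum.of_mul_of]
  refine DirectSum.of_eq_of_gradedMonoid_eq ?_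
  refine L.mk_eq_mk σ (zero_add n) (L.mul σ (L.const σ c) s) (L.constMul σ c s) fun w => ?_
  have hw : (fun i => w (0 + i)) = w := by simp
  have e : L.opens σ (0 + n) w ≤ L.opens σ n fun i => w (0 + i) := L.opens_add_le_right σ 0 n w
  have h1 := id_appLE_apply (L.opens_add_le_right σ 0 n w) e (s.1 fun i => w (0 + i))
  have h2 : (L.mul σ (L.const σ c) s).1 w = X.presheaf.map (homOfLE le_top).op c *
      X.presheaf.map (homOfLE e).op (s.1 fun i => w (0 + i)) := by
    rw [← h1]
    simp only [mul, const, map_map_apply]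
    rfl
  rw [h2, map_mul, map_map_apply, map_map_apply, L.map_congr σ s.1 hw _ le_rfl]
  exact congrArg _ (ConcreteCategory.congr_hom (X.presheaf.map_id _) _).symm

end InvertibleSheaf

/-! ### The action of an automorphism on the two planes. -/

namespace DoublePlane

variable {k : Type u} [Field k] {S : Type u} [CommRing S] [Algebra k S] {𝒮 : ℕ → Submodule k S}
  [GradedAlgebra 𝒮] (D : DoublePlane 𝒮)

lemma specializes_iff {x y : Proj 𝒮} : x ⤳ y ↔ x.asHomogeneousIdeal ≤ y.asHomogeneousIdeal :=
  specializes_iff_mem_closure.trans (ProjectiveSpectrum.le_iff_mem_closure (𝒜 := 𝒮) x y).symm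

lemma gen_injective : Function.Injective D.gen := by
  intro i j h
  by_contra hij
  have : j = !i := Bool.eq_not.2 (Ne.symm hij)
  subst this
  have key : ∀ x, x = D.gen (!i) → D.On (!i) x := by
    rintro _ rfl
    exact D.on_gen _
  exact D.not_on_gen_not i (key _ h)

/-- An automorphism permutes the generic points of the two planes. -/
lemma exists_perm (τ : Proj 𝒮 ≅ Proj 𝒮) :
    ∃ t : Bool → Bool, Function.Injective t ∧ ∀ i, τ.hom (D.gen i) = D.gen (t i) := by
  have hs : ∀ q : Proj 𝒮, ∃ i, D.gen i ⤳ q := fun q =>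
    (D.on_or_on q false).elim (fun h => ⟨_, specializes_iff.2 h⟩) fun h => ⟨_, specializes_iff.2 h⟩
  have h : ∀ i, ∃ j, τ.hom (D.gen i) = D.gen j := by
    intro i
    obtain ⟨j, hj⟩ := hs (τ.hom (D.gen i))
    refine ⟨j, ?_⟩
    have h1 : τ.inv (D.gen j) ⤳ D.gen i := by
      have := hj.map τ.inv.continuous
      rwa [show τ.inv (τ.hom (D.gen i)) = D.gen i from by simp] at this
    obtain ⟨l, hl⟩ := hs (τ.inv (D.gen j))
    have h2 : l = i := by
      by_contra hli
      have : l = !i := Bool.eq_not.2 hli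
      subst this
      exact D.not_on_gen_not i (specializes_iff.1 (hl.trans h1))
    subst h2
    have h3 : D.gen l = τ.inv (D.gen j) := (hl.antisymm h1).eq
    rw [h3]
    simp
  choose t ht using h
  refine ⟨t, fun i j hij => D.gen_injective ?_, ht⟩
  have : τ.hom (D.gen i) = τ.hom (D.gen j) := by rw [ht, ht, hij]
  simpa using congrArg τ.inv this

variable {i j : Bool} {U V : (Proj 𝒮).Opens}

/-- Expresses vanishing on a plane by the open set where a function is invertible. Morphisms pull
such sets back, so no formula for the automorphism on function fields is needed. -/
lemma gen_mem_basicOpen_iff (h : D.gen i ∈ U) (f : Γ(Proj 𝒮, U)) :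
    D.gen i ∈ (Proj 𝒮).basicOpen f ↔ D.ev i f ≠ 0 := by
  constructor
  · intro hf
    have hu : IsUnit ((Proj 𝒮).presheaf.map (homOfLE ((Proj 𝒮).basicOpen_le f)).op f) :=
      (Proj 𝒮).toRingedSpace.isUnit_res_basicOpen f
    obtain ⟨g, hg⟩ := hu.exists_right_inv
    have h1 := congrArg (D.ev i) hg
    rw [D.ev_mul, D.ev_one i hf, D.ev_map i hf] at h1
    exact left_ne_zero_of_mul (h1 ▸ one_ne_zero)
  · intro hf
    obtain ⟨n, a, b, ha, hb, hbq, hab⟩ := exists_fraction (K := PlaneField k) f h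
    have hab := hab (D.gen i) (D.toField i : S →+* PlaneField k) (D.toField_gen_ne_zero i) h le_rfl
    rw [← D.ev_eq i h] at hab
    have hb0 : D.toField i b ≠ 0 := D.toField_gen_ne_zero i _ hbq
    have ha0 : D.toField i a ≠ 0 := by
      have : D.toField i a = D.ev i f * D.toField i b := hab.symm
      rw [this]
      exact mul_ne_zero hf hb0
    -- On `V` the numerator `a` is invertible and the other plane is absent, so `b / a` is an
    -- inverse of `f`.
    let V : (Proj 𝒮).Opens := U ⊓ (Proj.basicOpen 𝒮 a ⊓ Proj.basicOpen 𝒮 (D.e i))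
    have hV : ∀ q ∈ V, a ∉ q.asHomogeneousIdeal ∧ ¬ D.On (!i) q := fun q hq => by
      refine ⟨hq.2.1, fun ho => hq.2.2 ?_⟩
      have := D.on_iff.1 ho
      rw [Bool.not_not] at this
      exact this
    have hgV : D.gen i ∈ V := by
      refine ⟨h, ?_, ?_⟩
      · exact fun h0 => ha0 ((D.toField_eq_zero).2 ((D.mem_gen).1 h0))
      · exact fun h0 => MvPolynomial.X_ne_zero 0 ((D.π_e i).symm.trans ((D.mem_gen).1 h0))
    obtain ⟨s, hs⟩ := D.exists_ev_eq (U := V) (f := fun _ => (D.ev i f)⁻¹) fun q hq => by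
      refine ⟨n, n, b, a, hb, ha, (add_zero _).symm, (hV q hq).1, fun l hl => ?_⟩
      have hli : l = i := by
        by_contra hli
        have : l = !i := Bool.eq_not.2 hli
        subst this
        exact (hV q hq).2 hl
      subst hli
      have : D.toField l a = D.ev l f * D.toField l b := hab.symm
      rw [this, inv_mul_cancel_left₀ hf]
    have hfs : (Proj 𝒮).presheaf.map (homOfLE inf_le_left).op f * s = 1 := by
      refine D.eq_of_ev fun l hl => ?_
      have hli : l = i := by
        by_contra hli
        have : l = !i := Bool.eq_not.2 hli
        subst this
        exact (hV _ hl).2 (D.on_gen _)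
      subst hli
      rw [D.ev_mul, D.ev_map l hl, hs l hl, D.ev_one l hl, mul_inv_cancel₀ hf]
    have := Scheme.basicOpen_of_isUnit _ (IsUnit.of_mul_eq_one _ hfs)
    rw [Scheme.basicOpen_res] at this
    exact (this.ge hgV).2

lemma ev_appLE_eq_zero_iff (σ : Proj 𝒮 ⟶ Proj 𝒮) (hσ : σ (D.gen i) = D.gen j)
    (e : V ≤ σ ⁻¹ᵁ U) (h : D.gen i ∈ V) (f : Γ(Proj 𝒮, U)) :
    D.ev i (σ.appLE U V e f) = 0 ↔ D.ev j f = 0 := by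
  have hU : D.gen j ∈ U := by
    rw [← hσ]
    exact e h
  rw [← not_iff_not, ← ne_eq, ← ne_eq, ← D.gen_mem_basicOpen_iff h, ← D.gen_mem_basicOpen_iff hU,
    Scheme.basicOpen_appLE, ← hσ]
  exact ⟨fun h => h.2, fun h' => ⟨h, h'⟩⟩

end DoublePlane

/-! ### The graded components of the map `A → S(X, σ, L)`. -/

namespace InvertibleSheaf

variable {X : Scheme.{u}} (L : InvertibleSheaf X) (σ : X ⟶ X)

lemma of_const_mul_apply (c : Γ(X, ⊤)) (z : L.TwistedRing σ) (n : ℕ) :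
    (DirectSum.of (fun n => L.sections σ n) 0 (L.const σ c) * z) n = L.constMul σ c (z n) := by
  have hadd : ∀ m, ∀ a b : L.sections σ m,
      L.constMul σ c (a + b) = L.constMul σ c a + L.constMul σ c b := fun m a b =>
    Subtype.ext (funext fun w => mul_add _ _ _)
  have hzero : ∀ m, L.constMul σ c (0 : L.sections σ m) = 0 := fun m =>
    Subtype.ext (funext fun w => mul_zero _)
  induction z using DirectSum.induction_on with
  | zero => rw [mul_zero, DirectSum.zero_apply, hzero]
  | of m x =>
    rw [of_const_mul]
    by_cases h : m = n
    · subst h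
      rw [DirectSum.of_eq_same, DirectSum.of_eq_same]
    · rw [DirectSum.of_eq_of_ne _ _ _ (Ne.symm h), DirectSum.of_eq_of_ne _ _ _ (Ne.symm h), hzero]
  | add x y hx hy => rw [mul_add, DirectSum.add_apply, DirectSum.add_apply, hx, hy, hadd]

-- Replaces the ring homomorphism to a direct sum by additive maps degree by degree, the form in
-- which it is composed with the identification of sections with polynomials.
variable {L σ} in
lemma IsQuotientBy.exists_components {k : Type u} [Field k] {p : X ⟶ Spec (.of k)}
    {A : Type v} [Ring A] [Algebra k A] {𝒜 : ℕ → Submodule k A} [GradedAlgebra 𝒜] {Ω : A}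
    (hA : L.IsQuotientBy σ p 𝒜 Ω) :
    ∃ ψ : ∀ n, A →+ L.sections σ n,
      (∀ n c a, ψ n (c • a) = L.constMul σ (p.appTop ((Scheme.ΓSpecIso (.of k)).inv c)) (ψ n a)) ∧
      (∀ n s, ∃ a ∈ 𝒜 n, ψ n a = s) ∧
      (∀ n, ∀ a ∈ 𝒜 n, ψ n a = 0 ↔ a ∈ TwoSidedIdeal.span {Ω}) ∧
      ∀ m n, ∀ x ∈ 𝒜 m, ∀ y ∈ 𝒜 n, ψ (m + n) (x * y) = L.mul σ (ψ m x) (ψ n y) := by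
  obtain ⟨φ, hscalar, hhom, hsurj, hker⟩ := hA
  have hcomp : ∀ n, ∀ a ∈ 𝒜 n, φ a = DirectSum.of (fun n => L.sections σ n) n (φ a n) := by
    intro n a ha
    obtain ⟨s, hs⟩ := hhom n a ha
    rw [hs, DirectSum.of_eq_same]
  refine ⟨fun n => AddMonoidHom.mk' (fun a => φ a n) fun a b => ?_, fun n c a => ?_,
    fun n s => ?_, fun n a ha => ?_, fun m n x hx y hy => ?_⟩
  · exact (congrArg (fun z : L.TwistedRing σ => z n) (φ.map_add a b)).trans
      (DirectSum.add_apply _ _ _)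
  · have h2 : φ (c • a) = L.scalar σ p c * φ a :=
      (congrArg φ (Algebra.smul_def c a)).trans
        ((φ.map_mul _ _).trans (congrArg (· * φ a) (hscalar c)))
    exact (congrArg (fun z : L.TwistedRing σ => z n) h2).trans
      (L.of_const_mul_apply σ _ (φ a) n)
  -- The component of degree `n` of any preimage is again a preimage, since `φ` preserves degrees.
  · obtain ⟨a, ha⟩ := hsurj (DirectSum.of _ n s)
    refine ⟨DirectSum.decompose 𝒜 a n, SetLike.coe_mem _, ?_⟩
    have h : φ (DirectSum.decompose 𝒜 a n) n = φ a n := by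
      clear ha
      induction a using DirectSum.Decomposition.inductionOn 𝒜 with
      | zero => simp
      | @homogeneous m x =>
        by_cases hmn : m = n
        · subst hmn
          rw [DirectSum.decompose_coe, DirectSum.of_eq_same]
        · rw [DirectSum.decompose_coe, DirectSum.of_eq_of_ne _ _ _ (Ne.symm hmn),
            hcomp m x x.2, DirectSum.of_eq_of_ne _ _ _ (Ne.symm hmn)]
          simp
      | add x y hx hy =>
        simp only [map_add, DirectSum.decompose_add, DirectSum.add_apply, hx, hy, Submodule.coe_add]
    exact h.trans ((congrArg (fun z : L.TwistedRing σ => z n) ha).trans (DirectSum.of_eq_same _ _))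
  · rw [← hker]
    constructor
    · intro h
      exact (hcomp n a ha).trans ((congrArg (DirectSum.of _ n) h).trans (map_zero _))
    · intro h
      exact (congrArg (fun z : L.TwistedRing σ => z n) h).trans (DirectSum.zero_apply _)
  · have h : φ (x * y) = DirectSum.of (fun n => L.sections σ n) (m + n)
        (L.mul σ (φ x m) (φ y n)) := by
      refine (φ.map_mul x y).trans ?_
      conv_lhs => rw [hcomp m x hx, hcomp n y hy]
      exact DirectSum.of_mul_of _ _
    exact (congrArg (fun z : L.TwistedRing σ => z (m + n)) h).trans (DirectSum.of_eq_same _ _)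

end InvertibleSheaf

/-! ### Sections of the twisted powers as forms on the quadric. -/

namespace DoublePlane

variable {k : Type u} [Field k] {S : Type u} [CommRing S] [Algebra k S] {𝒮 : ℕ → Submodule k S}
  [GradedAlgebra 𝒮] (D : DoublePlane 𝒮)

omit [GradedAlgebra 𝒮] in
lemma eq_of_toField {a b : S} (h : ∀ i, D.toField i a = D.toField i b) : a = b := by
  rw [← sub_eq_zero]
  refine D.eq_zero _ fun i => ?_
  rw [map_sub, sub_eq_zero]
  exact (D.toField_eq).1 (h i)

/-- The global functions given by the constants. -/
def globalConst (𝒮 : ℕ → Submodule k S) [GradedAlgebra 𝒮] (c : k) : Γ(Proj 𝒮, ⊤) :=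
  (Proj.toSpecZero 𝒮 ≫ Spec.map (CommRingCat.ofHom (algebraMap k (𝒮 0)))).appTop
    ((Scheme.ΓSpecIso (.of k)).inv c)

/-- The constants act as themselves on both planes; this makes the passage from sections to forms
`k`-linear. -/
lemma ev_globalConst (i : Bool) (c : k) :
    D.ev i (globalConst 𝒮 c) = algebraMap k (PlaneField k) c := by
  have h1 : globalConst 𝒮 c = (Proj.toSpecZero 𝒮).appTop ((Scheme.ΓSpecIso (.of (𝒮 0))).inv
      (algebraMap k (𝒮 0) c)) := by
    have := ConcreteCategory.congr_hom (Scheme.ΓSpecIso_inv_naturality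
      (CommRingCat.ofHom (algebraMap k (𝒮 0)))) c
    exact (congrArg (Proj.toSpecZero 𝒮).appTop this).symm
  have h2 := ConcreteCategory.congr_hom (toSpecZero_appTop (𝒮 := 𝒮)) (algebraMap k (𝒮 0) c)
  rw [h1]
  refine (congrArg (D.ev i) h2).trans ?_
  refine (D.ev_map i (V := ⊤) (show D.gen i ∈ (⊤ : (Proj 𝒮).Opens) from trivial) _ _).trans ((D.ev_awayToSection i _).trans ?_)
  exact (D.toField i).commutes c

variable (L : InvertibleSheaf (Proj 𝒮)) (σ : Proj 𝒮 ⟶ Proj 𝒮)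

/-- The sections of an invertible sheaf on a double plane are the forms of some degree, or zero. -/
lemma exists_model (n : ℕ) : ∃ Ψ : L.sections σ n →+ S,
    (∀ c s, Ψ (L.constMul σ (globalConst 𝒮 c) s) = c • Ψ s) ∧
    ((∀ s, Ψ s = 0) ∨ ∃ m, ∀ y, y ∈ 𝒮 m ↔ ∃ s, Ψ s = y) ∧
    (∀ s, Ψ s = 0 → s = 0) ∧
    ∀ s i w, D.gen i ∈ L.opens σ n w → (D.π i (Ψ s) = 0 ↔ D.ev i (s.1 w) = 0) := by
  have hw : ∀ i, ∃ w : ℕ → L.ι, D.gen i ∈ L.opens σ n w :=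
    fun i => exists_mem_U (L.twistPower σ n) (D.gen i)
  choose w hw using hw
  have hsec : ∀ s : L.sections σ n, (L.twistPower σ n).IsSection s.1 := fun s => s.2
  obtain ⟨d, F, hF⟩ := D.exists_isFrame (N := L.twistPower σ n) w hw
  have hF0 := hF.ne_zero hw
  have hzero : ∀ s : L.sections σ n, (∀ i, D.ev i (s.1 (w i)) = 0) → s = 0 := fun s h =>
    Subtype.ext (section_eq_zero (N := L.twistPower σ n) hw (hsec s) h)
  -- For a negative twist there are no nonzero sections.
  rcases lt_or_ge d 0 with hd | hd
  · have h0 : ∀ s : L.sections σ n, s = 0 := fun s => hzero s fun i =>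
      (mul_eq_zero.1 (D.eq_zero_of_regAt hd (hF.regAt hw (hsec s)) i)).resolve_left (hF0 i)
    refine ⟨0, fun c s => by simp, Or.inl fun s => rfl, fun s _ => h0 s, fun s i v hv => ?_⟩
    rw [h0 s]
    simpa using D.ev_zero i
  lift d to ℕ using hd
  choose Y hYmem hY using fun s : L.sections σ n => D.exists_mem_of_regAt (hF.regAt hw (hsec s))
  replace hY : ∀ (s : L.sections σ n) i, F i * D.ev i (s.1 (w i)) = D.toField i (Y s) := hY
  have hsw : ∀ (s : L.sections σ n) i v, D.gen i ∈ L.opens σ n v →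
      D.ev i (s.1 (w i)) = D.ev i (L.trans σ n (w i) v) * D.ev i (s.1 v) := fun s i v hv =>
    D.ev_section (N := L.twistPower σ n) (hsec s) (hw i) hv
  have hg : ∀ i v, D.gen i ∈ L.opens σ n v → D.ev i (L.trans σ n (w i) v) ≠ 0 := fun i v hv =>
    D.ev_g_ne_zero (N := L.twistPower σ n) (hw i) hv
  have hYu : ∀ s y, (∀ i, F i * D.ev i (s.1 (w i)) = D.toField i y) → Y s = y := fun s y h =>
    D.eq_of_toField fun i => (hY s i).symm.trans (h i)
  -- The form attached to a section is the section times the frame. The frame and the transition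
  -- functions are nonzero at the generic points, so vanishing on a plane is unaffected.
  have hpat : ∀ s i v, D.gen i ∈ L.opens σ n v → (D.π i (Y s) = 0 ↔ D.ev i (s.1 v) = 0) := by
    intro s i v hv
    rw [← D.toField_eq_zero, ← hY, mul_eq_zero, or_iff_right (hF0 i),
      hsw s i v hv, mul_eq_zero, or_iff_right (hg i v hv)]
  refine ⟨AddMonoidHom.mk' Y fun s t => hYu _ _ fun i => ?_, fun c s => hYu _ _ fun i => ?_,
    Or.inr ⟨d, fun y => ⟨fun hy => ?_, ?_⟩⟩, fun s hs => hzero s fun i => ?_, hpat⟩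
  · rw [map_add, ← hY, ← hY, ← mul_add]
    exact congrArg _ (D.ev_add i _ _)
  · rw [map_smul, AddMonoidHom.mk'_apply, ← hY, Algebra.smul_def, ← mul_assoc, mul_comm (algebraMap _ _ _), mul_assoc]
    refine congrArg _ ((D.ev_mul i _ _).trans (congrArg (· * _) ?_))
    rw [D.ev_map i (hw i), D.ev_globalConst]
  · obtain ⟨s, hs, hsF⟩ := hF.exists_section hw (D.regAt_toField hy)
    exact ⟨⟨s, hs⟩, hYu _ _ hsF⟩
  · rintro ⟨s, rfl⟩
    exact hYmem s
  · refine (hpat s i (w i) (hw i)).1 ?_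
    change Y s = 0 at hs
    rw [hs, map_zero]

/-- Products of sections of degree one vanish on a plane exactly when one factor does. -/
lemma ev_mul_eq_zero_iff {i j : Bool} (hσ : σ (D.gen i) = D.gen j) (s t : L.sections σ 1)
    (w : ℕ → L.ι) (h : D.gen i ∈ L.opens σ (1 + 1) w) :
    D.gen i ∈ L.opens σ 1 w ∧ D.gen j ∈ L.opens σ 1 (fun l => w (1 + l)) ∧
    (D.ev i ((L.mul σ s t).1 w) = 0 ↔
      D.ev i (s.1 w) = 0 ∨ D.ev j (t.1 fun l => w (1 + l)) = 0) := by
  have hσ1 : iter σ 1 (D.gen i) = D.gen j := by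
    rw [← hσ]
    simp [iter]
  refine ⟨L.opens_add_le_left σ 1 1 w h, ?_, ?_⟩
  · rw [← hσ1]
    exact L.opens_add_le_right σ 1 1 w h
  · change D.ev i (_ * _) = 0 ↔ _
    rw [D.ev_mul, mul_eq_zero, D.ev_map i h, D.ev_appLE_eq_zero_iff _ hσ1 _ h]

/-- A graded algebra with a homogeneous surjection onto a twisted homogeneous coordinate ring of a
double plane, described by forms on the double plane. -/
lemma exists_linear_model {A : Type v} [Ring A] [Algebra k A] {𝒜 : ℕ → Submodule k A}
    [GradedAlgebra 𝒜] (τ : Proj 𝒮 ≅ Proj 𝒮) (L : InvertibleSheaf (Proj 𝒮)) {Ω : A}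
    (hA : L.IsQuotientBy τ.hom
      (Proj.toSpecZero 𝒮 ≫ Spec.map (CommRingCat.ofHom (algebraMap k (𝒮 0)))) 𝒜 Ω) :
    ∃ (t : Bool → Bool) (Ψ : ℕ → A →ₗ[k] S), Function.Injective t ∧
      (∀ n, (∀ a ∈ 𝒜 n, Ψ n a = 0) ∨ ∃ m, ∀ y, y ∈ 𝒮 m ↔ ∃ a ∈ 𝒜 n, Ψ n a = y) ∧
      (∀ n, ∀ a ∈ 𝒜 n, Ψ n a = 0 ↔ a ∈ TwoSidedIdeal.span {Ω}) ∧
      ∀ x ∈ 𝒜 1, ∀ y ∈ 𝒜 1, ∀ i, D.π i (Ψ (1 + 1) (x * y)) = 0 ↔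
        D.π i (Ψ 1 x) = 0 ∨ D.π (t i) (Ψ 1 y) = 0 := by
  obtain ⟨ψ, hψsmul, hψsurj, hψker, hψmul⟩ := InvertibleSheaf.IsQuotientBy.exists_components hA
  obtain ⟨t, ht, hτ⟩ := D.exists_perm τ
  choose Ψ hsmul hrange hinj hpat using D.exists_model L τ.hom
  have hlin : ∀ n (c : k) a, ((Ψ n).comp (ψ n)) (c • a) = c • ((Ψ n).comp (ψ n)) a := by
    intro n c a
    rw [AddMonoidHom.comp_apply, AddMonoidHom.comp_apply, ← hsmul]
    exact congrArg (Ψ n) (hψsmul n c a)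
  have hr : ∀ n, (∀ a ∈ 𝒜 n, (Ψ n).comp (ψ n) a = 0) ∨
      ∃ m, ∀ y, y ∈ 𝒮 m ↔ ∃ a ∈ 𝒜 n, (Ψ n).comp (ψ n) a = y := by
    intro n
    have hψn := hψsurj n
    refine (hrange n).imp (fun h a _ => h _) (Exists.imp fun m hm y => (hm y).trans ?_)
    refine ⟨fun ⟨s, hs⟩ => ?_, fun ⟨a, _, ha⟩ => ⟨ψ n a, ha⟩⟩
    exact (hψn s).imp fun a ha => ⟨ha.1, (congrArg (Ψ n) ha.2).trans hs⟩
  have hz : ∀ n, ∀ a ∈ 𝒜 n, (Ψ n).comp (ψ n) a = 0 ↔ a ∈ TwoSidedIdeal.span {Ω} := by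
    intro n a ha
    refine Iff.trans ⟨hinj n _, fun h => ?_⟩ (hψker n a ha)
    exact (congrArg (Ψ n) h).trans (map_zero _)
  have hm : ∀ x ∈ 𝒜 1, ∀ y ∈ 𝒜 1, ∀ i, D.π i ((Ψ (1 + 1)).comp (ψ (1 + 1)) (x * y)) = 0 ↔
        D.π i ((Ψ 1).comp (ψ 1) x) = 0 ∨ D.π (t i) ((Ψ 1).comp (ψ 1) y) = 0 := by
    intro x hx y hy i
    obtain ⟨w, hw⟩ : ∃ w : ℕ → L.ι, D.gen i ∈ L.opens τ.hom (1 + 1) w :=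
      exists_mem_U (L.twistPower τ.hom (1 + 1)) (D.gen i)
    obtain ⟨h1, h2, h3⟩ := D.ev_mul_eq_zero_iff L τ.hom (hτ i) (ψ 1 x) (ψ 1 y) w hw
    refine (Iff.of_eq (congrArg (fun s => D.π i (Ψ (1 + 1) s) = 0) (hψmul 1 1 x hx y hy))).trans ?_
    exact (hpat (1 + 1) _ i w hw).trans
      (h3.trans (or_congr (hpat 1 _ i w h1).symm (hpat 1 _ (t i) _ h2).symm))
  exact ⟨t, fun n => { (Ψ n).comp (ψ n) with map_smul' := hlin n }, ht, hr, hz, hm⟩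

end DoublePlane

/-! ### Quadratic algebras: generation in degree one and the ideal `⟨Ω⟩` in low degrees. -/

section GradedNoncomm

variable {k : Type u} [Field k] {A : Type v} [Ring A] [Algebra k A] {𝒜 : ℕ → Submodule k A}

lemma IsQuadratic.adjoin_eq_top (h : IsQuadratic 𝒜) :
    Algebra.adjoin k (𝒜 1 : Set A) = ⊤ := by
  have h1 : (TensorAlgebra.lift k (𝒜 1).subtype).range = ⊤ := (AlgHom.range_eq_top _).2 h.1
  rw [TensorAlgebra.range_lift] at h1
  rw [← h1]
  congr 1
  ext x
  simp

/-- The `x` with `Ω * x ∈ A * Ω` form a subalgebra, and likewise on the other side, so generators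
suffice. -/
lemma isNormalElement_of_forall_mem (h : Algebra.adjoin k (𝒜 1 : Set A) = ⊤) {Ω : A}
    (h₁ : ∀ x ∈ 𝒜 1, ∃ y, Ω * x = y * Ω) (h₂ : ∀ x ∈ 𝒜 1, ∃ y, x * Ω = Ω * y) :
    IsNormalElement Ω := by
  have h₁' : ∀ x, ∃ y, Ω * x = y * Ω := by
    intro x
    have hx : x ∈ Algebra.adjoin k (𝒜 1 : Set A) := h ▸ Algebra.mem_top
    induction hx using Algebra.adjoin_induction with
    | mem x hx => exact h₁ x hx
    | algebraMap r => exact ⟨algebraMap k A r, (Algebra.commutes r Ω).symm⟩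
    | add x y _ _ hx hy =>
      obtain ⟨a, ha⟩ := hx
      obtain ⟨b, hb⟩ := hy
      exact ⟨a + b, by rw [mul_add, ha, hb, add_mul]⟩
    | mul x y _ _ hx hy =>
      obtain ⟨a, ha⟩ := hx
      obtain ⟨b, hb⟩ := hy
      exact ⟨a * b, by rw [← mul_assoc, ha, mul_assoc, hb, mul_assoc]⟩
  have h₂' : ∀ x, ∃ y, x * Ω = Ω * y := by
    intro x
    have hx : x ∈ Algebra.adjoin k (𝒜 1 : Set A) := h ▸ Algebra.mem_top
    induction hx using Algebra.adjoin_induction with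
    | mem x hx => exact h₂ x hx
    | algebraMap r => exact ⟨algebraMap k A r, Algebra.commutes r Ω⟩
    | add x y _ _ hx hy =>
      obtain ⟨a, ha⟩ := hx
      obtain ⟨b, hb⟩ := hy
      exact ⟨a + b, by rw [add_mul, ha, hb, mul_add]⟩
    | mul x y _ _ hx hy =>
      obtain ⟨a, ha⟩ := hx
      obtain ⟨b, hb⟩ := hy
      exact ⟨a * b, by rw [mul_assoc, hb, ← mul_assoc, ha, mul_assoc]⟩
  ext x
  constructor
  · rintro ⟨a, rfl⟩
    obtain ⟨y, hy⟩ := h₁' a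
    exact ⟨y, hy⟩
  · rintro ⟨a, rfl⟩
    obtain ⟨y, hy⟩ := h₂' a
    exact ⟨y, hy⟩

/-- Serves the degenerate cases in which `A₁` has dimension at most one. -/
lemma isNormalElement_of_commute (h : Algebra.adjoin k (𝒜 1 : Set A) = ⊤)
    (hc : ∀ x ∈ 𝒜 1, ∀ y ∈ 𝒜 1, x * y = y * x) (Ω : A) : IsNormalElement Ω := by
  have key : ∀ x ∈ 𝒜 1, Ω * x = x * Ω := by
    intro x hx
    have hΩ : Ω ∈ Algebra.adjoin k (𝒜 1 : Set A) := h ▸ Algebra.mem_top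
    have hle : Algebra.adjoin k (𝒜 1 : Set A) ≤ Subalgebra.centralizer k (𝒜 1 : Set A) :=
      Algebra.adjoin_le fun y hy =>
        (Subalgebra.mem_centralizer_iff k).2 fun z hz => hc z hz y hy
    exact ((Subalgebra.mem_centralizer_iff k).1 (hle hΩ) x hx).symm
  exact isNormalElement_of_forall_mem h (fun x hx => ⟨x, key x hx⟩)
    fun x hx => ⟨x, (key x hx).symm⟩

variable [GradedAlgebra 𝒜]

lemma IsQuadratic.mem_pow (h : IsQuadratic 𝒜) {n : ℕ} {x : A} (hx : x ∈ 𝒜 n) :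
    x ∈ (𝒜 1) ^ n := by
  have hle : ∀ n, (𝒜 1) ^ n ≤ 𝒜 n := by
    intro n
    induction n with
    | zero =>
      rw [pow_zero, Submodule.one_le]
      exact SetLike.GradedOne.one_mem
    | succ n ih =>
      rw [pow_succ, Submodule.mul_le]
      exact fun a ha b hb => SetLike.GradedMul.mul_mem (ih ha) hb
  have key : ∀ x : A, ∀ n, (DirectSum.decompose 𝒜 x n : A) ∈ (𝒜 1) ^ n := by
    intro x
    have hx : x ∈ Subalgebra.toSubmodule (Algebra.adjoin k (𝒜 1 : Set A)) :=
      (Subalgebra.mem_toSubmodule _).2 (h.adjoin_eq_top ▸ Algebra.mem_top)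
    rw [Algebra.adjoin_eq_span] at hx
    induction hx using Submodule.span_induction with
    | mem x hx =>
      have : ∃ m, x ∈ (𝒜 1) ^ m := by
        induction hx using Submonoid.closure_induction with
        | mem x hx => exact ⟨1, by rwa [pow_one]⟩
        | one => exact ⟨0, by
          rw [pow_zero]
          exact Submodule.mem_one.2 ⟨1, map_one (algebraMap k A)⟩⟩
        | mul x y _ _ hx hy =>
          obtain ⟨m, hm⟩ := hx
          obtain ⟨n, hn⟩ := hy
          exact ⟨m + n, by rw [pow_add]; exact Submodule.mul_mem_mul hm hn⟩
      obtain ⟨m, hm⟩ := this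
      intro n
      by_cases hmn : m = n
      · subst hmn
        rwa [DirectSum.decompose_of_mem_same _ (hle m hm)]
      · rw [DirectSum.decompose_of_mem_ne _ (hle m hm) hmn]
        exact zero_mem _
    | zero => simp
    | add x y _ _ hx hy =>
      intro n
      rw [DirectSum.decompose_add, DirectSum.add_apply, Submodule.coe_add]
      exact add_mem (hx n) (hy n)
    | smul c x _ hx =>
      intro n
      rw [DirectSum.decompose_smul, DirectSum.smul_apply, Submodule.coe_smul]
      exact Submodule.smul_mem _ c (hx n)
  have := key x n
  rwa [DirectSum.decompose_of_mem_same _ hx] at this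

lemma IsQuadratic.exists_algebraMap (h : IsQuadratic 𝒜) {x : A} (hx : x ∈ 𝒜 0) :
    ∃ c, x = algebraMap k A c := by
  have := h.mem_pow hx
  rw [pow_zero] at this
  obtain ⟨c, hc⟩ := Submodule.mem_one.1 this
  exact ⟨c, hc.symm⟩

open scoped Pointwise in
/-- The elements of degree at most two of the two-sided ideal generated by an element of degree
two. -/
lemma IsQuadratic.decompose_of_mem_span (h : IsQuadratic 𝒜) {Ω : A} (hΩ : Ω ∈ 𝒜 2) {a : A}
    (ha : a ∈ TwoSidedIdeal.span {Ω}) :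
    (DirectSum.decompose 𝒜 a 1 : A) = 0 ∧ ∃ c : k, (DirectSum.decompose 𝒜 a 2 : A) = c • Ω := by
  have hneg : ∀ (x : A) n, (DirectSum.decompose 𝒜 (-x) n : A) = -DirectSum.decompose 𝒜 x n := by
    intro x n
    rw [DirectSum.decompose_neg]
    rfl
  let T : AddSubgroup A :=
    { carrier := {a | (DirectSum.decompose 𝒜 a 1 : A) = 0 ∧
        ∃ c : k, (DirectSum.decompose 𝒜 a 2 : A) = c • Ω}
      zero_mem' := ⟨by simp, 0, by simp⟩
      add_mem' := by
        rintro x y ⟨hx, c, hc⟩ ⟨hy, d, hd⟩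
        refine ⟨?_, c + d, ?_⟩
        · rw [DirectSum.decompose_add, DirectSum.add_apply, Submodule.coe_add, hx, hy, add_zero]
        · rw [DirectSum.decompose_add, DirectSum.add_apply, Submodule.coe_add, hc, hd, add_smul]
      neg_mem' := by
        rintro x ⟨hx, c, hc⟩
        refine ⟨?_, -c, ?_⟩
        · rw [hneg, hx, neg_zero]
        · rw [hneg, hc, neg_smul] }
  have key : ∀ x y : A, x * Ω * y ∈ T := by
    intro x y
    induction x using DirectSum.Decomposition.inductionOn 𝒜 with
    | zero => simp
    | @homogeneous i x =>
      induction y using DirectSum.Decomposition.inductionOn 𝒜 with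
      | zero => simp
      | @homogeneous j y =>
        have hm : (x * Ω * y : A) ∈ 𝒜 (i + 2 + j) :=
          SetLike.GradedMul.mul_mem (SetLike.GradedMul.mul_mem x.2 hΩ) y.2
        refine ⟨DirectSum.decompose_of_mem_ne _ hm (by omega), ?_⟩
        -- `x * Ω * y` has degree `i + 2 + j`, so it reaches degree two only when `x` and `y` are
        -- scalars.
        by_cases hij : i = 0 ∧ j = 0
        · obtain ⟨rfl, rfl⟩ := hij
          obtain ⟨c, hc⟩ := h.exists_algebraMap x.2
          obtain ⟨d, hd⟩ := h.exists_algebraMap y.2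
          refine ⟨c * d, ?_⟩
          rw [DirectSum.decompose_of_mem_same _ hm, hc, hd, ← Algebra.smul_def,
            ← Algebra.commutes, ← Algebra.smul_def, smul_smul, mul_comm]
        · exact ⟨0, by rw [DirectSum.decompose_of_mem_ne _ hm (by omega), zero_smul]⟩
      | add y z hy hz => rw [mul_add]; exact T.add_mem hy hz
    | add x z hx hz => rw [add_mul, add_mul]; exact T.add_mem hx hz
  have hle : AddSubgroup.closure ((Set.univ : Set A) * ({Ω} : Set A) * (Set.univ : Set A)) ≤ T := by
    rw [AddSubgroup.closure_le]
    rintro _ ⟨_, ⟨x, -, _, rfl, rfl⟩, y, -, rfl⟩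
    exact key x y
  exact hle (TwoSidedIdeal.mem_span_iff_mem_addSubgroup_closure.1 ha)

end GradedNoncomm

/-- Rank and nullity. Applied with `x = Ω`, it accounts for the one dimension lost from `A₂` to the
forms. -/
lemma finrank_le_succ_of_map_le {k : Type*} [Field k] {V W : Type*} [AddCommGroup V] [Module k V]
    [AddCommGroup W] [Module k W] (f : V →ₗ[k] W) (J : Submodule k V) [FiniteDimensional k J]
    (K : Submodule k W) [FiniteDimensional k K] (x : V) (hK : ∀ v ∈ J, f v ∈ K)
    (hx : ∀ v ∈ J, f v = 0 → ∃ c : k, v = c • x) :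
    Module.finrank k J ≤ Module.finrank k K + 1 := by
  rw [← LinearMap.finrank_range_add_finrank_ker (f.domRestrict J)]
  refine add_le_add ?_ ?_
  · refine Submodule.finrank_mono ?_
    rintro _ ⟨v, rfl⟩
    exact hK v v.2
  · rw [← Submodule.finrank_map_subtype_eq]
    refine (Submodule.finrank_mono (t := Submodule.span k {x}) ?_).trans
      ((finrank_span_le_card _).trans (by simp))
    rintro _ ⟨v, hv, rfl⟩
    obtain ⟨c, hc⟩ := hx v v.2 hv
    exact Submodule.mem_span_singleton.2 ⟨c, hc.symm⟩

/-! ### Dimensions of spaces of forms on the double plane. -/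

namespace DoublePlane

variable {k : Type u} [Field k] {S : Type u} [CommRing S] [Algebra k S] {𝒮 : ℕ → Submodule k S}
  (D : DoublePlane 𝒮)

/-- Multiplication of a form on the plane by `e i`. -/
def eMul (i : Bool) : PlaneRing k →ₗ[k] S := (LinearMap.mulLeft k (D.e i)).comp D.ι.toLinearMap

lemma isHomogeneous_pred {n : ℕ} {c : PlaneRing k} (h : (MvPolynomial.X 0 * c).IsHomogeneous n) :
    c.IsHomogeneous (n - 1) := by
  by_cases hc : c = 0
  · rw [hc]
    exact MvPolynomial.isHomogeneous_zero _ _ _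
  · exact isHomogeneous_of_mul h (MvPolynomial.isHomogeneous_X _ _) (MvPolynomial.X_ne_zero _)

lemma exists_eq_of_mem {i : Bool} {n : ℕ} {y : S} (hy : y ∈ 𝒮 n) :
    ∃ c : PlaneRing k, c.IsHomogeneous (n - 1) ∧ y = D.ι (D.π i y) + D.eMul (!i) c := by
  obtain ⟨c, hc, h⟩ := D.exists_decomp i y
  refine ⟨c, isHomogeneous_pred ?_, h⟩
  rw [← hc]
  exact (MvPolynomial.homogeneousSubmodule (Fin 3) k n).sub_mem (D.π_mem _ _ _ hy)
    (D.π_mem _ _ _ hy)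

lemma exists_eq_of_π_eq_zero {i : Bool} {n : ℕ} {y : S} (hy : y ∈ 𝒮 n) (h : D.π i y = 0) :
    ∃ c : PlaneRing k, c.IsHomogeneous (n - 1) ∧ y = D.eMul (!i) c := by
  obtain ⟨c, hc, hyc⟩ := D.exists_eq_of_mem (i := i) hy
  refine ⟨c, hc, ?_⟩
  rwa [h, map_zero, zero_add] at hyc

lemma π_eMul (i : Bool) (c : PlaneRing k) : D.π i (D.eMul i c) = MvPolynomial.X 0 * c := by
  change D.π i (D.e i * D.ι c) = _
  rw [map_mul, D.π_e, D.π_ι]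

lemma π_eMul_not (i : Bool) (c : PlaneRing k) : D.π i (D.eMul (!i) c) = 0 := by
  change D.π i (D.e (!i) * D.ι c) = _
  rw [map_mul, D.π_e_not, zero_mul]

lemma π_not_eMul (i : Bool) (c : PlaneRing k) : D.π (!i) (D.eMul i c) = 0 := by
  have := D.π_eMul_not (!i) c
  rwa [Bool.not_not] at this

lemma finiteDimensional_grading (D : DoublePlane 𝒮) (n : ℕ) : FiniteDimensional k (𝒮 n) := by
  have : 𝒮 n ≤ (MvPolynomial.homogeneousSubmodule (Fin 3) k n).map D.ι.toLinearMap ⊔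
      (MvPolynomial.homogeneousSubmodule (Fin 3) k (n - 1)).map (D.eMul true) := by
    intro y hy
    obtain ⟨c, hc, hyc⟩ := D.exists_eq_of_mem (i := false) hy
    exact Submodule.mem_sup.2 ⟨_, ⟨_, D.π_mem false n y hy, rfl⟩, _, ⟨c, hc, rfl⟩, hyc.symm⟩
  exact Submodule.finiteDimensional_of_le this

/-- A form on the double plane is a form on one plane together with a multiple of `u` on the other.
-/
lemma finrank_grading_succ (D : DoublePlane 𝒮) [GradedAlgebra 𝒮] (n : ℕ) : Module.finrank k (𝒮 (n + 1)) =
    Nat.multichoose 3 (n + 1) + Nat.multichoose 3 n := by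
  have hmem : ∀ c : MvPolynomial.homogeneousSubmodule (Fin 3) k n,
      D.eMul true (c : PlaneRing k) ∈ 𝒮 (n + 1) := fun c => by
    rw [add_comm]
    exact SetLike.GradedMul.mul_mem (D.e_mem true) (D.ι_mem _ _ c.2)
  let f : (MvPolynomial.homogeneousSubmodule (Fin 3) k (n + 1) ×
      MvPolynomial.homogeneousSubmodule (Fin 3) k n) →ₗ[k] 𝒮 (n + 1) :=
    LinearMap.coprod (D.ι.toLinearMap.restrict fun f hf => D.ι_mem _ f hf)
      ((D.eMul true).restrict fun c hc => hmem ⟨c, hc⟩)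
  have hf : ∀ x, (f x : S) = D.ι x.1 + D.eMul true x.2 := fun x => rfl
  have hbij : Function.Bijective f := by
    constructor
    · rw [injective_iff_map_eq_zero]
      rintro ⟨a, c⟩ h
      have h0 : D.ι a + D.eMul true c = 0 := by rw [← hf (a, c), h, Submodule.coe_zero]
      have ha : (a : PlaneRing k) = 0 := by
        have := congrArg (D.π false) h0
        rwa [map_add, D.π_ι, show D.π false (D.eMul true c) = 0 from D.π_eMul_not false _,
          add_zero, map_zero] at this
      have hc : (c : PlaneRing k) = 0 := by
        have := congrArg (D.π true) h0
        rw [map_add, D.π_ι, D.π_eMul, ha, zero_add, map_zero, mul_eq_zero] at this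
        exact this.resolve_left (MvPolynomial.X_ne_zero _)
      exact Prod.ext (Subtype.ext ha) (Subtype.ext hc)
    · rintro ⟨y, hy⟩
      obtain ⟨c, hc, hyc⟩ := D.exists_eq_of_mem (i := false) hy
      exact ⟨⟨⟨_, D.π_mem false _ y hy⟩, ⟨c, hc⟩⟩, Subtype.ext hyc.symm⟩
  rw [← (LinearEquiv.ofBijective f hbij).finrank_eq, Module.finrank_prod,
    finrank_homogeneousSubmodule, finrank_homogeneousSubmodule, Fintype.card_fin]

/-- In degree three the dimension is `10 + 6 = 16`, and it does not decrease afterwards. As `A₂ /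
kΩ` has dimension at most `15`, the forms representing it must have degree at most two. -/
lemma le_finrank_grading (D : DoublePlane 𝒮) [GradedAlgebra 𝒮] {n : ℕ} (hn : 3 ≤ n) : 16 ≤ Module.finrank k (𝒮 n) := by
  obtain ⟨m, rfl⟩ : ∃ m, n = m + 2 + 1 := ⟨n - 3, by omega⟩
  rw [D.finrank_grading_succ, Nat.multichoose_eq, Nat.multichoose_eq]
  have h1 : Nat.choose 5 2 ≤ Nat.choose (3 + (m + 2 + 1) - 1) (m + 2 + 1) := by
    rw [← Nat.choose_symm (n := 3 + (m + 2 + 1) - 1) (by omega),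
      show 3 + (m + 2 + 1) - 1 - (m + 2 + 1) = 2 by omega]
    exact Nat.choose_le_choose 2 (by omega)
  have h2 : Nat.choose 4 2 ≤ Nat.choose (3 + (m + 2) - 1) (m + 2) := by
    rw [← Nat.choose_symm (n := 3 + (m + 2) - 1) (by omega),
      show 3 + (m + 2) - 1 - (m + 2) = 2 by omega]
    exact Nat.choose_le_choose 2 (by omega)
  have h3 : Nat.choose 5 2 = 10 := rfl
  have h4 : Nat.choose 4 2 = 6 := rfl
  omega

/-- The forms of degree at most two vanishing on one of the planes. -/
lemma exists_submodule_of_π_eq_zero (i : Bool) {n : ℕ} (hn : n ≤ 2) :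
    ∃ K : Submodule k S, FiniteDimensional k K ∧ Module.finrank k K ≤ 3 ∧
      ∀ y ∈ 𝒮 n, D.π i y = 0 → y ∈ K := by
  -- These forms are `e (!i)` times forms of degree `n - 1` in three variables. For `n = 0`
  -- truncated subtraction yields the constants, a harmless overestimate.
  refine ⟨(MvPolynomial.homogeneousSubmodule (Fin 3) k (n - 1)).map (D.eMul (!i)), inferInstance,
    (Submodule.finrank_map_le _ _).trans ?_, fun y hy h => ?_⟩
  · rw [finrank_homogeneousSubmodule, Fintype.card_fin]
    interval_cases n <;> norm_num [Nat.multichoose_eq, Nat.choose]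
  · obtain ⟨c, hc, hyc⟩ := D.exists_eq_of_π_eq_zero hy h
    exact ⟨c, hc, hyc.symm⟩

end DoublePlane

/-! ### Normality of `Ω`: the argument in degrees one and two. -/

namespace DoublePlane

variable {k : Type u} [Field k] {S : Type u} [CommRing S] [Algebra k S] {𝒮 : ℕ → Submodule k S}
  [GradedAlgebra 𝒮] (D : DoublePlane 𝒮) {A : Type v} [Ring A] [Algebra k A]
  {𝒜 : ℕ → Submodule k A} [GradedAlgebra 𝒜]

lemma eMul_mem (i : Bool) {n : ℕ} {c : PlaneRing k} (hc : c.IsHomogeneous n) :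
    D.eMul i c ∈ 𝒮 (n + 1) := by
  rw [add_comm]
  exact SetLike.GradedMul.mul_mem (D.e_mem i) (D.ι_mem _ _ hc)

omit [GradedAlgebra 𝒮] in
lemma exists_smul_eq_of_mem_zero (D : DoublePlane 𝒮) {y y' : S} (hy : y ∈ 𝒮 0) (hy' : y' ∈ 𝒮 0) (h : y ≠ 0) :
    ∃ c : k, y' = c • y := by
  have key : ∀ y ∈ 𝒮 0, ∃ c : k, y = algebraMap k S c := by
    intro y hy
    have hC : ∀ i, ∃ c, D.π i y = MvPolynomial.C c := fun i =>
      ⟨_, MvPolynomial.totalDegree_eq_zero_iff_eq_C.1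
        ((MvPolynomial.totalDegree_zero_iff_isHomogeneous _).2 (D.π_mem i 0 y hy))⟩
    obtain ⟨c, hc⟩ := hC false
    obtain ⟨d, hd⟩ := hC true
    have hcd : d = c := by
      have := lineRes_eq_zero_iff.2 (D.dvd false y)
      rw [Bool.not_false, hc, hd, ← map_sub] at this
      simpa [lineRes, sub_eq_zero] using this
    refine ⟨c, sub_eq_zero.1 (D.eq_zero _ fun i => ?_)⟩
    rw [map_sub, AlgHom.commutes, sub_eq_zero]
    cases i
    · exact hc
    · rw [hd, hcd]
      rfl
  obtain ⟨c, rfl⟩ := key y hy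
  obtain ⟨d, rfl⟩ := key y' hy'
  have hc : c ≠ 0 := by
    rintro rfl
    exact h (map_zero _)
  refine ⟨d / c, ?_⟩
  rw [Algebra.smul_def, ← map_mul, div_mul_cancel₀ _ hc]

/-- Two independent forms of degree `n ≥ 1` on the plane. -/
lemma eq_zero_of_smul_pow {n : ℕ} (hn : n ≠ 0) {c d : k}
    (h : c • (MvPolynomial.X 0 ^ n : PlaneRing k) = d • MvPolynomial.X 1 ^ n) : c = 0 ∧ d = 0 := by
  have h0 := congrArg (MvPolynomial.eval ![1, 0, 0]) h
  have h1 := congrArg (MvPolynomial.eval ![0, 1, 0]) h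
  simp only [MvPolynomial.smul_eval, map_pow, MvPolynomial.eval_X] at h0 h1
  simp [hn] at h0 h1
  exact ⟨h0, h1.symm⟩

omit [GradedAlgebra 𝒮] in
lemma eMul_injective (i : Bool) : Function.Injective (D.eMul i) := by
  rw [injective_iff_map_eq_zero]
  intro c hc
  have := D.π_eMul i c
  rw [hc, map_zero] at this
  exact (mul_eq_zero.1 this.symm).resolve_left (MvPolynomial.X_ne_zero _)

lemma finrank_grading_one (D : DoublePlane 𝒮) : Module.finrank k (𝒮 1) = 4 := by
  rw [D.finrank_grading_succ 0]
  norm_num [Nat.multichoose_eq]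

/-- For `B = A₂`, the elements vanishing on plane `i` have dimension at most `1` for `kΩ` plus `3`
for the forms `e (!i) * c` with `c` of degree at most one. -/
lemma finrank_vanishing_le {B : Submodule k A} [FiniteDimensional k B]
    (hB : Module.finrank k B ≤ 16) {Ψ : A →ₗ[k] S} {Ω : A} (hΩ : Ω ∈ B) (hΩ0 : Ω ≠ 0)
    (hΩΨ : Ψ Ω = 0) (hker : ∀ a ∈ B, Ψ a = 0 → ∃ c : k, a = c • Ω)
    (hrange : (∀ a ∈ B, Ψ a = 0) ∨ ∃ m, ∀ y, y ∈ 𝒮 m ↔ ∃ a ∈ B, Ψ a = y) (i : Bool) :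
    Module.finrank k ↥(B ⊓ LinearMap.ker ((D.π i).toLinearMap.comp Ψ)) ≤ 4 := by
  obtain ⟨K, hK1, hK2, hK3⟩ : ∃ K : Submodule k S, FiniteDimensional k K ∧
      Module.finrank k K ≤ 3 ∧ ∀ a ∈ B, D.π i (Ψ a) = 0 → Ψ a ∈ K := by
    rcases hrange with h0 | ⟨m, hm⟩
    · exact ⟨⊥, inferInstance, by simp, fun a ha _ => h0 a ha⟩
    · have hm2 : m ≤ 2 := by
        by_contra hm2
        have h1 := D.le_finrank_grading (n := m) (by omega)
        have h2 := LinearMap.finrank_range_add_finrank_ker (Ψ.domRestrict B)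
        have h3 : LinearMap.range (Ψ.domRestrict B) = 𝒮 m := by
          ext y
          rw [hm, LinearMap.mem_range]
          exact ⟨fun ⟨a, ha⟩ => ⟨a, a.2, ha⟩, fun ⟨a, ha, h⟩ => ⟨⟨a, ha⟩, h⟩⟩
        have hΩker : (⟨Ω, hΩ⟩ : B) ∈ LinearMap.ker (Ψ.domRestrict B) := hΩΨ
        have h4 : 0 < Module.finrank k (LinearMap.ker (Ψ.domRestrict B)) := by
          have : Nontrivial (LinearMap.ker (Ψ.domRestrict B)) := ⟨⟨⟨_, hΩker⟩, 0, fun h => hΩ0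
            (congrArg (fun x : LinearMap.ker (Ψ.domRestrict B) => ((x : B) : A)) h)⟩⟩
          exact Module.finrank_pos (R := k) (M := LinearMap.ker (Ψ.domRestrict B))
        rw [h3] at h2
        omega
      obtain ⟨K, h1, h2, h3⟩ := D.exists_submodule_of_π_eq_zero i hm2
      exact ⟨K, h1, h2, fun a ha h => h3 _ ((hm _).2 ⟨a, ha, rfl⟩) h⟩
  have hfin : FiniteDimensional k ↥(B ⊓ LinearMap.ker ((D.π i).toLinearMap.comp Ψ)) :=
    Submodule.finiteDimensional_of_le inf_le_left
  exact (finrank_le_succ_of_map_le Ψ (B ⊓ LinearMap.ker ((D.π i).toLinearMap.comp Ψ)) K Ω (fun v hv => hK3 v hv.1 hv.2)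
    fun v hv h => hker v hv.1 h).trans (by omega)

/-- The conclusion of the main theorem, from the description of `A` in degrees one and two by forms
on a double plane. -/
theorem isNormalElement_of_linear_model (hq : IsQuadratic 𝒜) [IsDomain A] {Ω : A} (hΩ : Ω ∈ 𝒜 2)
    {t : Bool → Bool} {Ψ : ℕ → A →ₗ[k] S} (ht : Function.Injective t)
    (hrange : ∀ n, (∀ a ∈ 𝒜 n, Ψ n a = 0) ∨ ∃ m, ∀ y, y ∈ 𝒮 m ↔ ∃ a ∈ 𝒜 n, Ψ n a = y)
    (hker : ∀ n, ∀ a ∈ 𝒜 n, Ψ n a = 0 ↔ a ∈ TwoSidedIdeal.span {Ω})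
    (hmul : ∀ x ∈ 𝒜 1, ∀ y ∈ 𝒜 1, ∀ i, D.π i (Ψ 2 (x * y)) = 0 ↔
      D.π i (Ψ 1 x) = 0 ∨ D.π (t i) (Ψ 1 y) = 0) :
    IsNormalElement Ω := by
  have hgen := hq.adjoin_eq_top
  have hinj : ∀ x ∈ 𝒜 1, Ψ 1 x = 0 → x = 0 := fun x hx h => by
    have := (hq.decompose_of_mem_span hΩ ((hker 1 x hx).1 h)).1
    rwa [DirectSum.decompose_of_mem_same _ hx] at this
  have hkerΩ : ∀ a ∈ 𝒜 2, Ψ 2 a = 0 → ∃ c : k, a = c • Ω := fun a ha h => by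
    have := (hq.decompose_of_mem_span hΩ ((hker 2 a ha).1 h)).2
    rwa [DirectSum.decompose_of_mem_same _ ha] at this
  have hmem : ∀ x ∈ 𝒜 1, ∀ y ∈ 𝒜 1, x * y ∈ 𝒜 2 := fun x hx y hy =>
    SetLike.GradedMul.mul_mem hx hy
  -- Such a product vanishes on both planes: on plane `i` by its first factor, on plane `!i` by its
  -- second.
  have hprod : ∀ x ∈ 𝒜 1, ∀ y ∈ 𝒜 1, ∀ i, D.π i (Ψ 1 x) = 0 → D.π (t !i) (Ψ 1 y) = 0 →
      ∃ c : k, x * y = c • Ω := fun x hx y hy i h₁ h₂ =>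
    hkerΩ _ (hmem x hx y hy) (D.eq_zero _ fun j => (hmul x hx y hy j).2 (by
      by_cases hij : j = i
      · exact Or.inl (hij ▸ h₁)
      · have : j = !i := Bool.eq_not.2 hij
        exact Or.inr (this ▸ h₂)))
  rcases hrange 1 with h0 | ⟨d, hd⟩
  · exact isNormalElement_of_commute hgen (fun x hx y hy => by
      rw [hinj x hx (h0 x hx), zero_mul, mul_zero]) Ω
  -- The forms of degree zero are the constants, so `A₁` is a line. From here on the forms in `A₁`
  -- have degree `d + 1`.
  rcases d with _ | d
  · refine isNormalElement_of_commute hgen (fun x hx y hy => ?_) Ω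
    by_cases hx0 : Ψ 1 x = 0
    · rw [hinj x hx hx0, zero_mul, mul_zero]
    · obtain ⟨c, hc⟩ := D.exists_smul_eq_of_mem_zero ((hd _).2 ⟨x, hx, rfl⟩)
        ((hd _).2 ⟨y, hy, rfl⟩) hx0
      have : y = c • x := sub_eq_zero.1 (hinj _ (sub_mem hy (Submodule.smul_mem _ c hx)) (by
        rw [map_sub, map_smul, hc, sub_self]))
      rw [this, mul_smul_comm, smul_mul_assoc]
  have hform : ∀ i (c : PlaneRing k), c.IsHomogeneous d → ∃ s ∈ 𝒜 1, Ψ 1 s = D.eMul i c :=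
    fun i c hc => (hd _).1 (D.eMul_mem i hc)
  by_cases hd0 : d = 0
  swap
  -- For forms of degree at least two, `s` and `s'` are independent forms vanishing on plane
  -- `false`, and `r` vanishes on plane `t true`.
  · exfalso
    have hX : ∀ i, (MvPolynomial.X i ^ d : PlaneRing k).IsHomogeneous d := fun i => by
      simpa using (MvPolynomial.isHomogeneous_X k i).pow d
    obtain ⟨s, hs, hsΨ⟩ := hform true _ (hX 0)
    obtain ⟨s', hs', hsΨ'⟩ := hform true _ (hX 1)
    obtain ⟨r, hr, hrΨ⟩ := hform (!t true) _ (hX 0)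
    have hX0 : (MvPolynomial.X 0 ^ d : PlaneRing k) ≠ 0 := pow_ne_zero _ (MvPolynomial.X_ne_zero _)
    have hne : ∀ i x, Ψ 1 x = D.eMul i (MvPolynomial.X 0 ^ d) → x ≠ 0 := by
      rintro i x hx rfl
      rw [map_zero] at hx
      exact hX0 (D.eMul_injective i (hx.symm.trans (map_zero _).symm))
    have hr0 : D.π (t !false) (Ψ 1 r) = 0 := by
      have := D.π_not_eMul (!t true) (MvPolynomial.X 0 ^ d)
      rwa [Bool.not_not, ← hrΨ] at this
    obtain ⟨c, hc⟩ := hprod s hs r hr false (hsΨ ▸ D.π_not_eMul true _) hr0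
    obtain ⟨c', hc'⟩ := hprod s' hs' r hr false (hsΨ' ▸ D.π_not_eMul true _) hr0
    -- Both products lie on the line `kΩ`, so this combination of `s` and `s'` kills `r`. In a
    -- domain it is zero, and independence then gives `c = 0` and `s * r = 0`.
    have h1 : (c' • s - c • s') * r = 0 := by
      rw [sub_mul, smul_mul_assoc, smul_mul_assoc, hc, hc', smul_smul, smul_smul, mul_comm, sub_self]
    have h2 := congrArg (Ψ 1) ((mul_eq_zero.1 h1).resolve_right (hne _ r hrΨ))
    rw [map_sub, map_smul, map_smul, hsΨ, hsΨ', map_zero, sub_eq_zero, ← map_smul, ← map_smul] at h2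
    have h3 := (eq_zero_of_smul_pow hd0 (D.eMul_injective true h2)).2
    rw [h3, zero_smul] at hc
    exact mul_ne_zero (hne _ s hsΨ) (hne _ r hrΨ) hc
  subst hd0
  -- Only linear forms remain; `s i` is the one vanishing on plane `i`, unique up to a scalar.
  have hs : ∀ i, ∃ s ∈ 𝒜 1, Ψ 1 s = D.eMul (!i) 1 := fun i =>
    hform (!i) 1 (MvPolynomial.isHomogeneous_one _ _)
  choose s hs hsΨ using hs
  have hs0 : ∀ i, s i ≠ 0 := fun i h => by
    have := hsΨ i
    rw [h, map_zero] at this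
    exact one_ne_zero (D.eMul_injective _ (this.symm.trans (map_zero _).symm))
  have hsπ : ∀ i, D.π i (Ψ 1 (s i)) = 0 := fun i => by
    rw [hsΨ]
    exact D.π_eMul_not i 1
  have hΩs : ∀ i, ∃ c : k, c ≠ 0 ∧ s i * s (t !i) = c • Ω := fun i => by
    obtain ⟨c, hc⟩ := hprod (s i) (hs i) (s (t !i)) (hs _) i (hsπ i) (hsπ _)
    refine ⟨c, ?_, hc⟩
    rintro rfl
    rw [zero_smul] at hc
    exact mul_ne_zero (hs0 _) (hs0 _) hc
  have hΩ0 : Ω ≠ 0 := by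
    rintro rfl
    obtain ⟨c, -, hc⟩ := hΩs true
    rw [smul_zero] at hc
    exact mul_ne_zero (hs0 _) (hs0 _) hc
  have hfin1 : FiniteDimensional k (𝒮 1) := D.finiteDimensional_grading 1
  let e : 𝒜 1 ≃ₗ[k] 𝒮 1 := LinearEquiv.ofBijective
    ((Ψ 1).restrict fun a ha => (hd _).2 ⟨a, ha, rfl⟩) ⟨by
      rw [injective_iff_map_eq_zero]
      intro a ha
      exact Subtype.ext (hinj a a.2 (congrArg Subtype.val ha)), fun y => by
      obtain ⟨a, ha, hay⟩ := (hd _).1 y.2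
      exact ⟨⟨a, ha⟩, Subtype.ext hay⟩⟩
  have hA1 : Module.finrank k (𝒜 1) = 4 := e.finrank_eq.trans D.finrank_grading_one
  have hΩΨ : Ψ 2 Ω = 0 := (hker 2 Ω hΩ).2 (TwoSidedIdeal.subset_span rfl)
  have hfinA1 : FiniteDimensional k (𝒜 1) := LinearEquiv.finiteDimensional e.symm
  have hle2 : 𝒜 2 ≤ LinearMap.range ((𝒜 1).mulMap (𝒜 1)) := fun a ha => by
    rw [Submodule.mulMap_range, ← pow_two]
    exact hq.mem_pow ha
  have hfinA2 : FiniteDimensional k (𝒜 2) := Submodule.finiteDimensional_of_le hle2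
  have hA2 : Module.finrank k (𝒜 2) ≤ 16 := by
    refine (Submodule.finrank_mono hle2).trans ((LinearMap.finrank_range_le _).trans ?_)
    rw [Module.finrank_tensorProduct, hA1]
  -- The elements of `A₂` vanishing on plane `i` have dimension at most four, so any injective
  -- linear map from `A₁` into them is onto. It is applied to left multiplication by `s i` and to
  -- right multiplication by `s (t i)`.
  have hJ : ∀ i (f : A →ₗ[k] A), (∀ x, f x = 0 → x = 0) →
      (∀ x ∈ 𝒜 1, f x ∈ 𝒜 2 ∧ D.π i (Ψ 2 (f x)) = 0) →
      ∀ a ∈ 𝒜 2, D.π i (Ψ 2 a) = 0 → ∃ x ∈ 𝒜 1, f x = a := by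
    intro i f hf hfJ a ha hai
    let J : Submodule k A := 𝒜 2 ⊓ LinearMap.ker ((D.π i).toLinearMap.comp (Ψ 2))
    have hfinJ : FiniteDimensional k J := Submodule.finiteDimensional_of_le (inf_le_left : J ≤ 𝒜 2)
    have hJ4 : Module.finrank k J ≤ 4 := D.finrank_vanishing_le hA2 hΩ hΩ0 hΩΨ hkerΩ (hrange 2) i
    have hmap : (𝒜 1).map f = J := by
      refine Submodule.eq_of_le_of_finrank_le ?_ ?_
      · rintro _ ⟨x, hx, rfl⟩
        exact hfJ x hx
      · rwa [← (Submodule.equivMapOfInjective f ((injective_iff_map_eq_zero f).2 hf) _).finrank_eq,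
          hA1]
    have : a ∈ J := ⟨ha, hai⟩
    rw [← hmap] at this
    exact this
  have hJl : ∀ i, ∀ a ∈ 𝒜 2, D.π i (Ψ 2 a) = 0 → ∃ x ∈ 𝒜 1, s i * x = a := fun i =>
    hJ i (LinearMap.mulLeft k (s i)) (fun x hx => (mul_eq_zero.1 hx).resolve_left (hs0 i))
      fun x hx => ⟨hmem _ (hs i) x hx, (hmul _ (hs i) x hx i).2 (Or.inl (hsπ i))⟩
  have hJr : ∀ i, ∀ a ∈ 𝒜 2, D.π i (Ψ 2 a) = 0 → ∃ x ∈ 𝒜 1, x * s (t i) = a := fun i =>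
    hJ i (LinearMap.mulRight k (s (t i))) (fun x hx => (mul_eq_zero.1 hx).resolve_right (hs0 _))
      fun x hx => ⟨hmem x hx _ (hs _), (hmul x hx _ (hs _) i).2 (Or.inr (hsπ _))⟩
  have hlr : ∀ i, ∀ x ∈ 𝒜 1, ∃ y ∈ 𝒜 1, s i * x = y * s (t i) := fun i x hx => by
    obtain ⟨y, hy, h⟩ := hJr i _ (hmem _ (hs i) x hx)
      ((hmul _ (hs i) x hx i).2 (Or.inl (hsπ i)))
    exact ⟨y, hy, h.symm⟩
  have hrl : ∀ i, ∀ x ∈ 𝒜 1, ∃ y ∈ 𝒜 1, x * s (t i) = s i * y := fun i x hx => by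
    obtain ⟨y, hy, h⟩ := hJl i _ (hmem x hx _ (hs _))
      ((hmul x hx _ (hs _) i).2 (Or.inr (hsπ _)))
    exact ⟨y, hy, h.symm⟩
  have ht' : ∀ i, (!t i) = t !i := fun i => by
    have h1 : t i ≠ t !i := fun h => by
      have := ht h
      exact Bool.eq_not.1 this rfl
    exact (Bool.eq_not.2 h1.symm).symm
  obtain ⟨c, hc0, hc⟩ := hΩs true
  -- A second factorization of `Ω`, whose factors are those of the first shifted by `t`; `ht'` gives
  -- it this shape.
  obtain ⟨d, hd0, hd⟩ := hΩs (t true)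
  rw [ht' true] at hd
  have hc' : Ω = c⁻¹ • (s true * s (t !true)) := by rw [hc, inv_smul_smul₀ hc0]
  have hd' : Ω = d⁻¹ • (s (t true) * s (t (t !true))) := by rw [hd, inv_smul_smul₀ hd0]
  refine isNormalElement_of_forall_mem hgen (fun x hx => ?_) fun x hx => ?_
  -- Moving `x` leftwards past both factors of `Ω` shifts each of them by `t` and turns the first
  -- factorization into the second.
  · obtain ⟨y, hy, hxy⟩ := hlr (t !true) x hx
    obtain ⟨z, hz, hyz⟩ := hlr true y hy
    refine ⟨(c⁻¹ * d) • z, ?_⟩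
    rw [smul_mul_assoc, mul_smul, ← mul_smul_comm, ← hd, ← mul_assoc, ← hyz, mul_assoc, ← hxy,
      ← mul_assoc, ← smul_mul_assoc, ← hc']
  · obtain ⟨y, hy, hxy⟩ := hrl true x hx
    obtain ⟨z, hz, hyz⟩ := hrl (t !true) y hy
    refine ⟨(d⁻¹ * c) • z, ?_⟩
    rw [mul_smul_comm, mul_smul, ← smul_mul_assoc, ← hc, mul_assoc, ← hyz, ← mul_assoc, ← hxy,
      mul_assoc, ← mul_smul_comm, ← hd']

end DoublePlane

theorem RankTwoQuadric.isNormalElement {k : Type u} [Field k] (Q : RankTwoQuadric k)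
    (τ : Q.scheme ≅ Q.scheme) (L : InvertibleSheaf Q.scheme) {A : Type v} [Ring A] [Algebra k A]
    {𝒜 : ℕ → Submodule k A} [GradedAlgebra 𝒜] (hq : IsQuadratic 𝒜) [IsDomain A] {Ω : A}
    (hΩ : Ω ∈ 𝒜 2) (hA : L.IsQuotientBy τ.hom Q.toSpec 𝒜 Ω) : IsNormalElement Ω := by
  obtain ⟨D, -⟩ := Q.exists_doublePlane
  obtain ⟨t, Ψ, ht, hrange, hker, hmul⟩ := D.exists_linear_model τ L hA
  exact D.isNormalElement_of_linear_model hq hΩ ht hrange hker hmul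

/-! ### The sheaf `𝒪(1)`, and the coordinate ring as `S(Q, id, 𝒪(1))`. -/

lemma iter_id {X : Scheme.{u}} (n : ℕ) : iter (𝟙 X) n = 𝟙 X := by
  induction n with
  | zero => rfl
  | succ n ih => rw [iter, ih, Category.comp_id]

namespace DoublePlane

variable {k : Type u} [Field k] {S : Type u} [CommRing S] [Algebra k S] {𝒮 : ℕ → Submodule k S}
  [GradedAlgebra 𝒮] (D : DoublePlane 𝒮)

lemma ev_iter_id_appLE {i : Bool} {U V : (Proj 𝒮).Opens} {n : ℕ} (e : V ≤ iter (𝟙 _) n ⁻¹ᵁ U)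
    (h : D.gen i ∈ V) (f : Γ(Proj 𝒮, U)) :
    D.ev i ((iter (𝟙 _) n).appLE U V e f) = D.ev i f := by
  have key : ∀ (g : Proj 𝒮 ⟶ Proj 𝒮) (hg : g = 𝟙 _) (e : V ≤ g ⁻¹ᵁ U),
      D.ev i (g.appLE U V e f) = D.ev i f := by
    rintro _ rfl e
    have e' : V ≤ U := e
    rw [InvertibleSheaf.id_appLE_apply e e', D.ev_map i h]
  exact key _ (iter_id n) e

/-- The coordinate function `X j` in the function field of a plane. -/
def coord (k : Type u) [Field k] (j : Fin 3) : PlaneField k :=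
  algebraMap (PlaneRing k) (PlaneField k) (MvPolynomial.X j)

lemma coord_ne_zero (j : Fin 3) : coord k j ≠ 0 :=
  (FaithfulSMul.algebraMap_eq_zero_iff _ _).not.2 (MvPolynomial.X_ne_zero j)

omit [GradedAlgebra 𝒮] in
lemma toField_ι_X (i : Bool) (j : Fin 3) : D.toField i (D.ι (MvPolynomial.X j)) = coord k j := by
  change algebraMap _ _ (D.π i (D.ι _)) = _
  rw [D.π_ι]
  rfl

lemma exists_ev_eq_div {U : (Proj 𝒮).Opens} {n : ℕ} {a b : S} (ha : a ∈ 𝒮 n) (hb : b ∈ 𝒮 n)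
    (hbU : ∀ q ∈ U, b ∉ q.asHomogeneousIdeal) :
    ∃ f : Γ(Proj 𝒮, U), ∀ i, D.gen i ∈ U → D.ev i f = D.toField i a / D.toField i b := by
  refine D.exists_ev_eq fun q hq =>
    ⟨n, n, a, b, ha, hb, (add_zero _).symm, hbU q hq, fun i hi => div_mul_cancel₀ _ fun h => ?_⟩
  exact hbU q hq (hi.mem_ideal ((D.toField_eq_zero).1 h))

lemma gen_mem_basicOpen_X (i : Bool) (j : Fin 3) :
    D.gen i ∈ Proj.basicOpen 𝒮 (D.ι (MvPolynomial.X j)) := fun h => by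
  have := D.mem_gen.1 h
  rw [D.π_ι] at this
  exact MvPolynomial.X_ne_zero j this

omit [GradedAlgebra 𝒮] in
lemma ι_X_mem (j : Fin 3) : D.ι (MvPolynomial.X j) ∈ 𝒮 1 :=
  D.ι_mem _ _ (MvPolynomial.isHomogeneous_X _ _)

lemma exists_ratio (j l : Fin 3) : ∃ f : Γ(Proj 𝒮, Proj.basicOpen 𝒮 (D.ι (MvPolynomial.X j)) ⊓
    Proj.basicOpen 𝒮 (D.ι (MvPolynomial.X l))), ∀ i, D.ev i f = coord k l / coord k j := by
  obtain ⟨f, hf⟩ := D.exists_ev_eq_div (U := Proj.basicOpen 𝒮 (D.ι (MvPolynomial.X j)) ⊓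
    Proj.basicOpen 𝒮 (D.ι (MvPolynomial.X l))) (D.ι_X_mem l) (D.ι_X_mem j) fun q hq => hq.1
  refine ⟨f, fun i => ?_⟩
  rw [hf i ⟨D.gen_mem_basicOpen_X i j, D.gen_mem_basicOpen_X i l⟩, D.toField_ι_X, D.toField_ι_X]

/-- The invertible sheaf `𝒪(1)` on a double plane. -/
def hyperplaneSheaf : InvertibleSheaf (Proj 𝒮) where
  ι := ULift (Fin 3)
  U j := Proj.basicOpen 𝒮 (D.ι (MvPolynomial.X j.down))
  iSup_U := by
    refine top_le_iff.1 (D.iSup_basicOpen_eq_top.ge.trans (iSup_le fun j => ?_))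
    exact le_iSup (fun j : ULift (Fin 3) =>
      Proj.basicOpen 𝒮 (D.ι (MvPolynomial.X j.down))) (ULift.up j)
  g j l := (D.exists_ratio j.down l.down).choose
  g_self j := D.eq_of_ev fun i hi => by
    rw [(D.exists_ratio j.down j.down).choose_spec i, D.ev_one i hi, div_self (coord_ne_zero _)]
  g_mul j l m := D.eq_of_ev fun i hi => by
    rw [D.ev_mul, D.ev_map i hi, D.ev_map i hi, D.ev_map i hi,
      (D.exists_ratio j.down l.down).choose_spec i, (D.exists_ratio l.down m.down).choose_spec i,
      (D.exists_ratio j.down m.down).choose_spec i]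
    rw [mul_comm, div_mul_div_cancel₀ (coord_ne_zero _)]

lemma ev_hyperplaneSheaf_g (i : Bool) (j l : D.hyperplaneSheaf.ι) :
    D.ev i (D.hyperplaneSheaf.g j l) = coord k l.down / coord k j.down :=
  (D.exists_ratio j.down l.down).choose_spec i

/-- The product of the first `n` coordinate functions of a sequence. -/
def coordProd (n : ℕ) (w : ℕ → D.hyperplaneSheaf.ι) : PlaneField k :=
  ∏ j ∈ Finset.range n, coord k (w j).down

lemma coordProd_ne_zero (n : ℕ) (w : ℕ → D.hyperplaneSheaf.ι) : D.coordProd n w ≠ 0 :=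
  Finset.prod_ne_zero_iff.2 fun _ _ => coord_ne_zero _

lemma coordProd_add (m n : ℕ) (w : ℕ → D.hyperplaneSheaf.ι) :
    D.coordProd (m + n) w = D.coordProd m w * D.coordProd n fun i => w (m + i) :=
  Finset.prod_range_add _ _ _

lemma mem_opens_iff {n : ℕ} {w : ℕ → D.hyperplaneSheaf.ι} {q : Proj 𝒮} :
    q ∈ D.hyperplaneSheaf.opens (𝟙 _) n w ↔
      ∀ j < n, q ∈ Proj.basicOpen 𝒮 (D.ι (MvPolynomial.X (w j).down)) := by
  have h : ∀ j, iter (𝟙 (Proj 𝒮)) j q = q := fun j => by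
    rw [iter_id]
    rfl
  constructor
  · intro hq j hj
    have := D.hyperplaneSheaf.opens_le (𝟙 _) w ⟨j, hj⟩ hq
    rw [Scheme.Hom.mem_preimage] at this
    rw [← h j]
    exact this
  · intro hq
    have : ∀ j : Fin n, iter (𝟙 (Proj 𝒮)) j q ∈ D.hyperplaneSheaf.U (w j) := fun j => by
      rw [h]
      exact hq j j.2
    simpa [InvertibleSheaf.opens, ← SetLike.mem_coe, Opens.coe_finset_inf] using this

lemma gen_mem_opens (i : Bool) (n : ℕ) (w : ℕ → D.hyperplaneSheaf.ι) :
    D.gen i ∈ D.hyperplaneSheaf.opens (𝟙 _) n w :=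
  D.mem_opens_iff.2 fun _ _ => D.gen_mem_basicOpen_X i _

lemma ev_hyperplaneSheaf_trans (i : Bool) (n : ℕ) (w w' : ℕ → D.hyperplaneSheaf.ι) :
    D.ev i (D.hyperplaneSheaf.trans (𝟙 _) n w w') = D.coordProd n w' / D.coordProd n w := by
  have hg : D.gen i ∈ D.hyperplaneSheaf.opens (𝟙 _) n w ⊓ D.hyperplaneSheaf.opens (𝟙 _) n w' :=
    ⟨D.gen_mem_opens i n w, D.gen_mem_opens i n w'⟩
  have hprod : ∀ f : Fin n → Γ(Proj 𝒮, D.hyperplaneSheaf.opens (𝟙 _) n w ⊓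
      D.hyperplaneSheaf.opens (𝟙 _) n w'), D.ev i (∏ j, f j) = ∏ j, D.ev i (f j) := by
    intro f
    simp only [D.ev_eq i hg, map_prod]
  change _ = (∏ j ∈ Finset.range n, coord k (w' j).down) / ∏ j ∈ Finset.range n, coord k (w j).down
  rw [InvertibleSheaf.trans, hprod, ← Finset.prod_div_distrib, Finset.prod_range]
  refine Finset.prod_congr rfl fun j _ => ?_
  rw [D.ev_iter_id_appLE _ hg, D.ev_hyperplaneSheaf_g]

/-- In the trivialization by `w`, dividing a form of degree `n` by the product of the `n` chosen
coordinates gives a function. -/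
lemma exists_formSection (n : ℕ) (a : 𝒮 n) : ∃ s : D.hyperplaneSheaf.sections (𝟙 _) n,
    ∀ i w, D.ev i (s.1 w) = D.toField i a / D.coordProd n w := by
  have h : ∀ w : ℕ → D.hyperplaneSheaf.ι, ∃ f : Γ(Proj 𝒮, D.hyperplaneSheaf.opens (𝟙 _) n w),
      ∀ i, D.ev i f = D.toField i a / D.coordProd n w := by
    intro w
    let b : S := ∏ j ∈ Finset.range n, D.ι (MvPolynomial.X (w j).down)
    have hb : ∀ i, D.toField i b = D.coordProd n w := fun i => by
      rw [map_prod]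
      exact Finset.prod_congr rfl fun j _ => D.toField_ι_X i _
    obtain ⟨f, hf⟩ := D.exists_ev_eq_div (U := D.hyperplaneSheaf.opens (𝟙 _) n w) (b := b) a.2 (by
        have := SetLike.prod_mem_graded 𝒮 (fun _ : ℕ => 1)
          (fun j => D.ι (MvPolynomial.X (w j).down)) (F := Finset.range n) fun j _ => D.ι_X_mem _
        simpa using this) fun q hq h => by
      have hp : b ∈ q.asHomogeneousIdeal.toIdeal := h
      obtain ⟨j, hj, hjq⟩ := (Ideal.IsPrime.prod_mem_iff).1 hp
      exact D.mem_opens_iff.1 hq j (Finset.mem_range.1 hj) hjq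
    exact ⟨f, fun i => by rw [hf i (D.gen_mem_opens i n w), hb]⟩
  choose s hs using h
  refine ⟨⟨s, fun w w' => D.eq_of_ev fun i hi => ?_⟩, fun i w => hs w i⟩
  rw [D.ev_mul, D.ev_map i hi, D.ev_map i hi, hs, hs, ev_hyperplaneSheaf_trans]
  rw [mul_comm, div_mul_div_cancel₀ (D.coordProd_ne_zero _ _)]

/-- The section of `𝒪(n)` given by a form of degree `n`. -/
def formSection (n : ℕ) (a : 𝒮 n) : D.hyperplaneSheaf.sections (𝟙 _) n :=
  (D.exists_formSection n a).choose

lemma ev_formSection {n : ℕ} (a : 𝒮 n) (i : Bool) (w : ℕ → D.hyperplaneSheaf.ι) :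
    D.ev i ((D.formSection n a).1 w) = D.toField i a / D.coordProd n w :=
  (D.exists_formSection n a).choose_spec i w

lemma section_ext {n : ℕ} {s t : D.hyperplaneSheaf.sections (𝟙 _) n}
    (h : ∀ i w, D.ev i (s.1 w) = D.ev i (t.1 w)) : s = t :=
  Subtype.ext (funext fun w => D.eq_of_ev fun i _ => h i w)

lemma formSection_add {n : ℕ} (a b : 𝒮 n) :
    D.formSection n (a + b) = D.formSection n a + D.formSection n b := by
  refine D.section_ext fun i w => ?_
  refine Eq.trans ?_ (D.ev_add i _ _).symm
  rw [ev_formSection, ev_formSection, ev_formSection, Submodule.coe_add, map_add, add_div]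

lemma formSection_injective (n : ℕ) : Function.Injective (D.formSection n) := by
  intro a b h
  refine Subtype.ext (D.eq_of_toField fun i => ?_)
  have h1 := D.ev_formSection a i fun _ => ULift.up 0
  have h2 := D.ev_formSection b i fun _ => ULift.up 0
  rw [h, h2] at h1
  exact ((div_left_inj' (D.coordProd_ne_zero _ _)).1 h1).symm

/-- Multiplying back by the coordinates gives an expression independent of the trivialization: the
form to which the section belongs. -/
lemma ev_mul_coordProd {n : ℕ} (s : D.hyperplaneSheaf.sections (𝟙 _) n) (i : Bool)
    (w w' : ℕ → D.hyperplaneSheaf.ι) :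
    D.ev i (s.1 w) * D.coordProd n w = D.ev i (s.1 w') * D.coordProd n w' := by
  have hg : D.gen i ∈ D.hyperplaneSheaf.opens (𝟙 _) n w ⊓ D.hyperplaneSheaf.opens (𝟙 _) n w' :=
    ⟨D.gen_mem_opens i n w, D.gen_mem_opens i n w'⟩
  have := congrArg (D.ev i) (s.2 w w')
  rw [D.ev_mul, D.ev_map i hg, D.ev_map i hg, ev_hyperplaneSheaf_trans] at this
  rw [this, mul_right_comm, div_mul_cancel₀ _ (D.coordProd_ne_zero _ _), mul_comm]

lemma formSection_surjective (n : ℕ) : Function.Surjective (D.formSection n) := by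
  intro s
  -- Regularity at `q` is read off in the trivialization by a single coordinate not vanishing at
  -- `q`, where the form is a function times the `n`-th power of that coordinate.
  let w₀ : ℕ → D.hyperplaneSheaf.ι := fun _ => ULift.up 0
  obtain ⟨y, hy, hys⟩ := D.exists_mem_of_regAt (n := n)
    (f := fun i => D.ev i (s.1 w₀) * D.coordProd n w₀) (fun q => by
      obtain ⟨j, hj⟩ := exists_mem_U D.hyperplaneSheaf q
      let w : ℕ → D.hyperplaneSheaf.ι := fun _ => j
      have hq : q ∈ D.hyperplaneSheaf.opens (𝟙 _) n w := D.mem_opens_iff.2 fun _ _ => hj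
      have hX : D.ι (MvPolynomial.X j.down ^ n) ∈ 𝒮 n :=
        D.ι_mem _ _ (by simpa using (MvPolynomial.isHomogeneous_X k j.down).pow n)
      have := (D.regAt_ev (s.1 w) hq).mul (D.regAt_toField hX q)
      rw [zero_add] at this
      refine this.congr fun i _ => ?_
      rw [D.ev_mul_coordProd s i w₀ w]
      congr 1
      rw [map_pow, map_pow, D.toField_ι_X]
      have h : D.coordProd n w = ∏ _l ∈ Finset.range n, coord k j.down := rfl
      rw [h, Finset.prod_const, Finset.card_range])
  refine ⟨⟨y, hy⟩, D.section_ext fun i w => ?_⟩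
  rw [ev_formSection, ← hys, D.ev_mul_coordProd s i w₀ w]
  exact mul_div_cancel_right₀ _ (D.coordProd_ne_zero n w)

lemma formSection_mul {m n : ℕ} (a : 𝒮 m) (b : 𝒮 n) (c : 𝒮 (m + n)) (h : (c : S) = a * b) :
    D.formSection (m + n) c =
      D.hyperplaneSheaf.mul (𝟙 _) (D.formSection m a) (D.formSection n b) := by
  refine D.section_ext fun i w => ?_
  have hg := D.gen_mem_opens i (m + n) w
  refine Eq.trans ?_ (D.ev_mul i _ _).symm
  rw [D.ev_map i hg, D.ev_iter_id_appLE _ hg, ev_formSection, ev_formSection, ev_formSection, h,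
    map_mul, D.coordProd_add, mul_div_mul_comm]

lemma formSection_algebraMap (c : k) (a : 𝒮 0) (h : (a : S) = algebraMap k S c) :
    D.formSection 0 a = D.hyperplaneSheaf.const (𝟙 _) (globalConst 𝒮 c) := by
  refine D.section_ext fun i w => ?_
  refine Eq.trans ?_ (D.ev_map i (D.gen_mem_opens i 0 w) _ _).symm
  rw [ev_formSection, h, ev_globalConst, AlgHom.commutes]
  exact div_one _

lemma globalConst_one : globalConst 𝒮 1 = 1 := by
  rw [globalConst, map_one, map_one]

/-- The homogeneous coordinate ring of a double plane as a twisted homogeneous coordinate ring with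
trivial automorphism. -/
def toTwistedRing : S →+* D.hyperplaneSheaf.TwistedRing (𝟙 _) :=
  (DirectSum.toSemiring (fun n => (DirectSum.of _ n).comp
      (AddMonoidHom.mk' (D.formSection n) D.formSection_add))
    (congrArg (DirectSum.of _ 0)
      ((D.formSection_algebraMap 1 _ (map_one _).symm).trans (by rw [globalConst_one]; rfl)))
    (fun {m n} a b => (congrArg (DirectSum.of _ (m + n)) (D.formSection_mul a b _ rfl)).trans
      (DirectSum.of_mul_of _ _).symm)).comp (DirectSum.decomposeRingEquiv 𝒮 : S →+* _)

lemma toTwistedRing_coe {n : ℕ} (a : 𝒮 n) :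
    D.toTwistedRing a = DirectSum.of _ n (D.formSection n a) := by
  change DirectSum.toAddMonoid (fun n => (DirectSum.of _ n).comp
    (AddMonoidHom.mk' (D.formSection n) D.formSection_add)) (DirectSum.decompose 𝒮 (a : S)) = _
  rw [DirectSum.decompose_coe]
  exact DirectSum.toAddMonoid_of _ _ _

lemma toTwistedRing_apply (a : S) (n : ℕ) :
    D.toTwistedRing a n = D.formSection n (DirectSum.decompose 𝒮 a n) := by
  have hadd : ∀ a b : S, D.toTwistedRing (a + b) n = D.toTwistedRing a n + D.toTwistedRing b n :=
    fun a b => (congrArg (fun z : D.hyperplaneSheaf.TwistedRing (𝟙 _) => z n)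
      (D.toTwistedRing.map_add a b)).trans (DirectSum.add_apply _ _ _)
  have h0 : D.formSection n 0 = 0 := by
    have := D.formSection_add (0 : 𝒮 n) 0
    rwa [add_zero, left_eq_add] at this
  induction a using DirectSum.Decomposition.inductionOn 𝒮 with
  | zero =>
    rw [DirectSum.decompose_zero, DirectSum.zero_apply, h0]
    exact (congrArg (fun z : D.hyperplaneSheaf.TwistedRing (𝟙 _) => z n)
      (D.toTwistedRing.map_zero)).trans (DirectSum.zero_apply _)
  | @homogeneous m x =>
    rw [toTwistedRing_coe, DirectSum.decompose_coe]
    by_cases hmn : m = n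
    · subst hmn
      rw [DirectSum.of_eq_same, DirectSum.of_eq_same]
    · rw [DirectSum.of_eq_of_ne _ _ _ (Ne.symm hmn), DirectSum.of_eq_of_ne _ _ _ (Ne.symm hmn), h0]
  | add x y hx hy =>
    rw [hadd, hx, hy, DirectSum.decompose_add, DirectSum.add_apply, formSection_add]

lemma toTwistedRing_injective : Function.Injective D.toTwistedRing := by
  intro a b h
  have : DirectSum.decompose 𝒮 a = DirectSum.decompose 𝒮 b := by
    refine DFinsupp.ext fun n => D.formSection_injective n ?_
    rw [← toTwistedRing_apply, ← toTwistedRing_apply, h]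
  exact (DirectSum.decompose 𝒮).injective this

lemma toTwistedRing_surjective : Function.Surjective D.toTwistedRing := by
  intro z
  induction z using DirectSum.induction_on with
  | zero => exact ⟨0, D.toTwistedRing.map_zero⟩
  | of n s =>
    obtain ⟨a, rfl⟩ := D.formSection_surjective n s
    exact ⟨a, D.toTwistedRing_coe a⟩
  | add x y hx hy =>
    obtain ⟨a, rfl⟩ := hx
    obtain ⟨b, rfl⟩ := hy
    exact ⟨a + b, D.toTwistedRing.map_add a b⟩

lemma toTwistedRing_algebraMap (c : k) : D.toTwistedRing (algebraMap k S c) =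
    D.hyperplaneSheaf.scalar (𝟙 _)
      (Proj.toSpecZero 𝒮 ≫ Spec.map (CommRingCat.ofHom (algebraMap k (𝒮 0)))) c :=
  (D.toTwistedRing_coe (algebraMap k (𝒮 0) c)).trans
    (congrArg (DirectSum.of _ 0) (D.formSection_algebraMap c _ rfl))

/-- A graded algebra mapping onto the homogeneous coordinate ring of a double plane with kernel
`⟨Ω⟩`. -/
lemma isQuotientBy_of_algHom {A : Type v} [Ring A] [Algebra k A] {𝒜 : ℕ → Submodule k A} {Ω : A}
    (ρ : A →ₐ[k] S) (hρ : ∀ n, ∀ a ∈ 𝒜 n, ρ a ∈ 𝒮 n) (hsurj : Function.Surjective ρ)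
    (hker : ∀ a, ρ a = 0 ↔ a ∈ TwoSidedIdeal.span {Ω}) :
    D.hyperplaneSheaf.IsQuotientBy (𝟙 _)
      (Proj.toSpecZero 𝒮 ≫ Spec.map (CommRingCat.ofHom (algebraMap k (𝒮 0)))) 𝒜 Ω := by
  refine ⟨D.toTwistedRing.comp ρ.toRingHom, fun c => ?_, fun n a ha => ?_,
    D.toTwistedRing_surjective.comp hsurj, fun a => ?_⟩
  · exact (congrArg D.toTwistedRing (ρ.commutes c)).trans (D.toTwistedRing_algebraMap c)
  · exact ⟨_, D.toTwistedRing_coe ⟨ρ a, hρ n a ha⟩⟩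
  · rw [← hker]
    exact map_eq_zero_iff D.toTwistedRing D.toTwistedRing_injective

end DoublePlane

/-! ### A quadratic algebra with zero divisors -/

section Counterexample

variable (k : Type u) [Field k]

/-- The relations `x₀x₁ = 0` and `xᵢxⱼ = xⱼxᵢ` for `i < 2`. -/
inductive CommRel : FreeAlgebra k (Fin 4) → FreeAlgebra k (Fin 4) → Prop
  | mul_eq_zero : CommRel (FreeAlgebra.ι k 0 * FreeAlgebra.ι k 1) 0
  | comm (i j : Fin 4) (h : i < 2) :
      CommRel (FreeAlgebra.ι k i * FreeAlgebra.ι k j) (FreeAlgebra.ι k j * FreeAlgebra.ι k i)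

/-- The algebra on `x₀, x₁, x₂, x₃` with relations `x₀x₁ = 0` and `xᵢxⱼ = xⱼxᵢ` for `i < 2`. -/
abbrev PartialCommAlgebra : Type u := RingQuot (CommRel k)

namespace PartialCommAlgebra

/-- The generators. -/
def gen (i : Fin 4) : PartialCommAlgebra k := RingQuot.mkAlgHom k (CommRel k) (FreeAlgebra.ι k i)

lemma gen_zero_mul_gen_one : gen k 0 * gen k 1 = 0 := by
  rw [gen, gen, ← map_mul, RingQuot.mkAlgHom_rel k CommRel.mul_eq_zero, map_zero]

lemma gen_comm {i : Fin 4} (h : i < 2) (j : Fin 4) : gen k i * gen k j = gen k j * gen k i := by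
  rw [gen, gen, ← map_mul, RingQuot.mkAlgHom_rel k (CommRel.comm i j h), map_mul]

variable {k} {B : Type v} [Semiring B] [Algebra k B]

/-- The universal property. -/
def lift (b : Fin 4 → B) (h0 : b 0 * b 1 = 0) (hc : ∀ i j, i < 2 → b i * b j = b j * b i) :
    PartialCommAlgebra k →ₐ[k] B :=
  RingQuot.liftAlgHom k ⟨FreeAlgebra.lift k b, by
    rintro _ _ (_ | ⟨i, j, h⟩)
    · simpa using h0
    · simpa using hc i j h⟩

@[simp]
lemma lift_gen (b : Fin 4 → B) (h0 : b 0 * b 1 = 0) (hc : ∀ i j, i < 2 → b i * b j = b j * b i)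
    (i : Fin 4) : lift b h0 hc (gen k i) = b i := by
  rw [lift, gen, RingQuot.liftAlgHom_mkAlgHom_apply, FreeAlgebra.lift_ι_apply]

lemma hom_ext {f g : PartialCommAlgebra k →ₐ[k] B} (h : ∀ i, f (gen k i) = g (gen k i)) :
    f = g := by
  refine RingQuot.ringQuot_ext' _ _ _ (FreeAlgebra.hom_ext ?_)
  funext i
  exact h i

variable (k)

/-- The linear forms. -/
def linearForms : Submodule k (PartialCommAlgebra k) := Submodule.span k (Set.range (gen k))

lemma gen_mem (i : Fin 4) : gen k i ∈ linearForms k := Submodule.subset_span ⟨i, rfl⟩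

/-- The grading by degree. -/
def grading (n : ℕ) : Submodule k (PartialCommAlgebra k) := linearForms k ^ n

lemma gen_mem_grading (i : Fin 4) : gen k i ∈ grading k 1 := by
  rw [grading, pow_one]
  exact gen_mem k i

instance : SetLike.GradedMonoid (grading k) := Submodule.nat_power_gradedMonoid (linearForms k)

/-- A generator, as a homogeneous element. -/
def homGen (i : Fin 4) : DirectSum ℕ fun n => grading k n :=
  DirectSum.of (fun n => grading k n) 1 ⟨gen k i, gen_mem_grading k i⟩

/-- The decomposition into homogeneous components. -/
def decomposeHom : PartialCommAlgebra k →ₐ[k] DirectSum ℕ fun n => grading k n :=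
  lift (homGen k)
    (by
      rw [homGen, homGen, DirectSum.of_mul_of]
      refine (congrArg (DirectSum.of (fun n => grading k n) (1 + 1)) ?_).trans (map_zero _)
      exact Subtype.ext (gen_zero_mul_gen_one k))
    (fun i j h => by
      rw [homGen, homGen, DirectSum.of_mul_of, DirectSum.of_mul_of]
      refine congrArg (DirectSum.of (fun n => grading k n) (1 + 1)) ?_
      exact Subtype.ext (gen_comm k h j))

lemma decomposeHom_apply (m : PartialCommAlgebra k) (hm : m ∈ linearForms k) :
    decomposeHom k m = DirectSum.of (fun n => grading k n) 1
      ⟨m, by rw [grading, pow_one]; exact hm⟩ := by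
  induction hm using Submodule.span_induction with
  | mem x hx =>
    obtain ⟨i, rfl⟩ := hx
    exact lift_gen _ _ _ i
  | zero => exact (map_zero _).trans (map_zero _).symm
  | add x y hx hy ihx ihy =>
    rw [map_add, ihx, ihy, ← map_add]
    rfl
  | smul c x hx ihx =>
    rw [map_smul, ihx]
    exact (map_smul (DirectSum.lof k ℕ (fun n => grading k n) 1) c
      (⟨x, by rw [grading, pow_one]; exact hx⟩ : grading k 1)).symm

instance : GradedAlgebra (grading k) :=
  GradedAlgebra.ofAlgHom _ (decomposeHom k)
    (hom_ext fun i => by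
      rw [AlgHom.comp_apply, decomposeHom, lift_gen, homGen, DirectSum.coeAlgHom_of]
      rfl)
    (fun n x => by
      obtain ⟨x, hx⟩ := x
      induction hx using Submodule.pow_induction_on_left' with
      | algebraMap r =>
        rw [AlgHom.commutes, DirectSum.algebraMap_apply]
        rfl
      | add x y i hx hy ihx ihy =>
        rw [map_add, ihx, ihy, ← map_add]
        rfl
      | mem_mul m hm i x hx ih =>
        have hm' : decomposeHom k m = DirectSum.of (fun n => grading k n) 1
            ⟨m, by rw [grading, pow_one]; exact hm⟩ := decomposeHom_apply k m hm
        rw [map_mul, ih, hm', DirectSum.of_mul_of]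
        exact DirectSum.of_eq_of_gradedMonoid_eq (Sigma.subtype_ext (add_comm _ _) rfl))

lemma adjoin_gen : Algebra.adjoin k (Set.range (gen k)) = ⊤ := by
  have h : Set.range (gen k) =
      RingQuot.mkAlgHom k (CommRel k) '' Set.range (FreeAlgebra.ι k (X := Fin 4)) := by
    rw [← Set.range_comp]
    rfl
  rw [h, ← AlgHom.map_adjoin, FreeAlgebra.adjoin_range_ι, Algebra.map_top, AlgHom.range_eq_top]
  exact RingQuot.mkAlgHom_surjective k _

lemma lift_surjective :
    Function.Surjective (TensorAlgebra.lift k (grading k 1).subtype) := by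
  rw [← AlgHom.range_eq_top, ← top_le_iff, ← adjoin_gen, Algebra.adjoin_le_iff]
  rintro _ ⟨i, rfl⟩
  exact ⟨TensorAlgebra.ι k ⟨gen k i, gen_mem_grading k i⟩, TensorAlgebra.lift_ι_apply _ _⟩

/-- The defining relations are of degree two and hold modulo the quadratic relations of the tensor
algebra. The universal property therefore maps `A` back to the quotient of the tensor algebra by
these, compatibly with the projections, so the kernel of `T(A₁) → A` is generated in degree two. -/
theorem isQuadratic : IsQuadratic (grading k) := by
  refine ⟨lift_surjective k, fun t => ⟨fun ht => ?_, fun ht => ?_⟩⟩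
  · set W := {r : TensorAlgebra k (grading k 1) |
      r ∈ LinearMap.range (TensorAlgebra.ι k (M := grading k 1)) ^ 2 ∧
        TensorAlgebra.lift k (grading k 1).subtype r = 0} with hW
    set I := TwoSidedIdeal.span W with hI
    let π : TensorAlgebra k (grading k 1) →ₐ[k] I.ringCon.Quotient := I.ringCon.mkₐ k
    have hπ : ∀ {x}, π x = 0 ↔ x ∈ I := by
      intro x
      rw [TwoSidedIdeal.mem_iff, ← RingCon.eq]
      rfl
    let T : Fin 4 → TensorAlgebra k (grading k 1) :=
      fun i => TensorAlgebra.ι k ⟨gen k i, gen_mem_grading k i⟩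
    have hT : ∀ i, TensorAlgebra.lift k (grading k 1).subtype (T i) = gen k i :=
      fun i => TensorAlgebra.lift_ι_apply _ _
    have hTT : ∀ i j, T i * T j ∈ LinearMap.range (TensorAlgebra.ι k (M := grading k 1)) ^ 2 := by
      intro i j
      rw [pow_two]
      exact Submodule.mul_mem_mul ⟨_, rfl⟩ ⟨_, rfl⟩
    let g : PartialCommAlgebra k →ₐ[k] I.ringCon.Quotient := lift (fun i => π (T i))
      (by
        rw [← map_mul, hπ]
        exact TwoSidedIdeal.subset_span ⟨hTT 0 1, by
          rw [map_mul, hT, hT, gen_zero_mul_gen_one]⟩)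
      (fun i j h => by
        rw [← sub_eq_zero, ← map_mul π, ← map_mul π, ← map_sub, hπ]
        exact TwoSidedIdeal.subset_span ⟨sub_mem (hTT i j) (hTT j i), by
          rw [map_sub, map_mul, map_mul, hT, hT, gen_comm k h, sub_self]⟩)
    have hg : g.comp (TensorAlgebra.lift k (grading k 1).subtype) = π := by
      refine TensorAlgebra.hom_ext (LinearMap.ext fun ⟨v, hv⟩ => ?_)
      have hv' : v ∈ linearForms k := by
        rwa [grading, pow_one] at hv
      change g (TensorAlgebra.lift k (grading k 1).subtype (TensorAlgebra.ι k ⟨v, hv⟩)) =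
        π (TensorAlgebra.ι k ⟨v, hv⟩)
      rw [TensorAlgebra.lift_ι_apply, Submodule.subtype_apply]
      induction hv' using Submodule.span_induction with
      | mem x hx =>
        obtain ⟨i, rfl⟩ := hx
        exact lift_gen _ _ _ i
      | zero =>
        rw [map_zero]
        exact ((congrArg π (map_zero (TensorAlgebra.ι k))).trans (map_zero π)).symm
      | add x y hx hy ihx ihy =>
        have hx' : x ∈ grading k 1 := by rw [grading, pow_one]; exact hx
        have hy' : y ∈ grading k 1 := by rw [grading, pow_one]; exact hy
        rw [map_add, ihx hx', ihy hy', ← map_add, ← map_add]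
        rfl
      | smul c x hx ihx =>
        have hx' : x ∈ grading k 1 := by rw [grading, pow_one]; exact hx
        rw [map_smul, ihx hx', ← map_smul, ← map_smul]
        rfl
    rw [← hπ, ← hg, AlgHom.comp_apply, ht, map_zero]
  · have h : TwoSidedIdeal.span {r : TensorAlgebra k (grading k 1) |
        r ∈ LinearMap.range (TensorAlgebra.ι k (M := grading k 1)) ^ 2 ∧
          TensorAlgebra.lift k (grading k 1).subtype r = 0} ≤
        TwoSidedIdeal.ker (TensorAlgebra.lift k (grading k 1).subtype) :=
      TwoSidedIdeal.span_le.2 fun r hr => (TwoSidedIdeal.mem_ker _).2 hr.2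
    exact (TwoSidedIdeal.mem_ker _).1 (h ht)

/-- The algebra has a character with value one on the given generator and zero on the others. -/
lemma gen_ne_zero (i : Fin 4) (h : i < 2) : gen k i ≠ 0 := by
  intro h0
  have := lift_gen (k := k) (B := k) (Pi.single i 1)
    (by fin_cases i <;> simp) (fun _ _ _ => mul_comm _ _) i
  rw [h0, map_zero, Pi.single_eq_same] at this
  exact zero_ne_one this

lemma not_isDomain : ¬ IsDomain (PartialCommAlgebra k) := fun _ =>
  (mul_eq_zero.1 (gen_zero_mul_gen_one k)).elim (gen_ne_zero k 0 (by decide))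
    (gen_ne_zero k 1 (by decide))

/-- The commutator of the two generators that do not commute. -/
def commutator : PartialCommAlgebra k := gen k 2 * gen k 3 - gen k 3 * gen k 2

lemma commutator_mem : commutator k ∈ grading k 2 := by
  have h : ∀ i j, gen k i * gen k j ∈ grading k 2 := fun i j => by
    rw [grading, pow_two]
    exact Submodule.mul_mem_mul (gen_mem k i) (gen_mem k j)
  exact sub_mem (h _ _) (h _ _)

open Matrix in
lemma not_isNormalElement_commutator : ¬ IsNormalElement (commutator k) := by
  intro h
  obtain ⟨a, ha⟩ : gen k 2 * commutator k ∈ {x | ∃ a, x = commutator k * a} := by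
    rw [h]
    exact ⟨_, rfl⟩
  -- The commutator becomes the matrix unit at `(1, 0)`, and `x₂` moves row `1` to row `2`. Right
  -- multiples of the commutator have row `2` zero, whereas `x₂Ω` has entry `1` at `(2, 0)`.
  let b : Fin 4 → Matrix (Fin 3) (Fin 3) k :=
    ![0, 0, !![0, 0, 0; 1, 0, 0; 0, 1, 0], !![1, 0, 0; 0, 0, 0; 0, 0, 0]]
  let f := lift (k := k) b (by simp [b]) (fun i j h => by
    obtain rfl | rfl : i = 0 ∨ i = 1 := by omega
    all_goals simp [b])
  have hf : f (commutator k) = !![0, 0, 0; 1, 0, 0; 0, 0, 0] := by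
    rw [commutator, map_sub, map_mul, map_mul, lift_gen, lift_gen]
    ext i j
    fin_cases i <;> fin_cases j <;> simp [b]
  have h2 := congrArg (fun M : Matrix (Fin 3) (Fin 3) k => M 2 0) (congrArg f ha)
  simp only [map_mul, hf] at h2
  rw [lift_gen] at h2
  simp [b, Matrix.mul_apply, Fin.sum_univ_three] at h2

end PartialCommAlgebra

end Counterexample

/-! ### The coordinate ring of `V(x₀x₁)` as the quotient by the commutator. -/

/-- The quadric `V(x₀x₁)`. -/
def coordinateQuadric (k : Type u) [Field k] : RankTwoQuadric k where
  l₁ := MvPolynomial.X 0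
  l₂ := MvPolynomial.X 1
  hom₁ := MvPolynomial.isHomogeneous_X k 0
  hom₂ := MvPolynomial.isHomogeneous_X k 1
  linearIndependent := by
    rw [LinearIndependent.pair_iff]
    intro s t h
    constructor
    · have := congrArg (MvPolynomial.eval (Pi.single 0 1)) h
      simpa using this
    · have := congrArg (MvPolynomial.eval (Pi.single 1 1)) h
      simpa using this

namespace PartialCommAlgebra

variable (k : Type u) [Field k]

/-- The abelianization, as a map to the homogeneous coordinate ring of `V(x₀x₁)`. -/
def toCoordinateRing : PartialCommAlgebra k →ₐ[k] (coordinateQuadric k).CoordinateRing :=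
  lift (fun i => Ideal.Quotient.mk _ (MvPolynomial.X i))
    (by
      rw [← map_mul]
      exact Ideal.Quotient.eq_zero_iff_mem.2 (Ideal.mem_span_singleton_self _))
    (fun _ _ _ => mul_comm _ _)

lemma toCoordinateRing_gen (i : Fin 4) :
    toCoordinateRing k (gen k i) = Ideal.Quotient.mk _ (MvPolynomial.X i) :=
  lift_gen _ _ _ i

lemma toCoordinateRing_mem (n : ℕ) (a : PartialCommAlgebra k) (ha : a ∈ grading k n) :
    toCoordinateRing k a ∈ (coordinateQuadric k).grading n := by
  have h1 : ∀ m ∈ linearForms k, toCoordinateRing k m ∈ (coordinateQuadric k).grading 1 := by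
    intro m hm
    have : linearForms k ≤
        ((coordinateQuadric k).grading 1).comap (toCoordinateRing k).toLinearMap := by
      refine Submodule.span_le.2 ?_
      rintro _ ⟨i, rfl⟩
      exact ⟨_, MvPolynomial.isHomogeneous_X k i, (toCoordinateRing_gen k i).symm⟩
    exact this hm
  induction ha using Submodule.pow_induction_on_left' with
  | algebraMap r =>
    rw [AlgHom.commutes]
    exact SetLike.algebraMap_mem_graded (coordinateQuadric k).grading r
  | add x y i hx hy ihx ihy =>
    rw [map_add]
    exact add_mem ihx ihy
  | mem_mul m hm i x hx ih =>
    rw [map_mul, Nat.succ_eq_one_add]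
    exact SetLike.GradedMul.mul_mem (h1 m hm) ih

lemma toCoordinateRing_surjective : Function.Surjective (toCoordinateRing k) := by
  intro y
  obtain ⟨p, rfl⟩ := Ideal.Quotient.mk_surjective y
  change Ideal.Quotient.mk _ p ∈ (toCoordinateRing k).range
  induction p using MvPolynomial.induction_on with
  | C a => exact (toCoordinateRing k).range.algebraMap_mem a
  | add p q hp hq =>
    rw [map_add]
    exact add_mem hp hq
  | mul_X p i hp =>
    rw [map_mul]
    exact mul_mem hp ⟨gen k i, toCoordinateRing_gen k i⟩

/-- Modulo the commutator all generators commute, so the quotient is commutative with `x₀x₁ = 0`.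
The universal property of `k[x₀, …, x₃]/(x₀x₁)` then gives a map back, which shows that the kernel
is no larger. -/
lemma toCoordinateRing_eq_zero_iff (a : PartialCommAlgebra k) :
    toCoordinateRing k a = 0 ↔ a ∈ TwoSidedIdeal.span {commutator k} := by
  set I := TwoSidedIdeal.span {commutator k} with hI
  constructor
  · intro ha
    let π : PartialCommAlgebra k →ₐ[k] I.ringCon.Quotient := I.ringCon.mkₐ k
    have hπ : ∀ {x}, π x = 0 ↔ x ∈ I := by
      intro x
      rw [TwoSidedIdeal.mem_iff, ← RingCon.eq]
      rfl
    have hgen : ∀ i j, Commute (π (gen k i)) (π (gen k j)) := by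
      have h23 : Commute (π (gen k 2)) (π (gen k 3)) := by
        rw [commute_iff_eq, ← sub_eq_zero, ← map_mul, ← map_mul, ← map_sub, hπ]
        exact TwoSidedIdeal.subset_span rfl
      have hlt : ∀ i j, i < 2 → Commute (π (gen k i)) (π (gen k j)) := fun i j h => by
        rw [commute_iff_eq, ← map_mul, ← map_mul, gen_comm k h]
      intro i j
      by_cases hi : i < 2
      · exact hlt i j hi
      by_cases hj : j < 2
      · exact (hlt j i hj).symm
      obtain rfl | rfl : i = 2 ∨ i = 3 := by omega
      all_goals obtain rfl | rfl : j = 2 ∨ j = 3 := by omega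
      exacts [Commute.refl _, h23, h23.symm, Commute.refl _]
    have hsurj : Function.Surjective π := RingCon.mk'_surjective _
    have htop : Algebra.adjoin k (Set.range fun i => π (gen k i)) = ⊤ := by
      have : (Set.range fun i => π (gen k i)) = π '' Set.range (gen k) := by
        rw [← Set.range_comp]
        rfl
      rw [this, ← AlgHom.map_adjoin, adjoin_gen, Algebra.map_top, AlgHom.range_eq_top]
      exact hsurj
    have hcomm : ∀ x y : I.ringCon.Quotient, x * y = y * x := by
      have := Algebra.isMulCommutative_adjoin k
        (s := Set.range fun i => π (gen k i)) (by
          rintro _ ⟨i, rfl⟩ _ ⟨j, rfl⟩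
          exact hgen i j)
      intro x y
      have hx : x ∈ Algebra.adjoin k (Set.range fun i => π (gen k i)) := htop ▸ trivial
      have hy : y ∈ Algebra.adjoin k (Set.range fun i => π (gen k i)) := htop ▸ trivial
      exact congrArg Subtype.val (mul_comm'
        (⟨x, hx⟩ : Algebra.adjoin k (Set.range fun i => π (gen k i))) ⟨y, hy⟩)
    let _ : CommRing I.ringCon.Quotient :=
      { (inferInstance : Ring I.ringCon.Quotient) with mul_comm := hcomm }
    let κ : (coordinateQuadric k).CoordinateRing →ₐ[k] I.ringCon.Quotient :=
      Ideal.Quotient.liftₐ _ (MvPolynomial.aeval fun i => π (gen k i)) (by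
        intro p hp
        obtain ⟨q, rfl⟩ := Ideal.mem_span_singleton'.1 hp
        rw [map_mul]
        have : MvPolynomial.aeval (fun i => π (gen k i))
            ((coordinateQuadric k).l₁ * (coordinateQuadric k).l₂) = 0 := by
          rw [map_mul]
          refine (congrArg₂ (· * ·) (MvPolynomial.aeval_X _ 0) (MvPolynomial.aeval_X _ 1)).trans ?_
          exact (map_mul π _ _).symm.trans
            ((congrArg π (gen_zero_mul_gen_one k)).trans (map_zero π))
        rw [this, mul_zero])
    have hκ : κ.comp (toCoordinateRing k) = π := hom_ext fun i => by
      rw [AlgHom.comp_apply, toCoordinateRing_gen]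
      exact MvPolynomial.aeval_X _ i
    rw [← hπ, ← hκ, AlgHom.comp_apply, ha, map_zero]
  · intro ha
    have h : I ≤ TwoSidedIdeal.ker (toCoordinateRing k) :=
      TwoSidedIdeal.span_le.2 fun r hr => (TwoSidedIdeal.mem_ker _).2 (by
        rw [Set.mem_singleton_iff.1 hr, commutator, map_sub, map_mul, map_mul, mul_comm, sub_self])
    exact (TwoSidedIdeal.mem_ker _).1 (h ha)

end PartialCommAlgebra

/-- Over every field there is a quadratic algebra, not a domain, with a homogeneous coordinate ring
of a rank-two quadric as a quotient by an element of degree two that is not normal. -/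
theorem exists_not_isNormalElement (k : Type u) [Field k] :
    ∃ (Q : RankTwoQuadric k) (L : InvertibleSheaf Q.scheme)
      (A : Type u) (_ : Ring A) (_ : Algebra k A) (𝒜 : ℕ → Submodule k A) (_ : GradedAlgebra 𝒜)
      (Ω : A), IsQuadratic 𝒜 ∧ ¬ IsDomain A ∧ Ω ∈ 𝒜 2 ∧
        L.IsQuotientBy (𝟙 Q.scheme) Q.toSpec 𝒜 Ω ∧ ¬ IsNormalElement Ω := by
  obtain ⟨D, -⟩ := (coordinateQuadric k).exists_doublePlane
  exact ⟨coordinateQuadric k, D.hyperplaneSheaf, PartialCommAlgebra k, inferInstance,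
    inferInstance, PartialCommAlgebra.grading k, inferInstance, PartialCommAlgebra.commutator k,
    PartialCommAlgebra.isQuadratic k, PartialCommAlgebra.not_isDomain k,
    PartialCommAlgebra.commutator_mem k,
    D.isQuotientBy_of_algHom (PartialCommAlgebra.toCoordinateRing k)
      (PartialCommAlgebra.toCoordinateRing_mem k) (PartialCommAlgebra.toCoordinateRing_surjective k)
      (PartialCommAlgebra.toCoordinateRing_eq_zero_iff k),
    PartialCommAlgebra.not_isNormalElement_commutator k⟩

end TwistedQuadric

end

/-- If `A` is a quadratic domain and `Ω ∈ A₂` is such that `A/⟨Ω⟩` is the twisted homogeneous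
coordinate ring `S(Q, τ, L)` of a rank-two quadric `Q` in `ℙ³`, then `Ω` is normal in `A`; and this
fails for quadratic algebras that are not domains. -/
theorem proposition1p5 (k : Type u) [Field k] :
    (∀ (Q : TwistedQuadric.RankTwoQuadric k) (τ : Q.scheme ≅ Q.scheme),
      τ.hom ≫ Q.toSpec = Q.toSpec →
      ∀ (L : TwistedQuadric.InvertibleSheaf Q.scheme)
        (A : Type v) [Ring A] [Algebra k A] (𝒜 : ℕ → Submodule k A) [GradedAlgebra 𝒜],
        TwistedQuadric.IsQuadratic 𝒜 → IsDomain A →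
        ∀ Ω ∈ 𝒜 2, L.IsQuotientBy τ.hom Q.toSpec 𝒜 Ω →
          TwistedQuadric.IsNormalElement Ω) ∧
    (∃ (Q : TwistedQuadric.RankTwoQuadric k) (L : TwistedQuadric.InvertibleSheaf Q.scheme)
        (A : Type u) (_ : Ring A) (_ : Algebra k A) (𝒜 : ℕ → Submodule k A) (_ : GradedAlgebra 𝒜)
        (Ω : A),
        TwistedQuadric.IsQuadratic 𝒜 ∧ ¬ IsDomain A ∧ Ω ∈ 𝒜 2 ∧
          L.IsQuotientBy (𝟙 Q.scheme) Q.toSpec 𝒜 Ω ∧ ¬ TwistedQuadric.IsNormalElement Ω) := by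
  refine ⟨?_, ?_⟩
  · intro Q τ _ L A _ _ 𝒜 _ hq _ Ω hΩ hA
    exact Q.isNormalElement τ L hq hΩ hA
  · exact TwistedQuadric.exists_not_isNormalElement k
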